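/- All graphs are finite, simple and undirected. For a graph $G$, let $E(G)$ be its energy, i.e. the sum of the absolute values of the eigenvalues (with multiplicity) of its adjacency matrix. Let $\mathrm{ch}(G)$ be its choice number, i.e. the smallest $k$ such that for every assignment of sets $L_v$ of $k$ distinct elements to the vertices $v$ of $G$ one can choose $\ell_v\in L_v$ for all $v$ so that $\ell_u\ne\ell_v$ whenever $u$ and $v$ are adjacent. For $1\le t\le n-1$ let $A_{n,t}$ be the graph obtained by joining a new vertex to $t$ vertices of the complete graph $K_n$, and for $n\ge 1$ let $B_n$ be the graph of order $n+2$ obtained by adding two pendant vertices to one vertex of $K_n$. Then, for every graph $G$, $E(G)<2\,\mathrm{ch}(G)$ if and only if $G$ is a disjoint union of some (possibly no) isolated vertices and one of the following graphs: (i) the complete graph $K_n$, $n\ge 1$; (ii) the graph $B_n$, $n\ge 1$; (iii) the graph $A_{n,t}$ with $1\le t\le n-1$, where either $n\le 7$ and $(n,t)\neq(7,4)$, or $n\ge 8$ and $t\in\{1,2,n-1\}$; (iv) a triangle with two pendant vertices adjacent to different vertices of the triangle; (v) the complete bipartite graph $K_{2,4}$. Equivalently, $E(G)\ge 2\,\mathrm{ch}(G)$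 holds precisely for all other graphs $G$. -/

import Mathlib

namespace GraphEnergy

open SimpleGraph

/-- The energy of a finite graph: the sum of the absolute values of all eigenvalues (counted with
multiplicity) of its real adjacency matrix. -/
noncomputable def energy {V : Type*} [Fintype V] [DecidableEq V] (G : SimpleGraph V)
    [DecidableRel G.Adj] : ℝ :=
  ∑ i : V, |(G.isHermitian_adjMatrix ℝ).eigenvalues i|

/-- `G` is `k`-choosable: for every assignment of a set `L v` of `k` elements to each vertex `v`
one can pick `c v ∈ L v` for all `v` so that adjacent vertices get distinct elements. -/
def Choosable {V : Type*} (G : SimpleGraph V) (k : ℕ) : Prop :=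
  ∀ (α : Type) (L : V → Finset α), (∀ v, (L v).card = k) →
    ∃ c : V → α, (∀ v, c v ∈ L v) ∧ ∀ u v, G.Adj u v → c u ≠ c v

/-- The choice number: the smallest `k` such that `G` is `k`-choosable. -/
noncomputable def choiceNumber {V : Type*} (G : SimpleGraph V) : ℕ :=
  sInf {k : ℕ | Choosable G k}

/-- For a finite graph the minimum in the definition of the choice number is attained. -/
theorem isLeast_choiceNumber {V : Type*} [Fintype V] (G : SimpleGraph V) :
    IsLeast {k : ℕ | Choosable G k} (choiceNumber G) := by
  classical
  have hne : {k : ℕ | Choosable G k}.Nonempty := by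
    refine ⟨Fintype.card V, fun α L hL => ?_⟩
    obtain ⟨c, hc, hmem⟩ := (Finset.all_card_le_biUnion_card_iff_exists_injective L).1
      (fun s => by
        rcases s.eq_empty_or_nonempty with rfl | ⟨v, hv⟩
        · simp
        · calc s.card ≤ Fintype.card V := Finset.card_le_univ s
            _ = (L v).card := (hL v).symm
            _ ≤ (s.biUnion L).card := Finset.card_le_card (Finset.subset_biUnion_of_mem L hv))
    exact ⟨c, hmem, fun u v huv h => huv.ne (hc h)⟩
  exact ⟨Nat.sInf_mem hne, fun k hk => Nat.sInf_le hk⟩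

/-- `A n t`: the complete graph on `n` vertices together with one new vertex (`none`), joined to
`t` of them (those with index less than `t`). Meant for `1 ≤ t ≤ n - 1`. -/
def A (n t : ℕ) : SimpleGraph (Option (Fin n)) :=
  SimpleGraph.fromRel fun x y =>
    match x, y with
    | some _, some _ => True
    | none, some j => j.val < t
    | _, none => False

/-- `B n`: the complete graph on `n` vertices with two pendant vertices (`Sum.inr 0`, `Sum.inr 1`)
attached to one and the same of its vertices (that with index `0`). Meant for `1 ≤ n`. -/
def B (n : ℕ) : SimpleGraph (Fin n ⊕ Fin 2) :=
  SimpleGraph.fromRel fun x y =>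
    match x, y with
    | Sum.inl _, Sum.inl _ => True
    | Sum.inl i, Sum.inr _ => i.val = 0
    | Sum.inr _, _ => False

/-- The triangle `0, 1, 2` with a pendant vertex `3` attached to `0` and a pendant vertex `4`
attached to `1`. -/
def triangleTwoPendants : SimpleGraph (Fin 5) :=
  SimpleGraph.fromEdgeSet {s(0, 1), s(0, 2), s(1, 2), s(0, 3), s(1, 4)}

/-- `G` is the disjoint union of a copy of `H` and some (possibly no) isolated vertices. -/
def IsUnionWithIsolated {V W : Type*} (G : SimpleGraph V) (H : SimpleGraph W) : Prop :=
  ∃ m : ℕ, Nonempty (G ≃g H ⊕g (⊥ : SimpleGraph (Fin m)))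

end GraphEnergy

namespace GraphEnergy

open SimpleGraph Finset

/-! ### Spectral decomposition and Ky Fan's inequality -/

section Spectral

variable {V : Type*} [Fintype V] [DecidableEq V] (G : SimpleGraph V) [DecidableRel G.Adj]

/-! Lower bounds. The adjacency matrix has trace zero, so Ky Fan's principle gives 2|tr(AX)| ≤ E(G)
whenever 0 ≤ X ≤ 1; in particular E(G) is at least twice the absolute value of any sum of Rayleigh
quotients of orthogonal vectors. Three uses carry the proof. A vertex set H covered by D cliques
gives E ≥ 2(|H| - D) (`card_sub_cliqueCover_le_energy`). A clique of order n and k orthogonal test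
vectors with quotient sum q give E ≥ 2(n - 1 - k - q) (`clique_sub_rayleigh_le_energy`). The
indicator of a set inducing minimum degree at least d has quotient at least d. Besides, E² ≥
4|E(G)|.

Finding a clique (`exists_clique_or_completeBipartite`). Let E < 2 ch(G) with ch(G) = d + 1 ≥ 2. A
minimal set H inducing a non-d-choosable subgraph has minimum degree at least d. With |H| = d + 1 +
D, the complement on H has maximum degree at most D and is not D-colourable, by the clique cover
bound. A Kempe chain argument (`exists_clique_or_induced_cycle`) yields in this complement an
induced cycle of length at least 4 or a clique of order D + 1. The cycle supplies vectors orthogonal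
to the indicator of H, with quotient sum at least 1, so E ≥ 2(d + 1), a contradiction. The clique is
an independent set S of G completely joined to the d remaining vertices T. If T is a clique, T and a
vertex of S form a clique of order ch(G). Otherwise |S| ≥ 2d, since else H would be d-choosable
(`choosableOn_of_card_lt`), and the bound by the number of edges leaves only K_{2,4}.

Around the clique (`classification_of_clique`). Let Q be a clique of order n = ch(G) and E < 2n.
Clique covers and explicit test vectors exclude edges outside Q and all but a few ways of attaching
vertices to Q. One attached vertex with t neighbours requires t(n + 1 - t) < 2(n + 1), which is the
numerical condition on A_{n,t}.

Converse. The choice number is bounded below by a clique, or by bad lists for K_{2,4}. For K_n,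
A_{n,t} and B_n, an independent set bounds the number of negative eigenvalues, at most one of them
is below -1, and all exceed -2 (`energy_lt_of_quadForm`). The two sporadic graphs are written as
explicit differences of positive semidefinite matrices. -/

/-- The quadratic form of the adjacency matrix. -/
noncomputable def quadForm (x : V → ℝ) : ℝ :=
  ∑ i, ∑ j, G.adjMatrix ℝ i j * (x i * x j)

/-- The rows `U j` are orthonormal eigenvectors; everything later is done with finite sums in these
coordinates. -/
theorem exists_spectral_decomposition :
    ∃ (lam : V → ℝ) (U : V → V → ℝ),
      (∀ i k, G.adjMatrix ℝ i k = ∑ j, lam j * (U j i * U j k)) ∧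
      (∀ i k, ∑ j, U j i * U j k = if i = k then 1 else 0) ∧
      (∀ j l, ∑ i, U j i * U l i = if j = l then 1 else 0) ∧
      energy G = ∑ j, |lam j| ∧ ∑ j, lam j = 0 := by
  have hA := G.isHermitian_adjMatrix ℝ
  refine ⟨hA.eigenvalues, fun j i => (hA.eigenvectorUnitary : Matrix V V ℝ) i j, ?_, ?_, ?_, rfl, ?_⟩
  · intro i k
    have h := hA.spectral_theorem
    rw [Unitary.conjStarAlgAut_apply] at h
    have h2 := congrFun (congrFun h i) k
    rw [h2, Matrix.mul_apply]
    refine Finset.sum_congr rfl fun j _ => ?_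
    rw [Matrix.mul_diagonal]
    simp [Matrix.star_apply]
    ring
  · intro i k
    have h := Unitary.coe_mul_star_self hA.eigenvectorUnitary
    have h2 := congrFun (congrFun h i) k
    rw [Matrix.mul_apply, Matrix.one_apply] at h2
    simpa [Matrix.star_apply] using h2
  · intro i k
    have h := Unitary.coe_star_mul_self hA.eigenvectorUnitary
    have h2 := congrFun (congrFun h i) k
    rw [Matrix.mul_apply, Matrix.one_apply] at h2
    simpa [Matrix.star_apply] using h2
  · have h := hA.trace_eq_sum_eigenvalues
    rw [SimpleGraph.trace_adjMatrix] at h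
    simpa using h.symm

/-- If `0 ≤ X ≤ 1` as quadratic forms, then `|tr (A X)|` is at most half the energy. -/
theorem abs_sum_mul_le_energy (X : V → V → ℝ)
    (h0 : ∀ x : V → ℝ, 0 ≤ ∑ i, ∑ j, X i j * (x i * x j))
    (h1 : ∀ x : V → ℝ, ∑ i, ∑ j, X i j * (x i * x j) ≤ ∑ i, x i ^ 2) :
    2 * |∑ i, ∑ j, G.adjMatrix ℝ i j * X i j| ≤ energy G := by
  obtain ⟨lam, U, hA, -, hU, hE, h_tr⟩ := exists_spectral_decomposition G
  set c : V → ℝ := fun k => ∑ i, ∑ j, X i j * (U k i * U k j) with hc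
  have hc0 : ∀ k, 0 ≤ c k := fun k => h0 _
  have hc1 : ∀ k, c k ≤ 1 := fun k => by
    refine (h1 (U k)).trans (le_of_eq ?_)
    have := hU k k
    simpa [sq] using this
  have e1 : ∑ i, ∑ j, G.adjMatrix ℝ i j * X i j = ∑ k, lam k * c k := by
    simp only [hA, hc, Finset.sum_mul, Finset.mul_sum]
    rw [Finset.sum_comm' (t' := univ) (s' := fun _ => univ) (by simp)]
    rw [Finset.sum_comm]
    have : ∀ i : V, ∑ j, ∑ k, lam k * (U k j * U k i) * X j i =
        ∑ k, ∑ j, lam k * (U k j * U k i) * X j i := fun i => Finset.sum_comm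
    rw [Finset.sum_comm]
    simp only [this]
    rw [Finset.sum_comm]
    refine Finset.sum_congr rfl fun k _ => ?_
    rw [Finset.sum_comm]
    refine Finset.sum_congr rfl fun i _ => Finset.sum_congr rfl fun j _ => ?_
    ring
  -- Trace zero permits recentring the weights from [0, 1] to [-1/2, 1/2]; this is the source of the
  -- factor 2 in the bound.
  have e2 : ∑ k, lam k * c k = ∑ k, lam k * (c k - 1 / 2) := by
    simp only [mul_sub, Finset.sum_sub_distrib, ← Finset.sum_mul, h_tr]
    ring
  rw [e1, e2, hE]
  calc 2 * |∑ k, lam k * (c k - 1 / 2)| ≤ 2 * ∑ k, |lam k * (c k - 1 / 2)| := by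
        gcongr; exact Finset.abs_sum_le_sum_abs _ _
    _ ≤ 2 * ∑ k, |lam k| * (1 / 2) := by
        gcongr with k
        rw [abs_mul]
        gcongr
        rw [abs_le]; constructor <;> linarith [hc0 k, hc1 k]
    _ = ∑ j, |lam j| := by rw [← Finset.sum_mul]; ring

omit [DecidableEq V] in
/-- Bessel's inequality in coordinates. -/
theorem sum_sq_dot_le {ι : Type*} [Fintype ι] [DecidableEq ι] (u : ι → V → ℝ)
    (hu : ∀ a b, ∑ i, u a i * u b i = if a = b then 1 else 0) (x : V → ℝ) :
    ∑ a, (∑ i, u a i * x i) ^ 2 ≤ ∑ i, x i ^ 2 := by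
  set d : ι → ℝ := fun a => ∑ i, u a i * x i with hd
  have h : 0 ≤ ∑ i, (x i - ∑ a, d a * u a i) ^ 2 := Finset.sum_nonneg fun i _ => sq_nonneg _
  have e1 : ∑ i, x i * ∑ a, d a * u a i = ∑ a, d a ^ 2 := by
    simp only [Finset.mul_sum]
    rw [Finset.sum_comm]
    refine Finset.sum_congr rfl fun a _ => ?_
    rw [sq]
    nth_rewrite 3 [hd]
    simp only [Finset.mul_sum]
    exact Finset.sum_congr rfl fun i _ => by ring
  have e2 : ∑ i, (∑ a, d a * u a i) ^ 2 = ∑ a, d a ^ 2 := by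
    simp only [sq, Finset.sum_mul_sum]
    rw [Finset.sum_comm]
    refine Finset.sum_congr rfl fun a _ => ?_
    rw [Finset.sum_comm]
    have : ∀ b, ∑ i, d a * u a i * (d b * u b i) = d a * d b * if a = b then 1 else 0 := by
      intro b
      rw [← hu a b, Finset.mul_sum]
      exact Finset.sum_congr rfl fun i _ => by ring
    simp [this]
  have e3 : ∑ i, (x i - ∑ a, d a * u a i) ^ 2
      = ∑ i, x i ^ 2 - 2 * ∑ i, x i * ∑ a, d a * u a i + ∑ i, (∑ a, d a * u a i) ^ 2 := by
    rw [Finset.mul_sum, ← Finset.sum_sub_distrib, ← Finset.sum_add_distrib]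
    exact Finset.sum_congr rfl fun i _ => by ring
  rw [e3, e1, e2] at h
  linarith

/-- Ky Fan's inequality for an orthonormal family. -/
theorem abs_sum_quadForm_le_energy {ι : Type*} [Fintype ι] [DecidableEq ι] (u : ι → V → ℝ)
    (hu : ∀ a b, ∑ i, u a i * u b i = if a = b then 1 else 0) :
    2 * |∑ a, quadForm G (u a)| ≤ energy G := by
  have key : ∀ x : V → ℝ, ∑ i, ∑ j, (∑ a, u a i * u a j) * (x i * x j)
      = ∑ a, (∑ i, u a i * x i) ^ 2 := by
    intro x
    simp only [sq, Finset.sum_mul_sum]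
    rw [Finset.sum_comm]
    simp only [Finset.sum_mul]
    rw [Finset.sum_comm]
    have : ∀ i, ∑ j, ∑ a, u a i * u a j * (x i * x j)
        = ∑ a, ∑ j, u a i * u a j * (x i * x j) := fun i => Finset.sum_comm
    simp only [this]
    rw [Finset.sum_comm]
    exact Finset.sum_congr rfl fun a _ => Finset.sum_congr rfl fun i _ =>
      Finset.sum_congr rfl fun j _ => by ring
  have h := abs_sum_mul_le_energy G (fun i j => ∑ a, u a i * u a j)
    (fun x => by rw [key]; exact Finset.sum_nonneg fun a _ => sq_nonneg _)
    (fun x => by rw [key]; exact sum_sq_dot_le u hu x)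
  have e : ∑ a, quadForm G (u a) = ∑ i, ∑ j, G.adjMatrix ℝ i j * ∑ a, u a i * u a j := by
    simp only [quadForm, Finset.mul_sum]
    rw [Finset.sum_comm]
    refine Finset.sum_congr rfl fun i _ => Finset.sum_comm
  rw [e]; exact h

omit [DecidableEq V] in
theorem quadForm_smul (c : ℝ) (x : V → ℝ) :
    quadForm G (fun i => c * x i) = c ^ 2 * quadForm G x := by
  simp only [quadForm, Finset.mul_sum]
  exact Finset.sum_congr rfl fun i _ => Finset.sum_congr rfl fun j _ => by ring

/-- The energy dominates twice the sum of the Rayleigh quotients of an orthogonal family. -/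
theorem sum_rayleigh_le_energy {ι : Type*} [Fintype ι] [DecidableEq ι] (w : ι → V → ℝ)
    (hw : ∀ a b, a ≠ b → ∑ i, w a i * w b i = 0) (hpos : ∀ a, 0 < ∑ i, w a i ^ 2) :
    2 * |∑ a, quadForm G (w a) / ∑ i, w a i ^ 2| ≤ energy G := by
  have h := abs_sum_quadForm_le_energy G (fun a i => (√(∑ i, w a i ^ 2))⁻¹ * w a i) (by
    intro a b
    have e : ∑ i, (√(∑ i, w a i ^ 2))⁻¹ * w a i * ((√(∑ i, w b i ^ 2))⁻¹ * w b i)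
        = (√(∑ i, w a i ^ 2))⁻¹ * (√(∑ i, w b i ^ 2))⁻¹ * ∑ i, w a i * w b i := by
      rw [Finset.mul_sum]
      exact Finset.sum_congr rfl fun i _ => by ring
    rw [e]
    split_ifs with hab
    · subst hab
      rw [← mul_inv, Real.mul_self_sqrt (hpos a).le]
      have : ∑ i, w a i * w a i = ∑ i, w a i ^ 2 := by simp [sq]
      rw [this, inv_mul_cancel₀ (hpos a).ne']
    · rw [hw a b hab, mul_zero])
  simp only [quadForm_smul] at h
  convert h using 5 with a
  rw [inv_pow, Real.sq_sqrt (hpos a).le]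
  ring

end Spectral

/-! ### Lower bounds for the energy from cliques -/

section Spectral

variable {V : Type*} [Fintype V] [DecidableEq V] (G : SimpleGraph V) [DecidableRel G.Adj]

/-- On a clique the adjacency matrix is J - I, so sum-zero vectors supported there have Rayleigh
quotient -1. -/
theorem quadForm_eq_of_isClique {Q : Finset V} (hQ : G.IsClique Q) {x : V → ℝ}
    (hx : ∀ i, i ∉ Q → x i = 0) :
    quadForm G x = (∑ i, x i) ^ 2 - ∑ i, x i ^ 2 := by
  have h : ∀ i j, G.adjMatrix ℝ i j * (x i * x j) = x i * x j - if i = j then x i * x j else 0 := by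
    intro i j
    by_cases hi : i ∈ Q
    · by_cases hj : j ∈ Q
      · by_cases hij : i = j
        · subst hij; simp
        · simp [hij, hQ hi hj hij]
      · simp [hx j hj]
    · simp [hx i hi]
  simp only [quadForm, h, Finset.sum_sub_distrib, sq, Finset.sum_mul_sum]
  simp

omit [DecidableEq V] in
/-- An orthonormal family of vectors supported on `Q`, of coordinate sum zero, and orthogonal to
given vectors. -/
theorem exists_orthonormal_sum_zero (Q : Finset V) {ι : Type*} [Fintype ι] (w : ι → V → ℝ) :
    ∃ (e : ℕ) (b : Fin e → V → ℝ), #Q ≤ e + 1 + Fintype.card ι ∧ (∀ k, ∀ i ∉ Q, b k i = 0) ∧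
      (∀ k, ∑ i, b k i = 0) ∧ (∀ k a, ∑ i, w a i * b k i = 0) ∧
      ∀ k l, ∑ i, b k i * b l i = if k = l then 1 else 0 := by
  classical
  -- All constraints together form one linear map; its kernel has dimension at least |Q| - 1 - |ι|
  -- by rank-nullity, and any orthonormal basis of it will do.
  obtain ⟨L, hL⟩ : ∃ L : EuclideanSpace ℝ V →ₗ[ℝ] ({i // i ∉ Q} → ℝ) × ℝ × (ι → ℝ),
      ∀ x, L x = (fun i => x i.1, ∑ i, x i, fun a => ∑ i, w a i * x i) :=
    ⟨{ toFun := fun x => (fun i => x i.1, ∑ i, x i, fun a => ∑ i, w a i * x i)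
       map_add' := fun x y => by
        ext <;> simp [Finset.sum_add_distrib, mul_add]
       map_smul' := fun c x => by
        ext <;> simp [Finset.mul_sum, mul_left_comm] }, fun _ => rfl⟩
  have hrank := LinearMap.finrank_range_add_finrank_ker L
  have hle : Module.finrank ℝ (LinearMap.range L) ≤
      (Fintype.card V - #Q) + (1 + Fintype.card ι) := by
    refine (Submodule.finrank_le _).trans (le_of_eq ?_)
    rw [Module.finrank_prod, Module.finrank_prod, Module.finrank_fintype_fun_eq_card,
      Module.finrank_fintype_fun_eq_card, Module.finrank_self]
    congr 1
    rw [Fintype.card_subtype_compl]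
    simp
  rw [finrank_euclideanSpace] at hrank
  have hQV : #Q ≤ Fintype.card V := Finset.card_le_univ Q
  obtain ⟨b⟩ : Nonempty (OrthonormalBasis (Fin (Module.finrank ℝ (LinearMap.ker L))) ℝ
    (LinearMap.ker L)) := ⟨stdOrthonormalBasis ℝ (LinearMap.ker L)⟩
  have hker : ∀ k, (((fun i => (b k : EuclideanSpace ℝ V) i.1, ∑ i, (b k : EuclideanSpace ℝ V) i,
      fun a => ∑ i, w a i * (b k : EuclideanSpace ℝ V) i) :
      ({i // i ∉ Q} → ℝ) × ℝ × (ι → ℝ))) = 0 := fun k => (hL _).symm.trans (b k).2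
  refine ⟨Module.finrank ℝ (LinearMap.ker L), fun k i => (b k : EuclideanSpace ℝ V) i, by omega,
    fun k i hi => congrFun (congrArg Prod.fst (hker k)) ⟨i, hi⟩,
    fun k => congrArg (fun p => p.2.1) (hker k),
    fun k a => congrFun (congrArg (fun p => p.2.2) (hker k)) a, fun k l => ?_⟩
  have h := orthonormal_iff_ite.1 b.orthonormal k l
  rw [← h, Submodule.coe_inner, PiLp.inner_apply]
  exact Finset.sum_congr rfl fun i _ => by simp [mul_comm]

/-- A clique on `n` vertices contributes `n - 1` eigenvalues `-1`, up to the dimension spanned by a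
given orthogonal family. -/
theorem clique_sub_rayleigh_le_energy {Q : Finset V} (hQ : G.IsClique Q)
    {ι : Type*} [Fintype ι] [DecidableEq ι] (w : ι → V → ℝ)
    (hw : ∀ a b, a ≠ b → ∑ i, w a i * w b i = 0) (hpos : ∀ a, 0 < ∑ i, w a i ^ 2) :
    2 * ((#Q : ℝ) - 1 - Fintype.card ι - ∑ a, quadForm G (w a) / ∑ i, w a i ^ 2) ≤ energy G := by
  obtain ⟨e, b, hdim, hb0, hbs, hbw, hbo⟩ := exists_orthonormal_sum_zero Q w
  have hbn : ∀ k, ∑ i, b k i ^ 2 = 1 := fun k => by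
    simpa [sq] using hbo k k
  have h := sum_rayleigh_le_energy G (Sum.elim w b) (by
      rintro (a | k) (a' | l) hne
      · exact hw a a' (fun h => hne (by rw [h]))
      · exact hbw l a
      · simpa [mul_comm] using hbw k a'
      · have : k ≠ l := fun h => hne (by rw [h])
        simpa [this] using hbo k l) (by
      rintro (a | k)
      · exact hpos a
      · simp [hbn])
  rw [Fintype.sum_sum_type] at h
  have hq : ∀ k, quadForm G (b k) = -1 := fun k => by
    rw [quadForm_eq_of_isClique G hQ (hb0 k), hbs, hbn]; norm_num
  simp only [Sum.elim_inl, Sum.elim_inr, hq, hbn, Finset.sum_const, Finset.card_univ,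
    Fintype.card_fin, nsmul_eq_mul] at h
  have h3 := neg_le_abs (∑ a, quadForm G (w a) / ∑ i, w a i ^ 2 + e * ((-1 : ℝ) / 1))
  have h4 : ((#Q : ℕ) : ℝ) ≤ e + 1 + Fintype.card ι := by exact_mod_cast hdim
  have h5 := (mul_le_mul_of_nonneg_left h3 (by norm_num : (0:ℝ) ≤ 2)).trans h
  linarith

/-- A vertex set covered by `D` cliques. -/
theorem card_sub_cliqueCover_le_energy (H : Finset V) (c : V → ℕ) (D : ℕ) (hD : ∀ v ∈ H, c v < D)
    (hc : ∀ u ∈ H, ∀ v ∈ H, u ≠ v → c u = c v → G.Adj u v) :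
    2 * ((#H : ℝ) - D) ≤ energy G := by
  set S : ℕ → Finset V := fun k => H.filter (fun v => c v = k) with hS
  -- `X` is the sum of the orthogonal projections onto the sum-zero vectors supported on the single
  -- cliques `S k`; on each nonempty clique tr(AX) picks up 1 - |S k|.
  set X : V → V → ℝ := fun i j => ∑ k ∈ range D,
    (if i ∈ S k then 1 else 0) * (if j ∈ S k then 1 else 0) *
      ((if i = j then 1 else 0) - 1 / (#(S k) : ℝ)) with hX
  have hform : ∀ x : V → ℝ, ∑ i, ∑ j, X i j * (x i * x j)
      = ∑ k ∈ range D, (∑ i ∈ S k, x i ^ 2 - (∑ i ∈ S k, x i) ^ 2 / #(S k)) := by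
    intro x
    have e : ∀ k, ∑ i, ∑ j, ((if i ∈ S k then (1:ℝ) else 0) * (if j ∈ S k then 1 else 0) *
        ((if i = j then 1 else 0) - 1 / (#(S k) : ℝ))) * (x i * x j)
        = ∑ i ∈ S k, x i ^ 2 - (∑ i ∈ S k, x i) ^ 2 / #(S k) := by
      intro k
      have e1 : ∀ i j, ((if i ∈ S k then (1:ℝ) else 0) * (if j ∈ S k then 1 else 0) *
          ((if i = j then 1 else 0) - 1 / (#(S k) : ℝ))) * (x i * x j)
          = (if i = j then (if i ∈ S k then x i ^ 2 else 0) else 0) -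
            (if i ∈ S k then x i else 0) * (if j ∈ S k then x j else 0) / #(S k) := by
        intro i j
        by_cases hij : i = j
        · subst hij
          by_cases hi : i ∈ S k <;> simp [hi]; ring
        · by_cases hi : i ∈ S k <;> by_cases hj : j ∈ S k <;> simp [hi, hj, hij]; ring
      simp only [e1, Finset.sum_sub_distrib, ← Finset.sum_div, ← Finset.sum_mul_sum]
      rw [sq (∑ i ∈ S k, x i)]
      simp
    simp only [hX, Finset.sum_mul]
    rw [← Finset.sum_congr rfl fun k _ => e k]
    rw [Finset.sum_comm]
    refine Eq.trans ?_ (Finset.sum_comm)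
    rw [Finset.sum_comm]
    exact Finset.sum_congr rfl fun i _ => Finset.sum_comm
  have htr : ∑ i, ∑ j, G.adjMatrix ℝ i j * X i j ≤ -((#H : ℝ) - D) := by
    have e : ∀ k ∈ range D, ∑ i, ∑ j, G.adjMatrix ℝ i j * ((if i ∈ S k then (1:ℝ) else 0) *
        (if j ∈ S k then 1 else 0) * ((if i = j then 1 else 0) - 1 / (#(S k) : ℝ)))
        ≤ 1 - #(S k) := by
      intro k _
      have e1 : ∀ i j, G.adjMatrix ℝ i j * ((if i ∈ S k then (1:ℝ) else 0) *
          (if j ∈ S k then 1 else 0) * ((if i = j then 1 else 0) - 1 / (#(S k) : ℝ)))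
          = (if i = j then (if i ∈ S k then 1 / (#(S k) : ℝ) else 0) else 0) -
            (if i ∈ S k then 1 else 0) * (if j ∈ S k then 1 else 0) / #(S k) := by
        intro i j
        by_cases hij : i = j
        · subst hij
          by_cases hi : i ∈ S k <;> simp [hi]
        · by_cases hi : i ∈ S k <;> by_cases hj : j ∈ S k <;> simp [hi, hj, hij]
          have hi' := Finset.mem_filter.1 hi
          have hj' := Finset.mem_filter.1 hj
          simp [hc i hi'.1 j hj'.1 hij (hi'.2.trans hj'.2.symm)]
      simp only [e1, Finset.sum_sub_distrib, ← Finset.sum_div, ← Finset.sum_mul_sum]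
      -- An empty class contributes 0 instead of 1, with 1 / 0 = 0; hence only an inequality.
      by_cases h0 : #(S k) = 0
      · simp [h0]
      · have : (#(S k) : ℝ) ≠ 0 := by exact_mod_cast h0
        simp [this]
    have hH : #H = ∑ k ∈ range D, #(S k) :=
      Finset.card_eq_sum_card_fiberwise (fun v hv => by simpa using hD v hv)
    calc ∑ i, ∑ j, G.adjMatrix ℝ i j * X i j = _ := by
          simp only [hX, Finset.mul_sum]
          have : ∀ i : V, ∑ j : V, ∑ k ∈ range D, G.adjMatrix ℝ i j *
              ((if i ∈ S k then (1:ℝ) else 0) *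
              (if j ∈ S k then 1 else 0) * ((if i = j then 1 else 0) - 1 / (#(S k) : ℝ)))
            = ∑ k ∈ range D, ∑ j : V, G.adjMatrix ℝ i j *
              ((if i ∈ S k then (1:ℝ) else 0) *
              (if j ∈ S k then 1 else 0) * ((if i = j then 1 else 0) - 1 / (#(S k) : ℝ))) :=
            fun i => Finset.sum_comm
          simp only [this]
          exact Finset.sum_comm
      _ ≤ ∑ k ∈ range D, (1 - (#(S k) : ℝ)) := Finset.sum_le_sum e
      _ = -((#H : ℝ) - D) := by
          rw [hH, Finset.sum_sub_distrib]; simp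
  have h := abs_sum_mul_le_energy G X (fun x => by
      rw [hform]
      refine Finset.sum_nonneg fun k _ => ?_
      rw [sub_nonneg]
      refine div_le_of_le_mul₀ (by positivity) (Finset.sum_nonneg fun _ _ => sq_nonneg _) ?_
      rw [mul_comm]
      exact sq_sum_le_card_mul_sum_sq)
    (fun x => by
      rw [hform]
      calc _ ≤ ∑ k ∈ range D, ∑ i ∈ S k, x i ^ 2 := by
            refine Finset.sum_le_sum fun k _ => ?_
            have : 0 ≤ (∑ i ∈ S k, x i) ^ 2 / (#(S k) : ℝ) := by positivity
            linarith
        _ = ∑ i ∈ H, x i ^ 2 :=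
            Finset.sum_fiberwise_of_maps_to (fun v hv => by simpa using hD v hv) _
        _ ≤ ∑ i, x i ^ 2 := Finset.sum_le_sum_of_subset_of_nonneg (Finset.subset_univ _)
            (fun _ _ _ => sq_nonneg _))
  have h3 := neg_le_abs (∑ i, ∑ j, G.adjMatrix ℝ i j * X i j)
  linarith

end Spectral

/-! ### Eigenvector coordinates and upper bounds for the energy -/

section Spectral

variable {V : Type*} [Fintype V] [DecidableEq V] (G : SimpleGraph V) [DecidableRel G.Adj]

/-- An orthonormal basis of eigenvectors, with the quadratic form and norm in its coordinates. -/
theorem exists_eigenvector_coordinates :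
    ∃ (lam : V → ℝ) (U : V → V → ℝ),
      (∀ x : V → ℝ, quadForm G x = ∑ j, lam j * (∑ i, U j i * x i) ^ 2) ∧
      (∀ x : V → ℝ, ∑ i, x i ^ 2 = ∑ j, (∑ i, U j i * x i) ^ 2) ∧
      (∀ i k, G.adjMatrix ℝ i k = ∑ j, lam j * (U j i * U j k)) ∧
      (∀ i k, ∑ j, U j i * U j k = if i = k then 1 else 0) ∧
      (∀ j l, ∑ i, U j i * U l i = if j = l then 1 else 0) ∧
      (∀ j, quadForm G (U j) = lam j) ∧
      energy G = ∑ j, |lam j| ∧ ∑ j, lam j = 0 := by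
  obtain ⟨lam, U, hA, hU', hU, hE, h_tr⟩ := exists_spectral_decomposition G
  have swap : ∀ f : V → V → V → ℝ, ∑ i, ∑ k, ∑ j, f i k j = ∑ j, ∑ i, ∑ k, f i k j := by
    intro f
    have : ∀ i, ∑ k, ∑ j, f i k j = ∑ j, ∑ k, f i k j := fun i => Finset.sum_comm
    simp only [this]
    exact Finset.sum_comm
  have hq : ∀ x : V → ℝ, quadForm G x = ∑ j, lam j * (∑ i, U j i * x i) ^ 2 := by
    intro x
    simp only [quadForm, hA, Finset.sum_mul]
    rw [swap]
    refine Finset.sum_congr rfl fun j _ => ?_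
    rw [sq, Finset.sum_mul_sum, Finset.mul_sum]
    refine Finset.sum_congr rfl fun i _ => ?_
    rw [Finset.mul_sum]
    exact Finset.sum_congr rfl fun k _ => by ring
  refine ⟨lam, U, hq, fun x => ?_, hA, hU', hU, fun j => ?_, hE, h_tr⟩
  · have : ∀ j, (∑ i, U j i * x i) ^ 2 = ∑ i, ∑ k, U j i * U j k * (x i * x k) := by
      intro j
      rw [sq, Finset.sum_mul_sum]
      exact Finset.sum_congr rfl fun i _ => Finset.sum_congr rfl fun k _ => by ring
    simp only [this]
    rw [← swap]
    simp only [← Finset.sum_mul, hU']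
    simp [sq]
  · rw [hq]
    simp [hU]

/-- The squares of the eigenvalues sum to 2|E(G)|, and trace zero bounds each |λ| by E/2, so 2|E(G)|
≤ (E/2) Σ|λ| = E²/2. -/
theorem four_mul_card_edgeFinset_le_energy_sq : 4 * (#G.edgeFinset : ℝ) ≤ energy G ^ 2 := by
  obtain ⟨lam, U, hq, -, hA, -, -, hlam, hE, h_tr⟩ := exists_eigenvector_coordinates G
  have e1 : ∑ i, ∑ k, G.adjMatrix ℝ i k = ∑ j, lam j ^ 2 := by
    calc ∑ i, ∑ k, G.adjMatrix ℝ i k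
        = ∑ i, ∑ k, ∑ j, lam j * (G.adjMatrix ℝ i k * (U j i * U j k)) := by
          refine Finset.sum_congr rfl fun i _ => Finset.sum_congr rfl fun k _ => ?_
          have h1 : G.adjMatrix ℝ i k = G.adjMatrix ℝ i k * G.adjMatrix ℝ i k := by
            by_cases h : G.Adj i k <;> simp [h]
          nth_rewrite 1 [h1]
          nth_rewrite 2 [hA]
          rw [Finset.mul_sum]
          exact Finset.sum_congr rfl fun j _ => by ring
      _ = ∑ j, ∑ i, ∑ k, lam j * (G.adjMatrix ℝ i k * (U j i * U j k)) := by
          have : ∀ i, ∑ k, ∑ j, lam j * (G.adjMatrix ℝ i k * (U j i * U j k))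
            = ∑ j, ∑ k, lam j * (G.adjMatrix ℝ i k * (U j i * U j k)) := fun i => Finset.sum_comm
          simp only [this]
          exact Finset.sum_comm
      _ = ∑ j, lam j ^ 2 := by
          refine Finset.sum_congr rfl fun j _ => ?_
          simp only [← Finset.mul_sum]
          have := hlam j
          rw [quadForm] at this
          rw [this, sq]
  have e2 : ∑ i, ∑ k, G.adjMatrix ℝ i k = 2 * #G.edgeFinset := by
    have h := G.sum_degrees_eq_twice_card_edges
    have : ∀ i, ∑ k, G.adjMatrix ℝ i k = G.degree i := fun i => by
      simp [SimpleGraph.adjMatrix_apply, Finset.sum_boole, SimpleGraph.card_neighborFinset_eq_degree,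
        ← SimpleGraph.neighborFinset_eq_filter]
    simp only [this]
    exact_mod_cast h
  have h1 : ∀ j, |lam j| ≤ energy G / 2 := by
    intro j
    rw [hE, ← Finset.add_sum_erase _ _ (Finset.mem_univ j)]
    have h3 : lam j = -∑ l ∈ univ.erase j, lam l := by
      rw [← Finset.add_sum_erase _ _ (Finset.mem_univ j)] at h_tr
      linarith
    have h4 : |lam j| ≤ ∑ l ∈ univ.erase j, |lam l| := by
      rw [h3, abs_neg]
      exact Finset.abs_sum_le_sum_abs _ _
    linarith
  have h2 : ∑ j, lam j ^ 2 ≤ ∑ j, |lam j| * (energy G / 2) := by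
    refine Finset.sum_le_sum fun j _ => ?_
    rw [← sq_abs, sq]
    exact mul_le_mul_of_nonneg_left (h1 j) (abs_nonneg _)
  rw [← Finset.sum_mul, ← hE] at h2
  nlinarith

/-- An upper bound for the energy: an independent set bounds the number of negative eigenvalues, at
most one eigenvalue is less than `-1`, and none is `-2` or less. -/
theorem energy_lt_of_quadForm (I : Finset V) (hI : ∀ i ∈ I, ∀ j ∈ I, ¬ G.Adj i j) (k : ℕ)
    (hk : Fintype.card V ≤ #I + k) (r : V → ℝ)
    (h1 : ∀ x : V → ℝ, 0 ≤ quadForm G x + ∑ i, x i ^ 2 + (∑ i, r i * x i) ^ 2)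
    (h2 : ∀ x : V → ℝ, x ≠ 0 → 0 < quadForm G x + 2 * ∑ i, x i ^ 2) :
    energy G < 2 * (k + 1) := by
  obtain ⟨lam, U, hq, hn, -, -, hU, hlam, hE, h_tr⟩ := exists_eigenvector_coordinates G
  have hcoord : ∀ (c : V → ℝ) (l : V), ∑ i, U l i * ∑ j, c j * U j i = c l := by
    intro c l
    simp only [Finset.mul_sum]
    rw [Finset.sum_comm]
    have : ∀ j, ∑ i, U l i * (c j * U j i) = c j * if l = j then 1 else 0 := fun j => by
      rw [← hU l j, Finset.mul_sum]
      exact Finset.sum_congr rfl fun i _ => by ring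
    simp [this]
  have hq' : ∀ c : V → ℝ, quadForm G (fun i => ∑ j, c j * U j i) = ∑ j, lam j * c j ^ 2 := by
    intro c
    rw [hq]
    simp only [hcoord]
  have hn' : ∀ c : V → ℝ, ∑ i, (∑ j, c j * U j i) ^ 2 = ∑ j, c j ^ 2 := by
    intro c
    rw [hn]
    simp only [hcoord]
  set N : Finset V := univ.filter fun j => lam j < 0 with hN
  -- If there were more than |V| - |I| negative eigenvalues, some nonzero combination of their
  -- eigenvectors would vanish outside `I`. The form is zero there because `I` is independent, but
  -- negative on such a combination.
  have hNk : #N ≤ k := by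
    by_contra hlt
    push Not at hlt
    let L : (N → ℝ) →ₗ[ℝ] ({i // i ∉ I} → ℝ) :=
      { toFun := fun c i => ∑ j : N, c j * U j i
        map_add' := fun x y => by ext; simp [Finset.sum_add_distrib, add_mul]
        map_smul' := fun a x => by ext; simp [Finset.mul_sum, mul_assoc] }
    have hfr : Module.finrank ℝ ({i // i ∉ I} → ℝ) < Module.finrank ℝ (N → ℝ) := by
      rw [Module.finrank_fintype_fun_eq_card, Module.finrank_fintype_fun_eq_card,
        Fintype.card_subtype_compl]
      have := Finset.card_le_univ I
      simp
      omega
    obtain ⟨c, hc, hc0⟩ := Submodule.exists_mem_ne_zero_of_ne_bot (L.ker_ne_bot_of_finrank_lt hfr)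
    set d : V → ℝ := fun j => if h : j ∈ N then c ⟨j, h⟩ else 0 with hd
    have hdc : ∀ i, ∑ j, d j * U j i = ∑ j : N, c j * U j i := by
      intro i
      rw [← Finset.sum_subset (Finset.subset_univ N) (fun j _ hj => by simp [hd, hj]),
        ← Finset.sum_coe_sort N]
      exact Finset.sum_congr rfl fun j _ => by simp [hd]
    have hzero : ∀ i, i ∉ I → ∑ j, d j * U j i = 0 := by
      intro i hi
      rw [hdc]
      exact congrFun (LinearMap.mem_ker.1 hc) ⟨i, hi⟩
    have hq0 : quadForm G (fun i => ∑ j, d j * U j i) = 0 := by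
      refine Finset.sum_eq_zero fun i _ => Finset.sum_eq_zero fun j _ => ?_
      beta_reduce
      by_cases hi : i ∈ I
      · by_cases hj : j ∈ I
        · simp [hI i hi j hj]
        · rw [hzero j hj]; ring
      · rw [hzero i hi]; ring
    rw [hq'] at hq0
    obtain ⟨j, hj⟩ : ∃ j, c j ≠ 0 := by
      by_contra hcon
      push Not at hcon
      exact hc0 (funext hcon)
    have hle : ∀ i, lam i * d i ^ 2 ≤ 0 := by
      intro i
      by_cases hi : i ∈ N
      · exact mul_nonpos_of_nonpos_of_nonneg (Finset.mem_filter.1 hi).2.le (sq_nonneg _)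
      · simp [hd, hi]
    have := (Finset.sum_eq_zero_iff_of_nonpos fun i _ => hle i).1 hq0 j (Finset.mem_univ _)
    have hjN := (Finset.mem_filter.1 j.2).2
    simp [hd, hj, hjN.ne] at this
  have hgt : ∀ j, -2 < lam j := by
    intro j
    have hne : U j ≠ 0 := fun h => by
      have := hU j j
      simp [h] at this
    have := h2 (U j) hne
    have h3 := hU j j
    simp only [if_true, ← sq] at h3
    rw [hlam, h3] at this
    linarith
  -- `h1` says that A + I is nonnegative on the hyperplane orthogonal to `r`. Two eigenvectors with
  -- eigenvalues below -1 would span a plane meeting this hyperplane nontrivially.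
  have hone : ∀ j l, j ≠ l → lam j < -1 → -1 ≤ lam l := by
    intro j l hjl hj
    by_contra hl
    push Not at hl
    have h1' : ∀ c : V → ℝ, 0 ≤ ∑ m, lam m * c m ^ 2 + ∑ m, c m ^ 2
        + (∑ m, c m * ∑ i, r i * U m i) ^ 2 := by
      intro c
      have := h1 (fun i => ∑ j, c j * U j i)
      rw [hq', hn'] at this
      convert this using 3
      simp only [Finset.mul_sum]
      rw [Finset.sum_comm]
      exact Finset.sum_congr rfl fun j _ => Finset.sum_congr rfl fun i _ => by ring
    have key : ∀ a b : ℝ, 0 ≤ (lam j + 1) * a ^ 2 + (lam l + 1) * b ^ 2 +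
        (a * ∑ i, r i * U j i + b * ∑ i, r i * U l i) ^ 2 := by
      intro a b
      have h := h1' (fun m => if m = j then a else if m = l then b else 0)
      have hs : ∀ f : V → ℝ → ℝ, (∀ m, f m 0 = 0) →
          ∑ m, f m (if m = j then a else if m = l then b else 0) = f j a + f l b := by
        intro f hf
        rw [← Finset.sum_subset (Finset.subset_univ {j, l}) (fun m _ hm => by
          simp only [Finset.mem_insert, Finset.mem_singleton, not_or] at hm
          simp [hm.1, hm.2, hf]), Finset.sum_pair hjl]
        simp [hjl.symm]
      rw [hs (fun m t => lam m * t ^ 2) (by simp), hs (fun m t => t ^ 2) (by simp),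
        hs (fun m t => t * ∑ i, r i * U m i) (by simp)] at h
      linarith
    set s := ∑ i, r i * U j i
    set t := ∑ i, r i * U l i
    by_cases hst : t = 0
    · have := key 0 1
      rw [hst] at this
      norm_num at this
      linarith
    · have := key t (-s)
      have h5 : (t * s + -s * t) ^ 2 = 0 := by ring
      rw [h5] at this
      have ht : 0 < t ^ 2 := by positivity
      nlinarith [sq_nonneg s]
  -- By trace zero the negative eigenvalues carry half of the energy.
  have hE2 : energy G = 2 * ∑ j ∈ N, -lam j := by
    have : energy G = ∑ j, (|lam j| - lam j) := by
      rw [Finset.sum_sub_distrib, h_tr, hE, sub_zero]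
    rw [this, hN, Finset.sum_filter, Finset.mul_sum]
    refine Finset.sum_congr rfl fun j _ => ?_
    split_ifs with h
    · rw [abs_of_neg h]; ring
    · rw [abs_of_nonneg (not_lt.1 h)]; ring
  have hNk' : (#N : ℝ) ≤ k := by exact_mod_cast hNk
  rw [hE2]
  by_cases hex : ∃ j ∈ N, lam j < -1
  · obtain ⟨j, hj, hj1⟩ := hex
    rw [← Finset.add_sum_erase _ _ hj]
    have h3 : ∑ l ∈ N.erase j, -lam l ≤ ∑ l ∈ N.erase j, (1 : ℝ) :=
      Finset.sum_le_sum fun l hl => by linarith [hone j l (Finset.ne_of_mem_erase hl).symm hj1]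
    have h4 : (#(N.erase j) : ℝ) = #N - 1 := by
      rw [Finset.card_erase_of_mem hj, Nat.cast_sub (Finset.card_pos.2 ⟨j, hj⟩)]; simp
    rw [Finset.sum_const, nsmul_eq_mul, mul_one, h4] at h3
    linarith [hgt j]
  · push Not at hex
    have h3 : ∑ l ∈ N, -lam l ≤ ∑ l ∈ N, (1 : ℝ) :=
      Finset.sum_le_sum fun l hl => by linarith [hex l hl]
    rw [Finset.sum_const, nsmul_eq_mul, mul_one] at h3
    linarith

/-- If the adjacency matrix is a difference of positive semidefinite matrices, the sum of their
traces bounds the energy. -/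
theorem energy_le_of_sub_psd (P N : V → V → ℝ) (hA : ∀ i j, G.adjMatrix ℝ i j = P i j - N i j)
    (hP : ∀ x : V → ℝ, 0 ≤ ∑ i, ∑ j, P i j * (x i * x j))
    (hN : ∀ x : V → ℝ, 0 ≤ ∑ i, ∑ j, N i j * (x i * x j)) :
    energy G ≤ ∑ i, (P i i + N i i) := by
  obtain ⟨lam, U, -, -, -, hU, -, hlam, hE, -⟩ := exists_eigenvector_coordinates G
  have htr : ∀ M : V → V → ℝ, ∑ k, ∑ i, ∑ j, M i j * (U k i * U k j) = ∑ i, M i i := by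
    intro M
    rw [Finset.sum_comm]
    refine Finset.sum_congr rfl fun i _ => ?_
    rw [Finset.sum_comm]
    simp only [← Finset.mul_sum, hU]
    simp
  rw [hE, Finset.sum_add_distrib, ← htr P, ← htr N, ← Finset.sum_add_distrib]
  refine Finset.sum_le_sum fun k _ => ?_
  have : lam k = ∑ i, ∑ j, P i j * (U k i * U k j) - ∑ i, ∑ j, N i j * (U k i * U k j) := by
    rw [← hlam k, quadForm]
    simp only [hA, sub_mul, Finset.sum_sub_distrib]
  rw [abs_le]
  constructor <;> linarith [hP (U k), hN (U k)]

/-- As a function of the characteristic polynomial, the energy no longer depends on an indexing of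
the eigenvalues, so it can be compared between different vertex types. -/
theorem energy_eq_sum_roots :
    energy G = ((G.adjMatrix ℝ).charpoly.roots.map fun x => |x|).sum := by
  rw [(G.isHermitian_adjMatrix ℝ).roots_charpoly_eq_eigenvalues, Multiset.map_map]
  rfl

end Spectral

/-! ### Energy under isomorphism and under adding isolated vertices -/

theorem energy_eq_of_iso {V W : Type*} [Fintype V] [DecidableEq V] [Fintype W] [DecidableEq W]
    (G : SimpleGraph V) [DecidableRel G.Adj] (H : SimpleGraph W) [DecidableRel H.Adj]
    (e : G ≃g H) : energy G = energy H := by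
  have : Matrix.reindex e.toEquiv e.toEquiv (G.adjMatrix ℝ) = H.adjMatrix ℝ := by
    ext i j
    have : G.Adj (e.symm i) (e.symm j) ↔ H.Adj i j := e.symm.map_adj_iff
    simp only [Matrix.reindex_apply, Matrix.submatrix_apply, SimpleGraph.adjMatrix_apply]
    exact if_congr this rfl rfl
  rw [energy_eq_sum_roots, energy_eq_sum_roots, ← this, Matrix.charpoly_reindex]

theorem energy_sum_bot {W : Type*} [Fintype W] [DecidableEq W] (H : SimpleGraph W)
    [DecidableRel H.Adj] (m : ℕ) [DecidableRel (H ⊕g (⊥ : SimpleGraph (Fin m))).Adj] :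
    energy (H ⊕g (⊥ : SimpleGraph (Fin m))) = energy H := by
  have : (H ⊕g (⊥ : SimpleGraph (Fin m))).adjMatrix ℝ = Matrix.fromBlocks (H.adjMatrix ℝ) 0 0 0 := by
    ext (i | i) (j | j) <;> simp [SimpleGraph.adjMatrix_apply]
  have h0 : ((0 : Matrix (Fin m) (Fin m) ℝ).charpoly) = Polynomial.X ^ m := by
    simp
  rw [energy_eq_sum_roots, energy_eq_sum_roots, this, Matrix.charpoly_fromBlocks_zero₁₂, h0,
    Polynomial.roots_mul]
  · simp [Multiset.map_nsmul, Multiset.sum_nsmul]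
  · exact mul_ne_zero (Matrix.charpoly_monic _).ne_zero (pow_ne_zero _ Polynomial.X_ne_zero)

/-! ### List colouring -/

section Choosability

variable {V : Type*} (G : SimpleGraph V)

/-- The subgraph induced on `H` is `d`-choosable. -/
def ChoosableOn (H : Finset V) (d : ℕ) : Prop :=
  ∀ (α : Type) (L : V → Finset α), (∀ v, (L v).card = d) →
    ∃ c : V → α, (∀ v, c v ∈ L v) ∧ ∀ u ∈ H, ∀ v ∈ H, G.Adj u v → c u ≠ c v

theorem Choosable.of_injective {W : Type*} {G : SimpleGraph V} {H : SimpleGraph W} {k : ℕ}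
    (hG : Choosable G k) (f : W → V) (hf : Function.Injective f)
    (hadj : ∀ a b, H.Adj a b → G.Adj (f a) (f b)) : Choosable H k := by
  classical
  intro α L hL
  rcases isEmpty_or_nonempty W with hW | ⟨⟨w⟩⟩
  · exact ⟨fun v => hW.elim v, fun v => hW.elim v, fun v => hW.elim v⟩
  -- Vertices outside the image only need some list of the right size, so they all copy that of `w`.
  obtain ⟨c, hc, hc'⟩ := hG α (fun v => if h : ∃ a, f a = v then L h.choose else L w) (fun v => by
    split_ifs <;> exact hL _)
  refine ⟨fun a => c (f a), fun a => ?_, fun a b hab => hc' _ _ (hadj a b hab)⟩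
  have h := hc (f a)
  have hex : ∃ b, f b = f a := ⟨a, rfl⟩
  rw [dif_pos hex, hf hex.choose_spec] at h
  exact h

theorem choosable_choiceNumber [Fintype V] : Choosable G (choiceNumber G) :=
  (isLeast_choiceNumber G).1

theorem not_choosable_of_lt [Fintype V] {k : ℕ} (hk : k < choiceNumber G) : ¬ Choosable G k :=
  fun h => absurd ((isLeast_choiceNumber G).2 h) (not_le.2 hk)

variable {G} in
theorem le_choiceNumber_of_clique [Fintype V] {n : ℕ} (f : Fin n → V)
    (hf : ∀ a b, a ≠ b → G.Adj (f a) (f b)) : n ≤ choiceNumber G := by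
  have hinj : Function.Injective f := fun a b h => by
    by_contra hab
    exact G.loopless.irrefl _ (h ▸ hf a b hab)
  have h := (choosable_choiceNumber G).of_injective (H := completeGraph (Fin n)) f hinj
    (fun a b hab => hf a b hab)
  -- Equal lists reduce choosability to ordinary colouring.
  obtain ⟨c, -, hc⟩ := h (Fin (choiceNumber G)) (fun _ => Finset.univ) (fun _ => by simp)
  have hcinj : Function.Injective c := fun a b hab => by
    by_contra hne
    exact hc a b hne hab
  simpa using Fintype.card_le_of_injective c hcinj

/-- The bad lists are {0, 1} and {2, 3} on the side of order two, and the four sets with one colour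
from each of these on the other side: whatever pair is chosen on the small side is somebody's whole
list. -/
theorem three_le_choiceNumber_completeBipartite [Fintype V] {G : SimpleGraph V}
    (f : Fin 2 ⊕ Fin 4 → V) (hf : Function.Injective f)
    (hadj : ∀ a b, (completeBipartiteGraph (Fin 2) (Fin 4)).Adj a b → G.Adj (f a) (f b)) :
    3 ≤ choiceNumber G := by
  have h := (choosable_choiceNumber G).of_injective f hf hadj
  by_contra hlt
  have hcase : choiceNumber G = 0 ∨ choiceNumber G = 1 ∨ choiceNumber G = 2 := by omega
  rcases hcase with h0 | h0 | h0 <;> rw [h0] at h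
  · obtain ⟨c, hc, -⟩ := h ℕ (fun _ => ∅) (fun _ => rfl)
    simpa using hc (Sum.inl 0)
  · obtain ⟨c, hc, hc'⟩ := h ℕ (fun _ => {0}) (fun _ => rfl)
    have h1 := hc (Sum.inl 0)
    have h2 := hc (Sum.inr 0)
    simp only [Finset.mem_singleton] at h1 h2
    exact hc' (Sum.inl 0) (Sum.inr 0) (by simp) (h1.trans h2.symm)
  · obtain ⟨c, hc, hc'⟩ := h ℕ (Sum.elim ![{0, 1}, {2, 3}] ![{0, 2}, {0, 3}, {1, 2}, {1, 3}])
      (by rintro (a | a) <;> fin_cases a <;> rfl)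
    have h1 := hc (Sum.inl 0)
    have h2 := hc (Sum.inl 1)
    have h3 := hc (Sum.inr 0)
    have h4 := hc (Sum.inr 1)
    have h5 := hc (Sum.inr 2)
    have h6 := hc (Sum.inr 3)
    have g1 := fun j => hc' (Sum.inl 0) (Sum.inr j) (by simp)
    have g2 := fun j => hc' (Sum.inl 1) (Sum.inr j) (by simp)
    have a1 := g1 0
    have a2 := g1 1
    have a3 := g1 2
    have a4 := g1 3
    have b1 := g2 0
    have b2 := g2 1
    have b3 := g2 2
    have b4 := g2 3
    simp at h1 h2 h3 h4 h5 h6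
    omega

/-- An injective choice from large lists, avoiding given colours. -/
theorem exists_injective_choice {α : Type} [DecidableEq α] (L : V → Finset α) (U : Finset α)
    (T : Finset V) (hL : ∀ v ∈ T, #U + #T ≤ #(L v)) (hne : ∀ v, (L v).Nonempty) :
    ∃ f : V → α, (∀ v, f v ∈ L v) ∧ (∀ v ∈ T, f v ∉ U) ∧
      ∀ u ∈ T, ∀ v ∈ T, u ≠ v → f u ≠ f v := by
  classical
  induction T using Finset.induction_on with
  | empty => exact ⟨fun v => (hne v).choose, fun v => (hne v).choose_spec, by simp, by simp⟩
  | insert t T ht ih =>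
    rw [Finset.card_insert_of_notMem ht] at hL
    obtain ⟨f, hf, hfU, hfT⟩ := ih fun v hv => by
      have := hL v (Finset.mem_insert_of_mem hv)
      omega
    obtain ⟨a, ha, haU⟩ : ∃ a ∈ L t, a ∉ U ∪ T.image f := by
      apply Finset.exists_mem_notMem_of_card_lt_card
      have h1 := Finset.card_union_le U (T.image f)
      have h2 := Finset.card_image_le (s := T) (f := f)
      have := hL t (Finset.mem_insert_self _ _)
      omega
    rw [Finset.mem_union, not_or] at haU
    have haT : ∀ v ∈ T, f v ≠ a := fun v hv h => haU.2 (Finset.mem_image.2 ⟨v, hv, h⟩)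
    have hupd : ∀ v ∈ T, Function.update f t a v = f v := fun v hv =>
      Function.update_of_ne (fun h => ht (by rw [← h]; exact hv)) _ _
    refine ⟨Function.update f t a, fun v => ?_, fun v hv => ?_, fun u hu v hv huv => ?_⟩
    · by_cases h : v = t
      · subst h; simpa using ha
      · rw [Function.update_of_ne h]; exact hf v
    · rcases Finset.mem_insert.1 hv with rfl | hv
      · simpa using haU.1
      · rw [hupd v hv]; exact hfU v hv
    · rcases Finset.mem_insert.1 hu with hu' | hu' <;> rcases Finset.mem_insert.1 hv with hv' | hv'
      · exact absurd (hu'.trans hv'.symm) huv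
      · rw [hupd v hv', hu', Function.update_self]; exact (haT v hv').symm
      · rw [hupd u hu', hv', Function.update_self]; exact haT u hu'
      · rw [hupd u hu', hupd v hv']; exact hfT u hu' v hv' huv

variable {G} in
/-- Extending a colouring of `T` to an independent set of vertices whose lists are not used up. -/
theorem exists_extension_independent [DecidableEq V] {α : Type} [DecidableEq α]
    (L : V → Finset α) (S T : Finset V)
    (hS : ∀ u ∈ S, ∀ v ∈ S, ¬ G.Adj u v) (f : V → α) (hf : ∀ v, f v ∈ L v)
    (hfT : ∀ u ∈ T, ∀ v ∈ T, G.Adj u v → f u ≠ f v)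
    (hfree : ∀ s ∈ S, ∃ a ∈ L s, a ∉ T.image f) :
    ∃ c : V → α, (∀ v, c v ∈ L v) ∧ ∀ u ∈ T ∪ S, ∀ v ∈ T ∪ S, G.Adj u v → c u ≠ c v := by
  have h2 : ∀ s, ∃ a ∈ L s, s ∈ S → a ∉ T.image f := by
    intro s
    by_cases hs : s ∈ S
    · obtain ⟨a, ha, ha'⟩ := hfree s hs
      exact ⟨a, ha, fun _ => ha'⟩
    · exact ⟨f s, hf s, fun h => absurd h hs⟩
  choose g hg hg' using h2
  have hgT : ∀ s ∈ S, ∀ t ∈ T, g s ≠ f t := fun s hs t ht h =>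
    hg' s hs (Finset.mem_image.2 ⟨t, ht, h.symm⟩)
  refine ⟨fun v => if v ∈ T then f v else g v, fun v => ?_, fun u hu v hv huv => ?_⟩
  · beta_reduce
    split_ifs
    · exact hf v
    · exact hg v
  · beta_reduce
    rw [Finset.mem_union] at hu hv
    split_ifs with h1 h2 h2
    · exact hfT u h1 v h2 huv
    · exact (hgT v (hv.resolve_left h2) u h1).symm
    · exact hgT u (hu.resolve_left h1) v h2
    · exact absurd huv (hS u (hu.resolve_left h1) v (hv.resolve_left h2))

variable {G} in
/-- A graph made of a non-complete graph on `d` vertices and fewer than `2 d` independent vertices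
is `d`-choosable. -/
theorem choosableOn_of_card_lt [DecidableEq V] {d : ℕ} (S T : Finset V) (hT : #T = d)
    (hS : ∀ u ∈ S, ∀ v ∈ S, ¬ G.Adj u v) {x y : V} (hx : x ∈ T) (hy : y ∈ T) (hxy : x ≠ y)
    (hadj : ¬ G.Adj x y) (hcard : #S < 2 * d) : ChoosableOn G (T ∪ S) d := by
  classical
  intro α L hL
  have hT2 : 2 ≤ #T := by
    rw [← Finset.card_pair hxy]
    exact Finset.card_le_card (by simp [Finset.insert_subset_iff, hx, hy])
  set T' := (T.erase x).erase y with hT'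
  have hT'c : #T' + 2 = d := by
    rw [hT', Finset.card_erase_of_mem (Finset.mem_erase.2 ⟨hxy.symm, hy⟩),
      Finset.card_erase_of_mem hx]
    omega
  have hTT : ∀ v ∈ T, v = x ∨ v = y ∨ v ∈ T' := by
    intro v hv
    by_cases h1 : v = x
    · exact Or.inl h1
    · by_cases h2 : v = y
      · exact Or.inr (Or.inl h2)
      · exact Or.inr (Or.inr (Finset.mem_erase.2 ⟨h2, Finset.mem_erase.2 ⟨h1, hv⟩⟩))
  have hxT' : x ∉ T' := by simp [hT']
  have hyT' : y ∉ T' := by simp [hT']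
  have hne : ∀ v, (L v).Nonempty := fun v => Finset.card_pos.1 (by rw [hL]; omega)
  have build : ∀ (f : V → α) (a b : α), (∀ v, f v ∈ L v) → a ∈ L x → b ∈ L y →
      (∀ v ∈ T', f v ≠ a) → (∀ v ∈ T', f v ≠ b) →
      (∀ u ∈ T', ∀ v ∈ T', u ≠ v → f u ≠ f v) →
      (∀ s ∈ S, ∃ e ∈ L s, e ∉ insert a (insert b (T'.image f))) →
      ∃ c : V → α, (∀ v, c v ∈ L v) ∧ ∀ u ∈ T ∪ S, ∀ v ∈ T ∪ S, G.Adj u v → c u ≠ c v := by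
    intro f a b hf ha hb hfa hfb hfT hs
    set f' : V → α := fun v => if v = x then a else if v = y then b else f v with hf'
    have fx : f' x = a := by simp [hf']
    have fy : f' y = b := by simp [hf', hxy.symm]
    have fT : ∀ v ∈ T', f' v = f v := fun v hv => by
      have h1 : v ≠ x := fun h => hxT' (h ▸ hv)
      have h2 : v ≠ y := fun h => hyT' (h ▸ hv)
      simp [hf', h1, h2]
    refine exists_extension_independent L S T hS f' (fun v => ?_) (fun u hu v hv huv => ?_)
      (fun s hss => ?_)
    · simp only [hf']
      split_ifs with h1 h2
      · exact h1 ▸ ha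
      · exact h2 ▸ hb
      · exact hf v
    · rcases hTT u hu with rfl | rfl | hu <;> rcases hTT v hv with rfl | rfl | hv
      · exact absurd huv (G.loopless.irrefl _)
      · exact absurd huv hadj
      · rw [fx, fT v hv]; exact (hfa v hv).symm
      · exact absurd huv.symm hadj
      · exact absurd huv (G.loopless.irrefl _)
      · rw [fy, fT v hv]; exact (hfb v hv).symm
      · rw [fx, fT u hu]; exact hfa u hu
      · rw [fy, fT u hu]; exact hfb u hu
      · rw [fT u hu, fT v hv]; exact hfT u hu v hv huv.ne
    · obtain ⟨e, he, he'⟩ := hs s hss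
      refine ⟨e, he, fun h => he' ?_⟩
      obtain ⟨t, ht, rfl⟩ := Finset.mem_image.1 h
      rcases hTT t ht with rfl | rfl | ht
      · simp [fx]
      · simp [fy]
      · rw [fT t ht]
        exact Finset.mem_insert_of_mem (Finset.mem_insert_of_mem (Finset.mem_image_of_mem _ ht))
  -- With a common colour on the nonadjacent vertices `x` and `y`, at most d - 1 colours occur on
  -- `T`, so every list on `S` keeps a free colour.
  by_cases hdisj : ∃ a, a ∈ L x ∧ a ∈ L y
  · obtain ⟨a, hax, hay⟩ := hdisj
    obtain ⟨f, hf, hfU, hfT⟩ := exists_injective_choice L {a} T'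
      (fun v _ => by rw [hL, Finset.card_singleton]; omega) hne
    have hfa : ∀ v ∈ T', f v ≠ a := fun v hv h => hfU v hv (by simp [h])
    refine build f a a hf hax hay hfa hfa hfT fun s hs => ?_
    apply Finset.exists_mem_notMem_of_card_lt_card
    rw [hL, Finset.insert_idem]
    have h1 := Finset.card_insert_le a (T'.image f)
    have h2 := Finset.card_image_le (s := T') (f := f)
    omega
  · push Not at hdisj
    obtain ⟨f, hf, -, hfT⟩ := exists_injective_choice L ∅ T'
      (fun v _ => by rw [hL, Finset.card_empty]; omega) hne
    set Z := T'.image f with hZ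
    have hZc : #Z ≤ d - 2 := by
      have h2 : #Z ≤ #T' := Finset.card_image_le
      omega
    -- With disjoint lists, colour `T'` first, using the set `Z` of at most d - 2 colours. At least
    -- 2d pairs remain for `x` and `y`. A vertex `s` is blocked by a pair only if its list is
    -- exactly that pair together with `Z`, so each `s` rules out at most one pair, and |S| < 2d
    -- leaves a good one.
    set P := (L x \ Z) ×ˢ (L y \ Z) with hP
    have hPc : 2 * d ≤ #P := by
      rw [hP, Finset.card_product]
      have h1 := Finset.card_sdiff_add_card_inter (L x) Z
      have h2 := Finset.card_sdiff_add_card_inter (L y) Z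
      have h3 : #(L x ∩ Z) + #(L y ∩ Z) ≤ #Z := by
        rw [← Finset.card_union_of_disjoint]
        · exact Finset.card_le_card (Finset.union_subset Finset.inter_subset_right
            Finset.inter_subset_right)
        · rw [Finset.disjoint_left]
          intro a ha hb
          exact hdisj a (Finset.mem_inter.1 ha).1 (Finset.mem_inter.1 hb).1
      rw [hL] at h1 h2
      set p := #(L x ∩ Z)
      set q := #(L y ∩ Z)
      obtain ⟨e, rfl⟩ : ∃ e, d = p + q + 2 + e := ⟨d - (p + q + 2), by omega⟩
      have e1 : #(L x \ Z) = q + 2 + e := by omega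
      have e2 : #(L y \ Z) = p + 2 + e := by omega
      rw [e1, e2]
      nlinarith [Nat.zero_le (p * q), Nat.zero_le (q * e), Nat.zero_le (p * e),
        Nat.zero_le (e * e)]
    have hinj : Set.InjOn (fun ab : α × α => insert ab.1 (insert ab.2 Z)) P := by
      rintro ⟨a, b⟩ hab ⟨a', b'⟩ hab' heq
      simp only [hP, Finset.coe_product, Set.mem_prod, Finset.mem_coe, Finset.mem_sdiff] at hab hab'
      simp only at heq
      have ha : a ∈ insert a' (insert b' Z) := heq ▸ Finset.mem_insert_self _ _
      have hb : b ∈ insert a' (insert b' Z) := heq ▸ Finset.mem_insert_of_mem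
        (Finset.mem_insert_self _ _)
      simp only [Finset.mem_insert] at ha hb
      have h1 : a ≠ b' := fun h => hdisj a hab.1.1 (h ▸ hab'.2.1)
      have h2 : b ≠ a' := fun h => hdisj a' hab'.1.1 (h ▸ hab.2.1)
      rw [Prod.mk.injEq]
      exact ⟨ha.resolve_right fun h => h.elim h1 hab.1.2,
        (hb.resolve_left h2).resolve_right hab.2.2⟩
    obtain ⟨⟨a, b⟩, hab, hbad⟩ : ∃ ab ∈ P, ∀ s ∈ S, L s ≠ insert ab.1 (insert ab.2 Z) := by
      by_contra hcon
      push Not at hcon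
      have hsub : P.image (fun ab : α × α => insert ab.1 (insert ab.2 Z)) ⊆ S.image L := by
        intro C hC
        obtain ⟨ab, hab, rfl⟩ := Finset.mem_image.1 hC
        obtain ⟨s, hs, hse⟩ := hcon ab hab
        exact Finset.mem_image.2 ⟨s, hs, hse⟩
      have h1 := Finset.card_le_card hsub
      rw [Finset.card_image_of_injOn hinj] at h1
      have h2 := Finset.card_image_le (s := S) (f := L)
      omega
    simp only [hP, Finset.mem_product, Finset.mem_sdiff] at hab
    refine build f a b hf hab.1.1 hab.2.1
      (fun v hv h => hab.1.2 (h ▸ Finset.mem_image_of_mem f hv))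
      (fun v hv h => hab.2.2 (h ▸ Finset.mem_image_of_mem f hv)) hfT fun s hs => ?_
    by_contra hcon
    push Not at hcon
    refine hbad s hs (Finset.eq_of_subset_of_card_le hcon ?_)
    rw [hL]
    have h1 := Finset.card_insert_le a (insert b Z)
    have h2 := Finset.card_insert_le b Z
    simp only
    omega

variable {G} in
/-- A minimal set inducing a subgraph that is not `d`-choosable has minimum degree at least `d`. -/
theorem exists_minimal_not_choosableOn [Fintype V] [DecidableEq V] [DecidableRel G.Adj] {d : ℕ}
    (hd : 0 < d) (hG : ¬ Choosable G d) :
    ∃ H : Finset V, H.Nonempty ∧ ¬ ChoosableOn G H d ∧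
      ∀ v ∈ H, d ≤ #(H.filter fun u => G.Adj v u) := by
  classical
  have huniv : ¬ ChoosableOn G Finset.univ d := fun h => hG fun α L hL => by
    obtain ⟨c, hc, hc'⟩ := h α L hL
    exact ⟨c, hc, fun u v => hc' u (Finset.mem_univ _) v (Finset.mem_univ _)⟩
  obtain ⟨H, hH, hmin⟩ := Finset.exists_min_image
    (Finset.univ.filter fun H : Finset V => ¬ ChoosableOn G H d) Finset.card
    ⟨Finset.univ, by simpa using huniv⟩
  simp only [Finset.mem_filter, Finset.mem_univ, true_and] at hH hmin
  refine ⟨H, ?_, hH, fun v hv => ?_⟩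
  · by_contra hemp
    rw [Finset.not_nonempty_iff_eq_empty] at hemp
    subst hemp
    refine hH fun α L hL => ?_
    have hne : ∀ v, (L v).Nonempty := fun v => Finset.card_pos.1 (by rw [hL]; omega)
    exact ⟨fun v => (hne v).choose, fun v => (hne v).choose_spec, by simp⟩
  · by_contra hlt
    push Not at hlt
    refine hH fun α L hL => ?_
    have hch : ChoosableOn G (H.erase v) d := by
      by_contra hcon
      have := hmin _ hcon
      rw [Finset.card_erase_of_mem hv] at this
      have := Finset.card_pos.2 ⟨v, hv⟩
      omega
    obtain ⟨c, hc, hc'⟩ := hch α L hL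
    -- Fewer than `d` neighbours leave a colour for `v`, so a choice on `H.erase v` extends to `H`.
    obtain ⟨a, ha, ha'⟩ : ∃ a ∈ L v, a ∉ (H.filter fun u => G.Adj v u).image c := by
      apply Finset.exists_mem_notMem_of_card_lt_card
      have := Finset.card_image_le (s := H.filter fun u => G.Adj v u) (f := c)
      rw [hL]
      omega
    have hav : ∀ u ∈ H, G.Adj v u → c u ≠ a := fun u hu hvu h =>
      ha' (Finset.mem_image.2 ⟨u, Finset.mem_filter.2 ⟨hu, hvu⟩, h⟩)
    refine ⟨Function.update c v a, fun u => ?_, fun u hu w hw huw => ?_⟩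
    · by_cases h : u = v
      · subst h; simpa using ha
      · rw [Function.update_of_ne h]; exact hc u
    · by_cases h : u = v
      · subst h
        rw [Function.update_self, Function.update_of_ne huw.ne']
        exact (hav w hw huw).symm
      · by_cases h2 : w = v
        · subst h2
          rw [Function.update_self, Function.update_of_ne h]
          exact hav u hu huw.symm
        · rw [Function.update_of_ne h, Function.update_of_ne h2]
          exact hc' u (Finset.mem_erase.2 ⟨h, hu⟩) w (Finset.mem_erase.2 ⟨h2, hw⟩) huw

end Choosability

/-! ### A Brooks-type theorem by Kempe chains -/

section Kempe

variable {V : Type*} [Fintype V] [DecidableEq V] (F : SimpleGraph V) [DecidableRel F.Adj]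

/-- A shorter way to an intermediate vertex would shorten the whole walk. Consequently geodesics are
induced paths. -/
theorem Walk.dist_getVert_of_length_eq_dist {W : Type*} {K : SimpleGraph W} {u w : W}
    (p : K.Walk u w) (hp : p.length = K.dist u w) {a : ℕ} (ha : a ≤ p.length) :
    K.dist u (p.getVert a) = a := by
  have h1 := SimpleGraph.dist_le (p.take a)
  have h2 := SimpleGraph.dist_le (p.drop a)
  have h3 : K.Reachable u (p.getVert a) := ⟨p.take a⟩
  obtain ⟨q, hq⟩ := h3.exists_walk_length_eq_dist
  have h4 := SimpleGraph.dist_le (q.append (p.drop a))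
  rw [SimpleGraph.Walk.length_append] at h4
  simp only [SimpleGraph.Walk.take_length, SimpleGraph.Walk.drop_length] at h1 h2 h4
  omega

/-- `F` restricted to `H` is properly colourable with `D` colours. -/
def ColorableOn (F : SimpleGraph V) (H : Finset V) (D : ℕ) : Prop :=
  ∃ c : V → ℕ, (∀ v ∈ H, c v < D) ∧ ∀ u ∈ H, ∀ v ∈ H, F.Adj u v → c u ≠ c v

/-- A Brooks-type theorem: a subgraph of maximum degree at most `D` that is not `D`-colourable
contains a clique on `D + 1` vertices or an induced cycle of length at least four. -/
theorem exists_clique_or_induced_cycle (H : Finset V) (D : ℕ)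
    (hdeg : ∀ v ∈ H, #(H.filter fun u => F.Adj v u) ≤ D) (hcol : ¬ ColorableOn F H D) :
    (∃ S ⊆ H, F.IsClique S ∧ #S = D + 1) ∨
    ∃ (v : V) (l : ℕ) (p : ℕ → V), 2 ≤ l ∧ v ∈ H ∧ (∀ a ≤ l, p a ∈ H) ∧
      (∀ a ≤ l, ∀ b ≤ l, p a = p b → a = b) ∧
      (∀ a ≤ l, ∀ b ≤ l, F.Adj (p a) (p b) ↔ a + 1 = b ∨ b + 1 = a) ∧
      (∀ a ≤ l, p a ≠ v) ∧ ∀ a ≤ l, F.Adj v (p a) ↔ a = 0 ∨ a = l := by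
  classical
  -- `M` is a vertex-critical subset: deleting any vertex makes it `D`-colourable.
  obtain ⟨M, hM, hmin⟩ := Finset.exists_min_image
    (H.powerset.filter fun M => ¬ ColorableOn F M D) Finset.card
    ⟨H, by simpa using hcol⟩
  simp only [Finset.mem_filter, Finset.mem_powerset] at hM hmin
  obtain ⟨hMH, hM⟩ := hM
  obtain ⟨v, hv⟩ : M.Nonempty := by
    by_contra hemp
    rw [Finset.not_nonempty_iff_eq_empty] at hemp
    exact hM ⟨fun _ => 0, by simp [hemp], by simp [hemp]⟩
  set R := M.erase v with hR
  have hRM : ∀ x ∈ R, x ∈ M := fun x hx => Finset.mem_of_mem_erase hx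
  have hRv : ∀ x ∈ R, x ≠ v := fun x hx => Finset.ne_of_mem_erase hx
  obtain ⟨c, hcD, hc⟩ : ColorableOn F R D := by
    by_contra hcon
    have := hmin R ⟨(Finset.erase_subset _ _).trans hMH, hcon⟩
    rw [Finset.card_erase_of_mem hv] at this
    have := Finset.card_pos.2 ⟨v, hv⟩
    omega
  set N := M.filter fun u => F.Adj v u with hN
  have hNR : ∀ x ∈ N, x ∈ R := fun x hx => by
    have := Finset.mem_filter.1 hx
    exact Finset.mem_erase.2 ⟨this.2.ne', this.1⟩
  have hNadj : ∀ x ∈ N, F.Adj v x := fun x hx => (Finset.mem_filter.1 hx).2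
  have hNmem : ∀ x ∈ R, F.Adj v x → x ∈ N := fun x hx h => Finset.mem_filter.2 ⟨hRM x hx, h⟩
  -- Every `D`-colouring of `R` shows all colours on the neighbourhood of `v`, otherwise it would
  -- extend to `v`. As |N| ≤ D, each colour occurs on `N` exactly once.
  have hsurj : ∀ c' : V → ℕ, (∀ u ∈ R, c' u < D) →
      (∀ u ∈ R, ∀ w ∈ R, F.Adj u w → c' u ≠ c' w) → ∀ k < D, ∃ u ∈ N, c' u = k := by
    intro c' h1 h2 k hk
    by_contra hcon
    push Not at hcon
    have hupd : ∀ x ∈ M, x ≠ v → x ∈ R ∧ Function.update c' v k x = c' x := fun x hx hxv =>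
      ⟨Finset.mem_erase.2 ⟨hxv, hx⟩, Function.update_of_ne hxv _ _⟩
    refine hM ⟨Function.update c' v k, fun x hx => ?_, fun x hx y hy hxy => ?_⟩
    · by_cases h : x = v
      · subst h; simpa using hk
      · rw [(hupd x hx h).2]; exact h1 x (hupd x hx h).1
    · by_cases h : x = v
      · subst h
        obtain ⟨h3, h4⟩ := hupd y hy hxy.ne'
        rw [h4, Function.update_self]
        exact (hcon y (hNmem y h3 hxy)).symm
      · obtain ⟨h3, h4⟩ := hupd x hx h
        by_cases h' : y = v
        · subst h'
          rw [h4, Function.update_self]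
          exact hcon x (hNmem x h3 hxy.symm)
        · obtain ⟨h5, h6⟩ := hupd y hy h'
          rw [h4, h6]
          exact h2 x h3 y h5 hxy
  have hNle : #N ≤ D := (Finset.card_le_card (Finset.filter_subset_filter _ hMH)).trans
    (hdeg v (hMH hv))
  have himg : N.image c = Finset.range D := by
    ext k
    simp only [Finset.mem_image, Finset.mem_range]
    exact ⟨fun ⟨u, hu, h⟩ => h ▸ hcD u (hNR u hu), fun hk => hsurj c hcD hc k hk⟩
  have hND : #N = D := by
    have := Finset.card_image_le (s := N) (f := c)
    rw [himg, Finset.card_range] at this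
    omega
  have hinj : Set.InjOn c N := Finset.card_image_iff.1 (by rw [himg, hND, Finset.card_range])
  by_cases hcl : ∀ u ∈ N, ∀ w ∈ N, u ≠ w → F.Adj u w
  · left
    refine ⟨insert v N, ?_, ?_, ?_⟩
    · exact Finset.insert_subset (hMH hv) ((Finset.filter_subset _ _).trans hMH)
    · intro x hx y hy hxy
      rw [Finset.mem_coe, Finset.mem_insert] at hx hy
      rcases hx with rfl | hx <;> rcases hy with rfl | hy
      · exact absurd rfl hxy
      · exact hNadj y hy
      · exact (hNadj x hx).symm
      · exact hcl x hx y hy hxy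
    · rw [Finset.card_insert_of_notMem (fun h => hRv v (hNR v h) rfl), hND]
  · right
    push Not at hcl
    obtain ⟨u, hu, w, hw, huw, hnadj⟩ := hcl
    have hij : c u ≠ c w := fun h => huw (hinj hu hw h)
    set s : Set V := {x | x ∈ R ∧ (c x = c u ∨ c x = c w)} with hs
    have hus : u ∈ s := ⟨hNR u hu, Or.inl rfl⟩
    have hws : w ∈ s := ⟨hNR w hw, Or.inr rfl⟩
    -- If `u` and `w` lay in different components of the subgraph of their two colours, swapping
    -- these colours on the component of `u` would remove the colour of `u` from `N`.
    have hreach : (F.induce s).Reachable ⟨u, hus⟩ ⟨w, hws⟩ := by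
      by_contra hnr
      set C : Set V := {x | ∃ h : x ∈ s, (F.induce s).Reachable ⟨u, hus⟩ ⟨x, h⟩} with hC
      have hCs : ∀ x ∈ C, c x = c u ∨ c x = c w := fun x hx => hx.1.2
      have hCadj : ∀ x ∈ C, ∀ y ∈ s, F.Adj x y → y ∈ C := by
        rintro x ⟨hx, hxr⟩ y hy hxy
        refine ⟨hy, hxr.trans (SimpleGraph.Adj.reachable ?_)⟩
        exact hxy
      set c' : V → ℕ := fun x => if x ∈ C then (if c x = c u then c w else c u) else c x with hc'
      have hcross : ∀ x ∈ R, ∀ y ∈ R, F.Adj x y → x ∈ C → y ∉ C → c' x ≠ c' y := by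
        intro x _ y hy hxy hx hyC
        have h1 : c' y = c y := by simp [hc', hyC]
        have h2 : c' x = c u ∨ c' x = c w := by
          simp only [hc', hx, if_true]
          split_ifs <;> simp
        intro h
        refine hyC (hCadj x hx y ⟨hy, ?_⟩ hxy)
        rw [← h1, ← h]
        exact h2
      obtain ⟨z, hz, hzc⟩ := hsurj c' (fun x hx => by
          simp only [hc']
          split_ifs
          · exact hcD w (hNR w hw)
          · exact hcD u (hNR u hu)
          · exact hcD x hx) (fun x hx y hy hxy => by
          by_cases h1 : x ∈ C <;> by_cases h2 : y ∈ C
          · have h3 := hc x hx y hy hxy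
            have h4 := hCs x h1
            have h5 := hCs y h2
            simp only [hc', h1, h2, if_true]
            split_ifs with h6 h7 h7
            · exact absurd (h6.trans h7.symm) h3
            · exact hij.symm
            · exact hij
            · exact absurd ((h4.resolve_left h6).trans (h5.resolve_left h7).symm) h3
          · exact hcross x hx y hy hxy h1 h2
          · exact (hcross y hy x hx hxy.symm h2 h1).symm
          · simp only [hc', h1, h2, if_false]
            exact hc x hx y hy hxy) (c u) (hcD u (hNR u hu))
      by_cases hzC : z ∈ C
      · simp only [hc', hzC, if_true] at hzc
        split_ifs at hzc with h1
        · exact hij hzc.symm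
        · have : z = w := hinj hz hw ((hCs z hzC).resolve_left h1)
          subst this
          exact hnr hzC.2
      · simp only [hc', hzC, if_false] at hzc
        have : z = u := hinj hz hu hzc
        subst this
        exact hzC ⟨hus, SimpleGraph.Reachable.refl _⟩
    -- A shortest two-coloured path is induced, and `v` sees only its ends, since `N` contains just
    -- one vertex of each colour. Adding `v` closes it to an induced cycle, of length at least four
    -- because `u` and `w` are not adjacent.
    obtain ⟨p, hp⟩ := hreach.exists_walk_length_eq_dist
    have hdist : ∀ a ≤ p.length, (F.induce s).dist ⟨u, hus⟩ (p.getVert a) = a := fun a ha =>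
      Walk.dist_getVert_of_length_eq_dist p hp ha
    have hinjp : ∀ a ≤ p.length, ∀ b ≤ p.length, (p.getVert a : V) = p.getVert b → a = b := by
      intro a ha b hb h
      rw [← hdist a ha, ← hdist b hb, Subtype.ext h]
    have h0 : (p.getVert 0 : V) = u := by simp
    have hl : (p.getVert p.length : V) = w := by simp
    refine ⟨v, p.length, fun a => p.getVert a, ?_, hMH hv, fun a _ => hMH (hRM _ (p.getVert a).2.1),
      hinjp, fun a ha b hb => ⟨fun h => ?_, ?_⟩, fun a _ => hRv _ (p.getVert a).2.1,
      fun a ha => ⟨fun h => ?_, ?_⟩⟩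
    · by_contra hlt
      have : p.length = 0 ∨ p.length = 1 := by omega
      rcases this with h | h
      · exact huw (congrArg Subtype.val (SimpleGraph.Walk.eq_of_length_eq_zero h))
      · have hadj : (F.induce s).Adj ⟨u, hus⟩ ⟨w, hws⟩ := SimpleGraph.Walk.adj_of_length_eq_one h
        exact hnadj hadj
    · have hadj : (F.induce s).Adj (p.getVert a) (p.getVert b) := h
      have h1 := hadj.diff_dist_adj (u := ⟨u, hus⟩)
      rw [hdist a ha, hdist b hb] at h1
      have h2 : a ≠ b := fun hab => by
        subst hab
        exact F.loopless.irrefl _ h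
      omega
    · rintro (h | h)
      · subst h
        exact p.adj_getVert_succ (by omega)
      · subst h
        exact (p.adj_getVert_succ (by omega)).symm
    · have hmem : (p.getVert a : V) ∈ N := hNmem _ (p.getVert a).2.1 h
      rcases (p.getVert a).2.2 with h1 | h1
      · left
        exact hinjp a ha 0 (Nat.zero_le _) ((hinj hmem hu h1).trans h0.symm)
      · right
        exact hinjp a ha _ le_rfl ((hinj hmem hw h1).trans hl.symm)
    · rintro (rfl | rfl)
      · beta_reduce; rw [h0]; exact hNadj u hu
      · beta_reduce; rw [hl]; exact hNadj w hw

end Kempe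

/-! ### Integer test vectors on small induced subgraphs -/

section Embedded

variable {V : Type*} [Fintype V] [DecidableEq V] (G : SimpleGraph V) [DecidableRel G.Adj]

/-- The vector with integer coordinates `w` at the vertices `e a`. -/
def pushVec {m : ℕ} (e : Fin m → V) (w : Fin m → ℤ) (v : V) : ℝ :=
  ∑ a, if e a = v then (w a : ℝ) else 0

/-- The quadratic form of a `0`-`1` matrix at an integer vector. -/
def intForm {m : ℕ} (M : Fin m → Fin m → Bool) (w : Fin m → ℤ) : ℤ :=
  ∑ a, ∑ b, if M a b then w a * w b else 0

theorem sum_pushVec_mul {m : ℕ} (e : Fin m → V) (w : Fin m → ℤ) (f : V → ℝ) :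
    ∑ v, pushVec e w v * f v = ∑ a, w a * f (e a) := by
  simp only [pushVec, Finset.sum_mul]
  rw [Finset.sum_comm]
  exact Finset.sum_congr rfl fun a _ => by simp [ite_mul]

omit [Fintype V] in
theorem pushVec_apply {m : ℕ} {e : Fin m → V} (he : Function.Injective e) (w : Fin m → ℤ)
    (a : Fin m) : pushVec e w (e a) = w a := by
  simp [pushVec, he.eq_iff]

theorem sum_pushVec_mul_pushVec {m : ℕ} {e : Fin m → V} (he : Function.Injective e)
    (w w' : Fin m → ℤ) : ∑ v, pushVec e w v * pushVec e w' v = ((∑ a, w a * w' a : ℤ) : ℝ) := by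
  rw [sum_pushVec_mul]
  simp [pushVec_apply he]

theorem sum_pushVec_sq {m : ℕ} {e : Fin m → V} (he : Function.Injective e)
    (w : Fin m → ℤ) : ∑ v, pushVec e w v ^ 2 = ((∑ a, w a * w a : ℤ) : ℝ) := by
  rw [← sum_pushVec_mul_pushVec he]
  exact Finset.sum_congr rfl fun v _ => sq _

theorem quadForm_pushVec {m : ℕ} {e : Fin m → V} (M : Fin m → Fin m → Bool)
    (hM : ∀ a b, G.Adj (e a) (e b) ↔ M a b = true) (w : Fin m → ℤ) :
    quadForm G (pushVec e w) = intForm M w := by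
  have h : quadForm G (pushVec e w) =
      ∑ i, pushVec e w i * ∑ j, pushVec e w j * G.adjMatrix ℝ i j := by
    simp only [quadForm, Finset.mul_sum]
    exact Finset.sum_congr rfl fun i _ => Finset.sum_congr rfl fun j _ => by ring
  rw [h, sum_pushVec_mul, intForm]
  push_cast
  refine Finset.sum_congr rfl fun a _ => ?_
  rw [sum_pushVec_mul, Finset.mul_sum]
  refine Finset.sum_congr rfl fun b _ => ?_
  simp only [SimpleGraph.adjMatrix_apply, hM]
  split_ifs <;> simp

/-- A clique together with one vector of Rayleigh quotient at most `-2`. -/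
theorem two_mul_card_le_energy_of_vector {Q : Finset V} (hQ : G.IsClique Q) (w : V → ℝ)
    (hw : 0 < ∑ i, w i ^ 2) (h : quadForm G w ≤ -2 * ∑ i, w i ^ 2) : 2 * (#Q : ℝ) ≤ energy G := by
  have h1 := clique_sub_rayleigh_le_energy G hQ (fun _ : Fin 1 => w)
    (fun a b hab => absurd (Subsingleton.elim a b) hab) (fun _ => hw)
  have h2 : quadForm G w / ∑ i, w i ^ 2 ≤ -2 := by rwa [div_le_iff₀ hw]
  simp only [Fintype.card_fin, Finset.univ_unique, Finset.sum_singleton] at h1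
  push_cast at h1
  linarith

theorem two_mul_card_le_energy_of_embedded_vector {Q : Finset V} (hQ : G.IsClique Q) {m : ℕ}
    {e : Fin m → V} (he : Function.Injective e) (M : Fin m → Fin m → Bool)
    (hM : ∀ a b, G.Adj (e a) (e b) ↔ M a b = true) (w : Fin m → ℤ)
    (hw : 0 < ∑ a, w a * w a) (h : intForm M w ≤ -2 * ∑ a, w a * w a) :
    2 * (#Q : ℝ) ≤ energy G := by
  refine two_mul_card_le_energy_of_vector G hQ (pushVec e w) ?_ ?_
  · rw [sum_pushVec_sq he]; exact_mod_cast hw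
  · rw [sum_pushVec_sq he, quadForm_pushVec G M hM]; exact_mod_cast h

/-- Two test vectors cost two of the n - 1 eigenvalues -1 of the clique, so a sum of quotients of at
most -3 brings the total to -n. The denominators are cleared to make the hypothesis a decidable
statement about integers. -/
theorem two_mul_card_le_energy_of_embedded_pair {Q : Finset V} (hQ : G.IsClique Q) {m : ℕ}
    {e : Fin m → V} (he : Function.Injective e) (M : Fin m → Fin m → Bool)
    (hM : ∀ a b, G.Adj (e a) (e b) ↔ M a b = true) (w w' : Fin m → ℤ)
    (hw : 0 < ∑ a, w a * w a) (hw' : 0 < ∑ a, w' a * w' a) (horth : ∑ a, w a * w' a = 0)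
    (h : intForm M w * ∑ a, w' a * w' a + intForm M w' * ∑ a, w a * w a
      ≤ -3 * ((∑ a, w a * w a) * ∑ a, w' a * w' a)) :
    2 * (#Q : ℝ) ≤ energy G := by
  have h1 := clique_sub_rayleigh_le_energy G hQ ![pushVec e w, pushVec e w']
    (fun a b hab => by
      fin_cases a <;> fin_cases b
      · exact absurd rfl hab
      · simp [sum_pushVec_mul_pushVec he, horth]
      · simp [sum_pushVec_mul_pushVec he, mul_comm, horth]
      · exact absurd rfl hab)
    (fun a => by
      fin_cases a
      · refine lt_of_lt_of_eq ?_ (sum_pushVec_sq he w).symm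
        exact_mod_cast hw
      · refine lt_of_lt_of_eq ?_ (sum_pushVec_sq he w').symm
        exact_mod_cast hw')
  simp only [Fin.sum_univ_two, Matrix.cons_val_zero, Matrix.cons_val_one,
    sum_pushVec_sq he, quadForm_pushVec G M hM, Fintype.card_fin] at h1
  set a : ℤ := ∑ a, w a * w a
  set b : ℤ := ∑ a, w' a * w' a
  have ha : (0 : ℝ) < a := by exact_mod_cast hw
  have hb : (0 : ℝ) < b := by exact_mod_cast hw'
  have h2 : (intForm M w : ℝ) / a + (intForm M w' : ℝ) / b ≤ -3 := by
    rw [div_add_div _ _ ha.ne' hb.ne', div_le_iff₀ (by positivity)]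
    have : (intForm M w : ℝ) * b + intForm M w' * a ≤ -3 * (a * b) := by exact_mod_cast h
    linarith
  push_cast at h1
  linarith

/-- The Rayleigh quotient of an indicator function is the average degree. -/
theorem card_mul_le_quadForm_indicator (H : Finset V) (d : ℕ)
    (hdeg : ∀ v ∈ H, d ≤ #(H.filter fun u => G.Adj v u)) :
    (d : ℝ) * #H ≤ quadForm G (fun v => if v ∈ H then 1 else 0) := by
  have h : quadForm G (fun v => if v ∈ H then 1 else 0)
      = ∑ v ∈ H, (#(H.filter fun u => G.Adj v u) : ℝ) := by
    rw [quadForm, ← Finset.sum_subset (Finset.subset_univ H) (fun v _ hv => by simp [hv])]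
    refine Finset.sum_congr rfl fun v hv => ?_
    rw [← Finset.sum_subset (Finset.subset_univ H) (fun u _ hu => by simp [hu]),
      ← Finset.sum_boole]
    refine Finset.sum_congr rfl fun u hu => ?_
    simp [hu, hv, SimpleGraph.adjMatrix_apply]
  rw [h]
  calc (d : ℝ) * #H = ∑ v ∈ H, (d : ℝ) := by simp [mul_comm]
    _ ≤ _ := Finset.sum_le_sum fun v hv => by exact_mod_cast hdeg v hv

/-- A subgraph of minimum degree at least `d` together with two vectors orthogonal to the constants
and of Rayleigh quotients with sum at least `1`. -/
theorem two_mul_le_energy_of_minDegree_of_pair {H : Finset V} (hH : H.Nonempty) {d : ℕ}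
    (hdeg : ∀ v ∈ H, d ≤ #(H.filter fun u => G.Adj v u)) {m : ℕ}
    {e : Fin m → V} (he : Function.Injective e) (heH : ∀ a, e a ∈ H) (M : Fin m → Fin m → Bool)
    (hM : ∀ a b, G.Adj (e a) (e b) ↔ M a b = true) (w w' : Fin m → ℤ)
    (hw : 0 < ∑ a, w a * w a) (hw' : 0 < ∑ a, w' a * w' a) (horth : ∑ a, w a * w' a = 0)
    (hs : ∑ a, w a = 0) (hs' : ∑ a, w' a = 0)
    (h : (∑ a, w a * w a) * ∑ a, w' a * w' a ≤
      intForm M w * ∑ a, w' a * w' a + intForm M w' * ∑ a, w a * w a) :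
    2 * ((d : ℝ) + 1) ≤ energy G := by
  have hone : ∀ w : Fin m → ℤ, ∑ a, w a = 0 →
      ∑ v, pushVec e w v * (if v ∈ H then (1 : ℝ) else 0) = 0 := fun w hw => by
    rw [sum_pushVec_mul]
    simp only [heH, if_true, mul_one]
    exact_mod_cast hw
  have hcard : ∑ v, (if v ∈ H then (1 : ℝ) else 0) ^ 2 = #H := by simp
  have hHpos : (0 : ℝ) < #H := by exact_mod_cast hH.card_pos
  have h1 := sum_rayleigh_le_energy G
    ![fun v => if v ∈ H then (1 : ℝ) else 0, pushVec e w, pushVec e w']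
    (fun a b hab => by
      have c1 := hone w hs
      have c2 := hone w' hs'
      have c3 := sum_pushVec_mul_pushVec he w w'
      rw [horth, Int.cast_zero] at c3
      have c1' := c1
      have c2' := c2
      have c3' := c3
      simp only [mul_comm (pushVec e w _)] at c1' c3'
      simp only [mul_comm (pushVec e w' _) (ite _ _ _)] at c2'
      fin_cases a <;> fin_cases b
      · exact absurd rfl hab
      · exact c1'
      · exact c2'
      · exact c1
      · exact absurd rfl hab
      · exact c3
      · exact c2
      · exact c3'
      · exact absurd rfl hab)
    (fun a => by
      fin_cases a
      · exact lt_of_lt_of_eq hHpos hcard.symm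
      · refine lt_of_lt_of_eq ?_ (sum_pushVec_sq he w).symm
        exact_mod_cast hw
      · refine lt_of_lt_of_eq ?_ (sum_pushVec_sq he w').symm
        exact_mod_cast hw')
  have h0 := card_mul_le_quadForm_indicator G H d hdeg
  simp only [Fin.sum_univ_three, Matrix.cons_val_zero, Matrix.cons_val_one,
    Matrix.cons_val, sum_pushVec_sq he, quadForm_pushVec G M hM, hcard] at h1
  set a : ℤ := ∑ a, w a * w a
  set b : ℤ := ∑ a, w' a * w' a
  have ha : (0 : ℝ) < a := by exact_mod_cast hw
  have hb : (0 : ℝ) < b := by exact_mod_cast hw'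
  have h2 : 1 ≤ (intForm M w : ℝ) / a + (intForm M w' : ℝ) / b := by
    rw [div_add_div _ _ ha.ne' hb.ne', le_div_iff₀ (by positivity)]
    have : (a * b : ℝ) ≤ intForm M w * b + intForm M w' * a := by exact_mod_cast h
    linarith
  have h3 : (d : ℝ) ≤ quadForm G (fun v => if v ∈ H then 1 else 0) / #H := by
    rwa [le_div_iff₀ hHpos]
  have h4 := (mul_le_mul_of_nonneg_left (le_abs_self _) (by norm_num : (0:ℝ) ≤ 2)).trans h1
  linarith

/-- The coordinate sum zero makes `w` orthogonal to the indicator of `H`, whose quotient is at least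
`d`; the vector adds at least 1. -/
theorem two_mul_le_energy_of_minDegree_of_vector {H : Finset V} (hH : H.Nonempty) {d : ℕ}
    (hdeg : ∀ v ∈ H, d ≤ #(H.filter fun u => G.Adj v u)) {m : ℕ}
    {e : Fin m → V} (he : Function.Injective e) (heH : ∀ a, e a ∈ H) (M : Fin m → Fin m → Bool)
    (hM : ∀ a b, G.Adj (e a) (e b) ↔ M a b = true) (w : Fin m → ℤ)
    (hw : 0 < ∑ a, w a * w a) (hs : ∑ a, w a = 0) (h : ∑ a, w a * w a ≤ intForm M w) :
    2 * ((d : ℝ) + 1) ≤ energy G := by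
  have hone : ∑ v, pushVec e w v * (if v ∈ H then (1 : ℝ) else 0) = 0 := by
    rw [sum_pushVec_mul]
    simp only [heH, if_true, mul_one]
    exact_mod_cast hs
  have hcard : ∑ v, (if v ∈ H then (1 : ℝ) else 0) ^ 2 = #H := by simp
  have hHpos : (0 : ℝ) < #H := by exact_mod_cast hH.card_pos
  have h1 := sum_rayleigh_le_energy G ![fun v => if v ∈ H then (1 : ℝ) else 0, pushVec e w]
    (fun a b hab => by
      have c1' := hone
      simp only [mul_comm (pushVec e w _)] at c1'
      fin_cases a <;> fin_cases b
      · exact absurd rfl hab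
      · exact c1'
      · exact hone
      · exact absurd rfl hab)
    (fun a => by
      fin_cases a
      · exact lt_of_lt_of_eq hHpos hcard.symm
      · refine lt_of_lt_of_eq ?_ (sum_pushVec_sq he w).symm
        exact_mod_cast hw)
  have h0 := card_mul_le_quadForm_indicator G H d hdeg
  simp only [Fin.sum_univ_two, Matrix.cons_val_zero, Matrix.cons_val_one,
    sum_pushVec_sq he, quadForm_pushVec G M hM, hcard] at h1
  set a : ℤ := ∑ a, w a * w a
  have ha : (0 : ℝ) < a := by exact_mod_cast hw
  have h2 : 1 ≤ (intForm M w : ℝ) / a := by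
    rw [le_div_iff₀ ha, one_mul]
    exact_mod_cast h
  have h3 : (d : ℝ) ≤ quadForm G (fun v => if v ∈ H then 1 else 0) / #H := by
    rwa [le_div_iff₀ hHpos]
  have h4 := (mul_le_mul_of_nonneg_left (le_abs_self _) (by norm_num : (0:ℝ) ≤ 2)).trans h1
  linarith

/-- Adjacency in the complement of the cycle `0, 1, …, l + 1`. -/
def cycleCompl (l : ℕ) (a b : Fin (l + 2)) : Bool :=
  (a ≠ b) && ((a : ℕ) + 1 ≠ b) && ((b : ℕ) + 1 ≠ a) && !(a = 0 && (b : ℕ) = l + 1) &&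
    !(b = 0 && (a : ℕ) = l + 1)

/-- Adjacency in the complement of the path `0, 1, …, m - 1`. -/
def pathCompl (m : ℕ) (a b : Fin m) : Bool :=
  (a ≠ b) && ((a : ℕ) + 1 ≠ b) && ((b : ℕ) + 1 ≠ a)

/-- A subgraph of minimum degree at least `d` whose complement has an induced cycle of length at
least four has energy at least `2 (d + 1)`. -/
theorem two_mul_le_energy_of_induced_cycle {H : Finset V} {d : ℕ}
    (hdeg : ∀ v ∈ H, d ≤ #(H.filter fun u => G.Adj v u))
    {v : V} {l : ℕ} {p : ℕ → V} (hl : 2 ≤ l) (hv : v ∈ H) (hp : ∀ a ≤ l, p a ∈ H)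
    (hinj : ∀ a ≤ l, ∀ b ≤ l, p a = p b → a = b)
    (hadj : ∀ a ≤ l, ∀ b ≤ l, Gᶜ.Adj (p a) (p b) ↔ a + 1 = b ∨ b + 1 = a)
    (hpv : ∀ a ≤ l, p a ≠ v) (hvp : ∀ a ≤ l, Gᶜ.Adj v (p a) ↔ a = 0 ∨ a = l) :
    2 * ((d : ℝ) + 1) ≤ energy G := by
  have hH : H.Nonempty := ⟨v, hv⟩
  have hG : ∀ a ≤ l, ∀ b ≤ l, G.Adj (p a) (p b) ↔ a ≠ b ∧ a + 1 ≠ b ∧ b + 1 ≠ a := by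
    intro a ha b hb
    have h := hadj a ha b hb
    rw [SimpleGraph.compl_adj] at h
    by_cases hab : a = b
    · subst hab; simp
    · have hne : p a ≠ p b := fun h => hab (hinj a ha b hb h)
      constructor
      · intro h1
        refine ⟨hab, fun h2 => (h.2 (Or.inl h2)).2 h1, fun h2 => (h.2 (Or.inr h2)).2 h1⟩
      · rintro ⟨-, h1, h2⟩
        by_contra h3
        exact (h.1 ⟨hne, h3⟩).elim h1 h2
  have hGv : ∀ a ≤ l, G.Adj v (p a) ↔ a ≠ 0 ∧ a ≠ l := by
    intro a ha
    have h := hvp a ha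
    rw [SimpleGraph.compl_adj] at h
    constructor
    · intro h1
      exact ⟨fun h2 => (h.2 (Or.inl h2)).2 h1, fun h2 => (h.2 (Or.inr h2)).2 h1⟩
    · rintro ⟨h1, h2⟩
      by_contra h3
      exact (h.1 ⟨(hpv a ha).symm, h3⟩).elim h1 h2
  -- The cycle has length l + 2, with `v` at position 0 and the path shifted by one.
  set e : Fin (l + 2) → V := fun a => if (a : ℕ) = 0 then v else p (a - 1) with he
  have heinj : Function.Injective e := by
    intro a b hab
    have ha := a.2
    have hb := b.2
    simp only [he] at hab
    apply Fin.ext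
    split_ifs at hab with h1 h2 h2
    · omega
    · exact absurd hab.symm (hpv _ (by omega))
    · exact absurd hab (hpv _ (by omega))
    · have := hinj _ (by omega) _ (by omega) hab
      omega
  have heH : ∀ a, e a ∈ H := by
    intro a
    have ha := a.2
    simp only [he]
    split_ifs
    · exact hv
    · exact hp _ (by omega)
  have heM : ∀ a b, G.Adj (e a) (e b) ↔ cycleCompl l a b = true := by
    intro a b
    have ha := a.2
    have hb := b.2
    simp only [he, cycleCompl, Fin.ext_iff, ne_eq, Bool.and_eq_true, Bool.not_eq_true',
      decide_eq_true_eq, decide_eq_false_iff_not, Fin.val_zero, Bool.and_eq_false_imp]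
    split_ifs with h1 h2 h2
    · simp [h1, h2]
    · rw [hGv _ (by omega)]; omega
    · rw [SimpleGraph.adj_comm, hGv _ (by omega)]; omega
    · rw [hG _ (by omega) _ (by omega)]; omega
  -- On sum-zero vectors the complement of the cycle acts, as a quadratic form, like -1 minus the
  -- cycle. Even cycles have eigenvalue -2, which gives quotient 1 for the alternating vector. For
  -- lengths 5 and 7 the least cycle eigenvalue is double, and two orthogonal integer vectors
  -- approximate its eigenspace. From length 9 on, two disjoint blocks of four consecutive path
  -- vertices give 3/5 each.
  have hl' : l = 2 ∨ l = 3 ∨ l = 4 ∨ l = 5 ∨ l = 6 ∨ 7 ≤ l := by omega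
  rcases hl' with rfl | rfl | rfl | rfl | rfl | h7
  · exact two_mul_le_energy_of_minDegree_of_vector G hH hdeg heinj heH _ heM
      ![1, -1, 1, -1] (by decide) (by decide) (by decide)
  · exact two_mul_le_energy_of_minDegree_of_pair G hH hdeg heinj heH _ heM
      ![0, -1, 2, -2, 1] ![4, -3, 1, 1, -3] (by decide) (by decide) (by decide) (by decide)
      (by decide) (by decide)
  · exact two_mul_le_energy_of_minDegree_of_vector G hH hdeg heinj heH _ heM
      ![1, -1, 1, -1, 1, -1] (by decide) (by decide) (by decide)
  · exact two_mul_le_energy_of_minDegree_of_pair G hH hdeg heinj heH _ heM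
      ![4, -4, 3, -1, -1, 3, -4] ![0, 2, -4, 5, -5, 4, -2] (by decide) (by decide) (by decide)
      (by decide) (by decide) (by decide)
  · exact two_mul_le_energy_of_minDegree_of_vector G hH hdeg heinj heH _ heM
      ![1, -1, 1, -1, 1, -1, 1, -1] (by decide) (by decide) (by decide)
  · refine two_mul_le_energy_of_minDegree_of_pair G hH hdeg (e := fun a : Fin 8 => p a)
      (fun a b hab => ?_) (fun a => hp _ (by omega)) (pathCompl 8) (fun a b => ?_)
      ![-1, 2, -2, 1, 0, 0, 0, 0] ![0, 0, 0, 0, -1, 2, -2, 1] (by decide) (by decide) (by decide)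
      (by decide) (by decide) (by decide)
    · exact Fin.ext (hinj _ (by omega) _ (by omega) hab)
    · rw [hG _ (by omega) _ (by omega)]
      simp [pathCompl, Fin.ext_iff, and_assoc]

end Embedded

/-! ### Embeddings and isolated vertices -/

theorem isUnionWithIsolated_of_embedding {V W : Type*} [Fintype V] {G : SimpleGraph V}
    {H : SimpleGraph W} (f : W → V) (hf : Function.Injective f)
    (hadj : ∀ a b, G.Adj (f a) (f b) ↔ H.Adj a b)
    (hiso : ∀ v, v ∉ Set.range f → ∀ w, ¬ G.Adj v w) : IsUnionWithIsolated G H := by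
  classical
  refine ⟨Fintype.card {v // v ∉ Set.range f}, ⟨?_⟩⟩
  let e1 : W ⊕ Fin (Fintype.card {v // v ∉ Set.range f}) ≃ V :=
    (Equiv.sumCongr (Equiv.ofInjective f hf) (Fintype.equivFin _).symm).trans
      (Equiv.sumCompl (fun v => v ∈ Set.range f))
  have hl : ∀ a, e1 (Sum.inl a) = f a := fun a => rfl
  have hr : ∀ k, e1 (Sum.inr k) ∉ Set.range f := fun k => ((Fintype.equivFin _).symm k).2
  refine SimpleGraph.Iso.symm ⟨e1, ?_⟩
  rintro (a | a) (b | b)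
  · simp [hl, hadj]
  · simpa using fun h => hiso _ (hr b) _ h.symm
  · simpa using hiso _ (hr a) _
  · simpa using hiso _ (hr a) _

theorem exists_embedding_of_isUnionWithIsolated {V W : Type*} {G : SimpleGraph V}
    {H : SimpleGraph W} (h : IsUnionWithIsolated G H) :
    ∃ f : W → V, Function.Injective f ∧ ∀ a b, G.Adj (f a) (f b) ↔ H.Adj a b := by
  obtain ⟨m, ⟨e⟩⟩ := h
  refine ⟨fun a => e.symm (Sum.inl a), fun a b hab => ?_, fun a b => ?_⟩
  · exact Sum.inl_injective (e.symm.injective hab)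
  · rw [e.symm.map_adj_iff]; simp

theorem energy_eq_of_isUnionWithIsolated {V W : Type*} [Fintype V] [DecidableEq V]
    [Fintype W] [DecidableEq W] {G : SimpleGraph V} [DecidableRel G.Adj] {H : SimpleGraph W}
    [DecidableRel H.Adj] (h : IsUnionWithIsolated G H) : energy G = energy H := by
  classical
  obtain ⟨m, ⟨e⟩⟩ := h
  rw [energy_eq_of_iso G _ e, energy_sum_bot]

/-! ### A clique of order ch(G), or K_{2,4} -/

section Structure

variable {V : Type*} [Fintype V] [DecidableEq V] (G : SimpleGraph V) [DecidableRel G.Adj]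

theorem energy_nonneg : 0 ≤ energy G := Finset.sum_nonneg fun _ _ => abs_nonneg _

theorem card_edgeFinset_lt_sq {n : ℕ} (h : energy G < 2 * n) : #G.edgeFinset < n ^ 2 := by
  have h1 := four_mul_card_edgeFinset_le_energy_sq G
  have h2 := energy_nonneg G
  have : (#G.edgeFinset : ℝ) < (n : ℝ) ^ 2 := by nlinarith
  exact_mod_cast this

variable {G} in
/-- The edges of a complete bipartite subgraph. -/
theorem card_mul_card_le_card_edgeFinset {S T : Finset V} (hdisj : Disjoint T S)
    (hTS : ∀ t ∈ T, ∀ s ∈ S, G.Adj t s) :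
    #T * #S ≤ #G.edgeFinset ∧ (#G.edgeFinset ≤ #T * #S →
      ∀ a b, G.Adj a b ↔ (a ∈ T ∧ b ∈ S) ∨ (a ∈ S ∧ b ∈ T)) := by
  set E := (T ×ˢ S).image fun p : V × V => s(p.1, p.2) with hE
  have hcard : #E = #T * #S := by
    rw [hE, Finset.card_image_of_injOn, Finset.card_product]
    rintro ⟨a, b⟩ hab ⟨a', b'⟩ hab' heq
    simp only [Finset.coe_product, Set.mem_prod, Finset.mem_coe] at hab hab'
    simp only [Sym2.eq_iff] at heq
    rcases heq with ⟨h1, h2⟩ | ⟨h1, h2⟩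
    · rw [h1, h2]
    · exact absurd (h1 ▸ hab.1) (fun h => Finset.disjoint_left.1 hdisj h hab'.2)
  have hsub : E ⊆ G.edgeFinset := by
    intro x hx
    obtain ⟨⟨a, b⟩, hab, rfl⟩ := Finset.mem_image.1 hx
    rw [Finset.mem_product] at hab
    simpa using hTS a hab.1 b hab.2
  refine ⟨hcard ▸ Finset.card_le_card hsub, fun hle a b => ⟨fun h => ?_, ?_⟩⟩
  · have heq := Finset.eq_of_subset_of_card_le hsub (hcard ▸ hle)
    have hmem : s(a, b) ∈ E := by rw [heq]; simpa using h
    obtain ⟨⟨t, s⟩, hts, hts'⟩ := Finset.mem_image.1 hmem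
    rw [Finset.mem_product] at hts
    simp only [Sym2.eq_iff] at hts'
    rcases hts' with ⟨rfl, rfl⟩ | ⟨rfl, rfl⟩
    · exact Or.inl hts
    · exact Or.inr hts.symm
  · rintro (⟨h1, h2⟩ | ⟨h1, h2⟩)
    · exact hTS a h1 b h2
    · exact (hTS b h2 a h1).symm

/-- A graph of energy less than `2 ch(G)` has a clique of size `ch(G)`, or is `K_{2,4}` with some
isolated vertices. -/
theorem exists_clique_or_completeBipartite (h : energy G < 2 * (choiceNumber G : ℝ)) :
    (∃ Q : Finset V, G.IsClique Q ∧ #Q = choiceNumber G) ∨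
      IsUnionWithIsolated G (completeBipartiteGraph (Fin 2) (Fin 4)) := by
  classical
  have hn : 1 ≤ choiceNumber G := by
    have h0 := energy_nonneg G
    have : (0 : ℝ) < choiceNumber G := by linarith
    exact_mod_cast this
  obtain ⟨d, hd⟩ : ∃ d, choiceNumber G = d + 1 := ⟨choiceNumber G - 1, by omega⟩
  have hne : Nonempty V := by
    by_contra hemp
    rw [not_nonempty_iff] at hemp
    exact not_choosable_of_lt G (k := 0) hn fun α L _ =>
      ⟨fun v => hemp.elim v, fun v => hemp.elim v, fun v => hemp.elim v⟩
  -- Choice number 1 is separate because criticality needs d > 0; here one vertex is the clique.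
  rcases Nat.eq_zero_or_pos d with rfl | hdpos
  · left
    obtain ⟨v⟩ := hne
    exact ⟨{v}, by simp, by simp [hd]⟩
  obtain ⟨H, hH, hHch, hdeg⟩ := exists_minimal_not_choosableOn hdpos
    (not_choosable_of_lt G (k := d) (by omega))
  rw [hd] at h
  push_cast at h
  have hsplit : ∀ v ∈ H, #(H.filter fun u => Gᶜ.Adj v u) + #(H.filter fun u => G.Adj v u) + 1
      = #H := by
    intro v hv
    rw [← Finset.card_union_of_disjoint, ← Finset.card_insert_of_notMem (a := v)]
    · congr 1
      ext u
      simp only [Finset.mem_insert, Finset.mem_union, Finset.mem_filter, SimpleGraph.compl_adj]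
      constructor
      · rintro (rfl | h | h)
        · exact hv
        · exact h.1
        · exact h.1
      · intro hu
        by_cases huv : u = v
        · exact Or.inl huv
        · by_cases hadj : G.Adj v u
          · exact Or.inr (Or.inr ⟨hu, hadj⟩)
          · exact Or.inr (Or.inl ⟨hu, fun h => huv h.symm, hadj⟩)
    · simp
    · rw [Finset.disjoint_left]
      intro u hu hu'
      exact ((SimpleGraph.compl_adj ..).1 (Finset.mem_filter.1 hu).2).2 (Finset.mem_filter.1 hu').2
  have hHd : d + 1 ≤ #H := by
    obtain ⟨v, hv⟩ := hH
    have := hsplit v hv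
    have := hdeg v hv
    omega
  obtain ⟨D, hD⟩ : ∃ D, #H = d + 1 + D := ⟨#H - (d + 1), by omega⟩
  -- A colouring of the complement is a clique cover of `H`, and D cliques would give energy at
  -- least 2(|H| - D) = 2(d + 1).
  have hncol : ¬ ColorableOn Gᶜ H D := by
    rintro ⟨c, hcD, hc⟩
    have := card_sub_cliqueCover_le_energy G H c D hcD fun u hu v hv huv heq => by
      by_contra hadj
      exact hc u hu v hv ((SimpleGraph.compl_adj ..).2 ⟨huv, hadj⟩) heq
    rw [hD] at this
    push_cast at this
    linarith
  rcases exists_clique_or_induced_cycle Gᶜ H D (fun v hv => by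
      have := hsplit v hv
      have := hdeg v hv
      omega) hncol with ⟨S, hSH, hS, hSc⟩ | ⟨v, l, p, hl, hv, hp, hinj, hadj, hpv, hvp⟩
  swap
  · exact absurd h (not_lt.2 (two_mul_le_energy_of_induced_cycle G hdeg hl hv hp hinj hadj hpv hvp))
  have hSind : ∀ u ∈ S, ∀ v ∈ S, ¬ G.Adj u v := fun u hu v hv huv =>
    ((SimpleGraph.compl_adj ..).1 (hS hu hv huv.ne)).2 huv
  set T := H \ S with hT
  have hTc : #T = d := by
    rw [hT, Finset.card_sdiff_of_subset hSH]; omega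
  have hTS : ∀ t ∈ T, ∀ s ∈ S, G.Adj t s := by
    intro t ht s hs
    rw [hT, Finset.mem_sdiff] at ht
    by_contra hadj
    have hsub : insert t (S.erase s) ⊆ H.filter fun u => Gᶜ.Adj s u := by
      intro u hu
      rw [Finset.mem_insert, Finset.mem_erase] at hu
      rw [Finset.mem_filter]
      rcases hu with rfl | hu
      · exact ⟨ht.1, (SimpleGraph.compl_adj ..).2
          ⟨fun h => ht.2 (h ▸ hs), fun h => hadj h.symm⟩⟩
      · exact ⟨hSH hu.2, hS hs hu.2 hu.1.symm⟩
    have h1 := Finset.card_le_card hsub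
    rw [Finset.card_insert_of_notMem (fun h => ht.2 (Finset.mem_of_mem_erase h)),
      Finset.card_erase_of_mem hs] at h1
    have := hsplit s (hSH hs)
    have := hdeg s (hSH hs)
    omega
  by_cases hclique : ∀ x ∈ T, ∀ y ∈ T, x ≠ y → G.Adj x y
  · left
    obtain ⟨s, hs⟩ : S.Nonempty := Finset.card_pos.1 (by omega)
    refine ⟨insert s T, ?_, ?_⟩
    · rw [Finset.coe_insert, SimpleGraph.isClique_insert]
      exact ⟨fun x hx y hy hxy => hclique x hx y hy hxy, fun t ht _ => (hTS t ht s hs).symm⟩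
    · rw [Finset.card_insert_of_notMem (fun h => (Finset.mem_sdiff.1 h).2 hs), hTc, hd]
  · right
    push Not at hclique
    obtain ⟨x, hx, y, hy, hxy, hadj⟩ := hclique
    have hS2 : 2 * d ≤ #S := by
      by_contra hlt
      refine hHch ?_
      have := choosableOn_of_card_lt S T hTc hSind hx hy hxy hadj (not_le.1 hlt)
      rwa [hT, Finset.sdiff_union_of_subset hSH] at this
    have hdisj : Disjoint T S := Finset.sdiff_disjoint
    obtain ⟨he1, he2⟩ := card_mul_card_le_card_edgeFinset hdisj hTS
    have he3 : #G.edgeFinset < (d + 1) ^ 2 := card_edgeFinset_lt_sq G (by push_cast; exact h)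
    have hd2 : 2 ≤ d := by
      rw [← hTc, ← Finset.card_pair hxy]
      exact Finset.card_le_card (by simp [Finset.insert_subset_iff, hx, hy])
    rw [hTc] at he1 he2
    -- 2d² ≤ |E(G)| < (d + 1)² forces d ≤ 2. Then at most eight edges exist, so |S| = 4 and there
    -- are no edges besides those between `T` and `S`.
    have hd3 : d = 2 := by
      by_contra hne
      have : 3 ≤ d := by omega
      nlinarith
    subst hd3
    have hS4 : #S = 4 := by omega
    have hchar := he2 (by omega)
    have eT : Fin 2 ≃ T := (Finset.equivFinOfCardEq hTc).symm
    have eS : Fin 4 ≃ S := (Finset.equivFinOfCardEq hS4).symm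
    have hTnS : ∀ t ∈ T, t ∉ S := fun t ht => Finset.disjoint_left.1 hdisj ht
    refine isUnionWithIsolated_of_embedding (Sum.elim (fun a => (eT a : V)) fun b => (eS b : V))
      ?_ ?_ ?_
    · rintro (a | a) (b | b) hab
      · rw [eT.injective (Subtype.ext hab)]
      · have h : (eT a : V) = eS b := hab
        exact absurd (eS b).2 (h ▸ hTnS _ (eT a).2)
      · have h : (eT b : V) = eS a := hab.symm
        exact absurd (eS a).2 (h ▸ hTnS _ (eT b).2)
      · rw [eS.injective (Subtype.ext hab)]
    · rintro (a | a) (b | b) <;> simp [hchar, hTnS]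
      exact ⟨fun h => absurd (eS a).2 (hTnS _ h), fun h => absurd (eS b).2 (hTnS _ h)⟩
    · intro v hv w hvw
      rcases (hchar v w).1 hvw with ⟨h1, -⟩ | ⟨h1, -⟩
      · exact hv ⟨Sum.inl (eT.symm ⟨v, h1⟩), by simp⟩
      · exact hv ⟨Sum.inr (eS.symm ⟨v, h1⟩), by simp⟩

end Structure

/-! ### Forbidden attachments to a clique -/

section Configurations

variable {V : Type*} [Fintype V] [DecidableEq V] {G : SimpleGraph V} [DecidableRel G.Adj]

/-- The adjacency matrix of the graph with a given list of edges. -/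
def listAdj {m : ℕ} (L : List (ℕ × ℕ)) (a b : Fin m) : Bool :=
  L.contains ((a : ℕ), (b : ℕ)) || L.contains ((b : ℕ), (a : ℕ))

omit [Fintype V] [DecidableEq V] [DecidableRel G.Adj] in
theorem adj_iff_listAdj {m : ℕ} (L : List (ℕ × ℕ)) {e : Fin m → V}
    (hL : ∀ a : Fin m, listAdj L a a = false)
    (h : ∀ a b : Fin m, a < b → (G.Adj (e a) (e b) ↔ listAdj L a b = true)) (a b : Fin m) :
    G.Adj (e a) (e b) ↔ listAdj L a b = true := by
  rcases lt_trichotomy a b with hab | rfl | hab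
  · exact h a b hab
  · simp [hL]
  · rw [SimpleGraph.adj_comm, h b a hab, listAdj, listAdj, Bool.or_comm]

omit [Fintype V] [DecidableEq V] in
theorem injective_of_lt {m : ℕ} {e : Fin m → V} (h : ∀ a b : Fin m, a < b → e a ≠ e b) :
    Function.Injective e := by
  intro a b hab
  by_contra hne
  rcases lt_or_gt_of_ne hne with h1 | h1
  · exact h a b h1 hab
  · exact h b a h1 hab.symm

variable {Q : Finset V} (hQ : G.IsClique Q)
include hQ

/-- Two vertices outside a clique with two common neighbours and a common non-neighbour. -/
theorem energy_ge_of_two_common {x y z u v : V} (hx : x ∈ Q) (hy : y ∈ Q) (hz : z ∈ Q)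
    (hu : u ∉ Q) (hv : v ∉ Q) (huv : u ≠ v) (huv' : ¬ G.Adj u v) (hxy : x ≠ y)
    (hux : G.Adj u x) (huy : G.Adj u y) (huz : ¬ G.Adj u z)
    (hvx : G.Adj v x) (hvy : G.Adj v y) (hvz : ¬ G.Adj v z) : 2 * (#Q : ℝ) ≤ energy G := by
  have hxz : x ≠ z := fun h => huz (h ▸ hux)
  have hyz : y ≠ z := fun h => huz (h ▸ huy)
  have n1 : ∀ a ∈ Q, a ≠ u := fun a ha h => hu (h ▸ ha)
  have n2 : ∀ a ∈ Q, a ≠ v := fun a ha h => hv (h ▸ ha)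
  -- The five vertices induce K_5 minus the triangle on z, u, v, which has eigenvalue -2 with the
  -- eigenvector given here.
  refine two_mul_card_le_energy_of_embedded_vector G hQ (e := ![x, y, z, u, v])
    (injective_of_lt ?_) (listAdj [(0, 1), (0, 2), (1, 2), (0, 3), (1, 3), (0, 4), (1, 4)])
    (adj_iff_listAdj _ (by decide) ?_) ![1, 1, -1, -1, -1] (by decide) (by decide)
  · intro a b hab
    fin_cases a <;> fin_cases b <;> first | exact absurd hab (by decide) | skip
    all_goals simp [hxy, hxz, hyz, n1 _ hx, n1 _ hy, n1 _ hz, n2 _ hx, n2 _ hy, n2 _ hz, huv]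
  · intro a b hab
    fin_cases a <;> fin_cases b <;> first | exact absurd hab (by decide) | skip
    all_goals simp [listAdj, hQ hx hy hxy, hQ hx hz hxz, hQ hy hz hyz, hux.symm, huy.symm,
      hvx.symm, hvy.symm, G.adj_comm z, huz, hvz, huv']

/-- Two vertices outside a clique with a common neighbour, only one of them with another one. -/
theorem energy_ge_of_nested {x y z u v : V} (hx : x ∈ Q) (hy : y ∈ Q) (hz : z ∈ Q)
    (hu : u ∉ Q) (hv : v ∉ Q) (huv : u ≠ v) (huv' : ¬ G.Adj u v)
    (hux : G.Adj u x) (huy : G.Adj u y) (huz : ¬ G.Adj u z)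
    (hvx : G.Adj v x) (hvy : ¬ G.Adj v y) (hvz : ¬ G.Adj v z) : 2 * (#Q : ℝ) ≤ energy G := by
  have hxy : x ≠ y := fun h => hvy (h ▸ hvx)
  have hxz : x ≠ z := fun h => huz (h ▸ hux)
  have hyz : y ≠ z := fun h => huz (h ▸ huy)
  have n1 : ∀ a ∈ Q, a ≠ u := fun a ha h => hu (h ▸ ha)
  have n2 : ∀ a ∈ Q, a ≠ v := fun a ha h => hv (h ▸ ha)
  -- The Rayleigh quotients -68/39 and -78/62 add up to barely less than -3.
  refine two_mul_card_le_energy_of_embedded_pair G hQ (e := ![x, y, z, u, v])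
    (injective_of_lt ?_) (listAdj [(0, 1), (0, 2), (1, 2), (0, 3), (1, 3), (0, 4)])
    (adj_iff_listAdj _ (by decide) ?_) ![4, 1, -3, -3, -2] ![-3, 6, -2, -2, 3]
    (by decide) (by decide) (by decide) (by decide)
  · intro a b hab
    fin_cases a <;> fin_cases b <;> first | exact absurd hab (by decide) | skip
    all_goals simp [hxy, hxz, hyz, n1 _ hx, n1 _ hy, n1 _ hz, n2 _ hx, n2 _ hy, n2 _ hz, huv]
  · intro a b hab
    fin_cases a <;> fin_cases b <;> first | exact absurd hab (by decide) | skip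
    all_goals simp [listAdj, hQ hx hy hxy, hQ hx hz hxz, hQ hy hz hyz, hux.symm, huy.symm,
      hvx.symm, G.adj_comm z, G.adj_comm y v, huz, hvy, hvz, huv']

/-- Two vertices outside a clique, with two and one neighbours that are all different, and a common
non-neighbour. -/
theorem energy_ge_of_two_one {x x' y z u v : V} (hx : x ∈ Q) (hx' : x' ∈ Q) (hy : y ∈ Q)
    (hz : z ∈ Q) (hu : u ∉ Q) (hv : v ∉ Q) (huv : u ≠ v) (huv' : ¬ G.Adj u v) (hxx' : x ≠ x')
    (hux : G.Adj u x) (hux' : G.Adj u x') (huy : ¬ G.Adj u y) (huz : ¬ G.Adj u z)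
    (hvx : ¬ G.Adj v x) (hvx' : ¬ G.Adj v x') (hvy : G.Adj v y) (hvz : ¬ G.Adj v z) :
    2 * (#Q : ℝ) ≤ energy G := by
  have hxy : x ≠ y := fun h => hvx (h ▸ hvy)
  have hx'y : x' ≠ y := fun h => hvx' (h ▸ hvy)
  have hxz : x ≠ z := fun h => huz (h ▸ hux)
  have hx'z : x' ≠ z := fun h => huz (h ▸ hux')
  have hyz : y ≠ z := fun h => hvz (h ▸ hvy)
  have n1 : ∀ a ∈ Q, a ≠ u := fun a ha h => hu (h ▸ ha)
  have n2 : ∀ a ∈ Q, a ≠ v := fun a ha h => hv (h ▸ ha)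
  -- The quotients are -32/18 and -38/30. Both vectors respect the exchange of x and x'.
  refine two_mul_card_le_energy_of_embedded_pair G hQ (e := ![x, x', y, z, u, v])
    (injective_of_lt ?_)
    (listAdj [(0, 1), (0, 2), (1, 2), (0, 3), (1, 3), (2, 3), (0, 4), (1, 4), (2, 5)])
    (adj_iff_listAdj _ (by decide) ?_) ![2, 2, -2, -1, -2, 1] ![1, 1, 3, -3, -1, -3]
    (by decide) (by decide) (by decide) (by decide)
  · intro a b hab
    fin_cases a <;> fin_cases b <;> first | exact absurd hab (by decide) | skip
    all_goals simp [hxy, hxz, hyz, hxx', hx'y, hx'z, n1 _ hx, n1 _ hx', n1 _ hy, n1 _ hz,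
      n2 _ hx, n2 _ hx', n2 _ hy, n2 _ hz, huv]
  · intro a b hab
    fin_cases a <;> fin_cases b <;> first | exact absurd hab (by decide) | skip
    all_goals simp [listAdj, hQ hx hy hxy, hQ hx hz hxz, hQ hy hz hyz, hQ hx hx' hxx',
      hQ hx' hy hx'y, hQ hx' hz hx'z, hux.symm, hux'.symm, hvy.symm, G.adj_comm z, G.adj_comm y u,
      G.adj_comm x v, G.adj_comm x' v, huy, huz, hvx, hvx', hvz, huv']

/-- Two vertices outside a clique with different neighbours, and two common non-neighbours. -/
theorem energy_ge_of_two_pendants {x y z z' u v : V} (hx : x ∈ Q) (hy : y ∈ Q) (hz : z ∈ Q)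
    (hz' : z' ∈ Q) (hu : u ∉ Q) (hv : v ∉ Q) (huv : u ≠ v) (huv' : ¬ G.Adj u v) (hzz' : z ≠ z')
    (hux : G.Adj u x) (huy : ¬ G.Adj u y) (huz : ¬ G.Adj u z) (huz' : ¬ G.Adj u z')
    (hvx : ¬ G.Adj v x) (hvy : G.Adj v y) (hvz : ¬ G.Adj v z) (hvz' : ¬ G.Adj v z') :
    2 * (#Q : ℝ) ≤ energy G := by
  have hxy : x ≠ y := fun h => hvx (h ▸ hvy)
  have hxz : x ≠ z := fun h => huz (h ▸ hux)
  have hxz' : x ≠ z' := fun h => huz' (h ▸ hux)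
  have hyz : y ≠ z := fun h => hvz (h ▸ hvy)
  have hyz' : y ≠ z' := fun h => hvz' (h ▸ hvy)
  have n1 : ∀ a ∈ Q, a ≠ u := fun a ha h => hu (h ▸ ha)
  have n2 : ∀ a ∈ Q, a ≠ v := fun a ha h => hv (h ▸ ha)
  -- One vector is antisymmetric and one symmetric under exchanging (x, u) with (y, v); the
  -- quotients -110/68 and -158/114 sum to slightly less than -3.
  refine two_mul_card_le_energy_of_embedded_pair G hQ (e := ![x, y, z, z', u, v])
    (injective_of_lt ?_)
    (listAdj [(0, 1), (0, 2), (1, 2), (0, 3), (1, 3), (2, 3), (0, 4), (1, 5)])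
    (adj_iff_listAdj _ (by decide) ?_) ![5, -5, 0, 0, -3, 3] ![5, 5, -4, -4, -4, -4]
    (by decide) (by decide) (by decide) (by decide)
  · intro a b hab
    fin_cases a <;> fin_cases b <;> first | exact absurd hab (by decide) | skip
    all_goals simp [hxy, hxz, hyz, hxz', hyz', hzz', n1 _ hx, n1 _ hz', n1 _ hy, n1 _ hz,
      n2 _ hx, n2 _ hz', n2 _ hy, n2 _ hz, huv]
  · intro a b hab
    fin_cases a <;> fin_cases b <;> first | exact absurd hab (by decide) | skip
    all_goals simp [listAdj, hQ hx hy hxy, hQ hx hz hxz, hQ hy hz hyz, hQ hx hz' hxz',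
      hQ hy hz' hyz', hQ hz hz' hzz', hux.symm, hvy.symm, G.adj_comm z, G.adj_comm z',
      G.adj_comm y u, G.adj_comm x v, huy, huz, huz', hvx, hvz, hvz', huv']

/-- A clique with two vertices attached to one of its vertices and one attached to another. -/
theorem energy_ge_of_three_pendants {x y z u u' v : V} (hx : x ∈ Q) (hy : y ∈ Q) (hz : z ∈ Q)
    (hu : u ∉ Q) (hu' : u' ∉ Q) (hv : v ∉ Q) (huu : u ≠ u') (huv : u ≠ v) (hu'v : u' ≠ v)
    (huu' : ¬ G.Adj u u') (huv' : ¬ G.Adj u v) (hu'v' : ¬ G.Adj u' v)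
    (hux : G.Adj u x) (huy : ¬ G.Adj u y) (huz : ¬ G.Adj u z)
    (hu'x : G.Adj u' x) (hu'y : ¬ G.Adj u' y) (hu'z : ¬ G.Adj u' z)
    (hvx : ¬ G.Adj v x) (hvy : G.Adj v y) (hvz : ¬ G.Adj v z) : 2 * (#Q : ℝ) ≤ energy G := by
  have hxy : x ≠ y := fun h => hvx (h ▸ hvy)
  have hxz : x ≠ z := fun h => huz (h ▸ hux)
  have hyz : y ≠ z := fun h => hvz (h ▸ hvy)
  have n1 : ∀ a ∈ Q, a ≠ u := fun a ha h => hu (h ▸ ha)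
  have n2 : ∀ a ∈ Q, a ≠ v := fun a ha h => hv (h ▸ ha)
  have n3 : ∀ a ∈ Q, a ≠ u' := fun a ha h => hu' (h ▸ ha)
  -- The quotients are -56/30 and -50/37.
  refine two_mul_card_le_energy_of_embedded_pair G hQ (e := ![x, y, z, u, u', v])
    (injective_of_lt ?_) (listAdj [(0, 1), (0, 2), (1, 2), (0, 3), (0, 4), (1, 5)])
    (adj_iff_listAdj _ (by decide) ?_) ![4, -2, -1, -2, -2, 1] ![1, 4, -3, -1, -1, -3]
    (by decide) (by decide) (by decide) (by decide)
  · intro a b hab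
    fin_cases a <;> fin_cases b <;> first | exact absurd hab (by decide) | skip
    all_goals simp [hxy, hxz, hyz, n1 _ hx, n1 _ hy, n1 _ hz, n2 _ hx, n2 _ hy, n2 _ hz,
      n3 _ hx, n3 _ hy, n3 _ hz, huu, huv, hu'v]
  · intro a b hab
    fin_cases a <;> fin_cases b <;> first | exact absurd hab (by decide) | skip
    all_goals simp [listAdj, hQ hx hy hxy, hQ hx hz hxz, hQ hy hz hyz, hux.symm, hu'x.symm,
      hvy.symm, G.adj_comm z, G.adj_comm y u, G.adj_comm y u', G.adj_comm x v, huy, huz, hu'y,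
      hu'z, hvx, hvz, huv', huu', hu'v']

/-- A clique with three vertices attached to one of its vertices. -/
theorem energy_ge_of_star {x z u u' v : V} (hx : x ∈ Q) (hz : z ∈ Q)
    (hu : u ∉ Q) (hu' : u' ∉ Q) (hv : v ∉ Q) (huu : u ≠ u') (huv : u ≠ v) (hu'v : u' ≠ v)
    (huu' : ¬ G.Adj u u') (huv' : ¬ G.Adj u v) (hu'v' : ¬ G.Adj u' v)
    (hux : G.Adj u x) (huz : ¬ G.Adj u z) (hu'x : G.Adj u' x) (hu'z : ¬ G.Adj u' z)
    (hvx : G.Adj v x) (hvz : ¬ G.Adj v z) : 2 * (#Q : ℝ) ≤ energy G := by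
  have hxz : x ≠ z := fun h => huz (h ▸ hux)
  have n1 : ∀ a ∈ Q, a ≠ u := fun a ha h => hu (h ▸ ha)
  have n2 : ∀ a ∈ Q, a ≠ v := fun a ha h => hv (h ▸ ha)
  have n3 : ∀ a ∈ Q, a ≠ u' := fun a ha h => hu' (h ▸ ha)
  -- This is an induced star K_{1,4}, with least eigenvalue -2.
  refine two_mul_card_le_energy_of_embedded_vector G hQ (e := ![x, z, u, u', v])
    (injective_of_lt ?_) (listAdj [(0, 1), (0, 2), (0, 3), (0, 4)])
    (adj_iff_listAdj _ (by decide) ?_) ![2, -1, -1, -1, -1] (by decide) (by decide)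
  · intro a b hab
    fin_cases a <;> fin_cases b <;> first | exact absurd hab (by decide) | skip
    all_goals simp [hxz, n1 _ hx, n1 _ hz, n2 _ hx, n2 _ hz, n3 _ hx, n3 _ hz, huu, huv, hu'v]
  · intro a b hab
    fin_cases a <;> fin_cases b <;> first | exact absurd hab (by decide) | skip
    all_goals simp [listAdj, hQ hx hz hxz, hux.symm, hu'x.symm, hvx.symm, G.adj_comm z, huz, hu'z,
      hvz, huv', huu', hu'v']

/-- A clique with `t` of its vertices joined to a vertex outside. -/
theorem mul_lt_of_energy_lt {u : V} (hu : u ∉ Q) {t s : ℕ}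
    (ht : #(Q.filter fun x => G.Adj u x) = t) (ht0 : 0 < t) (hts : t + s = #Q + 1) (hs : 1 ≤ s)
    (h : energy G < 2 * (#Q : ℝ)) : t * s < 2 * (#Q + 1) := by
  by_contra hle
  push Not at hle
  -- Up to scaling, `w` minimises the form A + 2I on Q and u for a fixed sum over the neighbours of
  -- u.
  set w : V → ℝ := fun v => if v = u then -(t * s : ℝ) else
    if v ∈ Q then (if G.Adj u v then 2 * (s : ℝ) else -(2 * t : ℝ)) else 0 with hw
  set N := Q.filter fun x => G.Adj u x with hN
  set R := Q.filter fun x => ¬ G.Adj u x with hR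
  have hRc : (#R : ℝ) = s - 1 := by
    have h1 : #N + #R = #Q := Finset.card_filter_add_card_filter_not _
    have : #R + 1 = s := by omega
    rw [← this]; push_cast; ring
  have hwu : w u = -(t * s : ℝ) := by simp [hw]
  have hwN : ∀ v ∈ N, w v = 2 * s := fun v hv => by
    have hv' := Finset.mem_filter.1 hv
    have : v ≠ u := fun h => hu (h ▸ hv'.1)
    simp [hw, this, hv'.1, hv'.2]
  have hwR : ∀ v ∈ R, w v = -(2 * t) := fun v hv => by
    have hv' := Finset.mem_filter.1 hv
    have : v ≠ u := fun h => hu (h ▸ hv'.1)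
    simp [hw, this, hv'.1, hv'.2]
  have hw0 : ∀ v, v ∉ insert u Q → w v = 0 := fun v hv => by
    rw [Finset.mem_insert, not_or] at hv
    simp [hw, hv.1, hv.2]
  have hsum : ∀ f : V → ℝ, ∑ v ∈ Q, f v = ∑ v ∈ N, f v + ∑ v ∈ R, f v := fun f =>
    (Finset.sum_filter_add_sum_filter_not Q _ f).symm
  have e1 : ∑ v ∈ Q, w v = 2 * t := by
    rw [hsum, Finset.sum_congr rfl hwN, Finset.sum_congr rfl hwR, Finset.sum_const,
      Finset.sum_const, nsmul_eq_mul, nsmul_eq_mul, hRc, ht]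
    ring
  have e2 : ∑ v ∈ Q, w v ^ 2 = t * (4 * s ^ 2) + (s - 1) * (4 * t ^ 2) := by
    have hN2 : ∀ v ∈ N, w v ^ 2 = 4 * s ^ 2 := fun v hv => by rw [hwN v hv]; ring
    have hR2 : ∀ v ∈ R, w v ^ 2 = 4 * t ^ 2 := fun v hv => by rw [hwR v hv]; ring
    rw [hsum, Finset.sum_congr rfl hN2, Finset.sum_congr rfl hR2, Finset.sum_const,
      Finset.sum_const, nsmul_eq_mul, nsmul_eq_mul, hRc, ht]
  have e3 : ∑ v, w v ^ 2 = (t * s) ^ 2 + ∑ v ∈ Q, w v ^ 2 := by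
    rw [← Finset.sum_subset (Finset.subset_univ (insert u Q)) (fun v _ hv => by simp [hw0 v hv]),
      Finset.sum_insert hu, hwu]
    ring
  have e4 : ∑ v ∈ Q, G.adjMatrix ℝ u v * w v = 2 * t * s := by
    have : ∀ v ∈ Q, G.adjMatrix ℝ u v * w v = if G.Adj u v then w v else 0 := fun v _ => by
      by_cases h : G.Adj u v <;> simp [h]
    rw [Finset.sum_congr rfl this, ← Finset.sum_filter, Finset.sum_congr rfl hwN, Finset.sum_const,
      nsmul_eq_mul, ht]
    ring
  have e5 : quadForm G w = (∑ v ∈ Q, w v) ^ 2 - ∑ v ∈ Q, w v ^ 2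
      + 2 * w u * ∑ v ∈ Q, G.adjMatrix ℝ u v * w v := by
    have h1 : quadForm G w = ∑ i ∈ insert u Q, ∑ j ∈ insert u Q, G.adjMatrix ℝ i j * (w i * w j) := by
      rw [quadForm, ← Finset.sum_subset (Finset.subset_univ (insert u Q))
        (fun v _ hv => by simp [hw0 v hv])]
      refine Finset.sum_congr rfl fun i _ => ?_
      rw [← Finset.sum_subset (Finset.subset_univ (insert u Q)) (fun v _ hv => by simp [hw0 v hv])]
    have h2 : ∀ i ∈ Q, ∑ j ∈ Q, G.adjMatrix ℝ i j * (w i * w j)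
        = w i * ∑ j ∈ Q, w j - w i ^ 2 := by
      intro i hi
      rw [Finset.mul_sum]
      have h3 : ∀ j ∈ Q, G.adjMatrix ℝ i j * (w i * w j)
          = w i * w j - if i = j then w i ^ 2 else 0 := by
        intro j hj
        by_cases hij : i = j
        · subst hij; simp [sq]
        · simp [hij, hQ hi hj hij]
      rw [Finset.sum_congr rfl h3, Finset.sum_sub_distrib]
      simp [hi]
    rw [h1, Finset.sum_insert hu, Finset.sum_insert hu]
    simp only [Finset.sum_insert hu, Finset.sum_add_distrib]
    rw [Finset.sum_congr rfl h2, Finset.sum_sub_distrib, ← Finset.sum_mul]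
    have h4 : ∑ i ∈ Q, G.adjMatrix ℝ i u * (w i * w u)
        = w u * ∑ v ∈ Q, G.adjMatrix ℝ u v * w v := by
      rw [Finset.mul_sum]
      refine Finset.sum_congr rfl fun i _ => ?_
      simp only [SimpleGraph.adjMatrix_apply, G.adj_comm i u]
      ring
    have h5 : ∑ i ∈ Q, G.adjMatrix ℝ u i * (w u * w i)
        = w u * ∑ v ∈ Q, G.adjMatrix ℝ u v * w v := by
      rw [Finset.mul_sum]
      exact Finset.sum_congr rfl fun i _ => by ring
    rw [h4, h5]
    simp
    ring
  have hle' : 2 * ((#Q : ℝ) + 1) ≤ t * s := by exact_mod_cast hle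
  have hts' : (t : ℝ) + s = #Q + 1 := by exact_mod_cast hts
  have ht' : (0 : ℝ) < t := by exact_mod_cast ht0
  have hs' : (1 : ℝ) ≤ s := by exact_mod_cast hs
  refine absurd h (not_lt.2 (two_mul_card_le_energy_of_vector G hQ w ?_ ?_))
  · rw [e3, e2]
    have : 0 ≤ ((s : ℝ) - 1) * (4 * (t : ℝ) ^ 2) := mul_nonneg (by linarith) (by positivity)
    positivity
  -- The form plus twice the squared norm comes out as 2ts(2(t + s) - ts), with t + s = |Q| + 1.
  · rw [e5, e4, e3, e1, e2, hwu]
    have hpos : 0 ≤ (t : ℝ) * s := by positivity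
    have := mul_nonneg hpos (sub_nonneg.2 (hts' ▸ hle'))
    nlinarith

end Configurations

/-! ### Adjacency in A_{n,t} and B_n -/

theorem A_adj_some_some {n t : ℕ} {i j : Fin n} : (A n t).Adj (some i) (some j) ↔ i ≠ j := by
  simp [A]

theorem A_adj_none_some {n t : ℕ} {j : Fin n} : (A n t).Adj none (some j) ↔ j.val < t := by
  simp [A]

theorem A_adj_some_none {n t : ℕ} {j : Fin n} : (A n t).Adj (some j) none ↔ j.val < t := by
  simp [A]

theorem B_adj_inl_inl {n : ℕ} {i j : Fin n} : (B n).Adj (Sum.inl i) (Sum.inl j) ↔ i ≠ j := by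
  simp [B]

theorem B_adj_inl_inr {n : ℕ} {i : Fin n} {j : Fin 2} :
    (B n).Adj (Sum.inl i) (Sum.inr j) ↔ i.val = 0 := by
  simp [B]

theorem B_adj_inr_inl {n : ℕ} {i : Fin n} {j : Fin 2} :
    (B n).Adj (Sum.inr j) (Sum.inl i) ↔ i.val = 0 := by
  simp [B]

theorem B_not_adj_inr_inr {n : ℕ} {i j : Fin 2} : ¬ (B n).Adj (Sum.inr i) (Sum.inr j) := by
  simp [B]

/-- An enumeration of a finite set listing the elements with a given property first. -/
theorem exists_equiv_lt_iff {V : Type*} (Q : Finset V) (p : V → Prop) [DecidablePred p] {n t : ℕ}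
    (hn : #Q = n) (ht : #(Q.filter p) = t) : ∃ e : Fin n ≃ Q, ∀ i, p (e i) ↔ i.val < t := by
  classical
  have f : Fin n ≃ Q := (Finset.equivFinOfCardEq hn).symm
  have htn : t ≤ n := by rw [← hn, ← ht]; exact Finset.card_filter_le _ _
  have hc1 : Fintype.card {i : Fin n // i.val < t} = t := by
    rw [Fintype.card_subtype]
    have : (Finset.univ.filter fun i : Fin n => i.val < t) = Finset.univ.map (Fin.castLEEmb htn) := by
      ext i
      simp only [Finset.mem_filter, Finset.mem_univ, true_and, Finset.mem_map]
      exact ⟨fun h => ⟨⟨i, h⟩, rfl⟩, fun ⟨a, ha⟩ => ha ▸ a.2⟩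
    rw [this, Finset.card_map, Finset.card_univ, Fintype.card_fin]
  have hc2 : Fintype.card {i : Fin n // p (f i)} = t := by
    rw [Fintype.card_subtype, ← ht]
    refine Finset.card_bij (fun i _ => (f i : V)) (fun i hi => ?_) (fun i _ j _ hij => ?_)
      (fun v hv => ?_)
    · simpa using hi
    · exact f.injective (Subtype.ext hij)
    · rw [Finset.mem_filter] at hv
      exact ⟨f.symm ⟨v, hv.1⟩, by simpa using hv.2, by simp⟩
  have g : {i : Fin n // i.val < t} ≃ {i : Fin n // p (f i)} :=
    Fintype.equivOfCardEq (hc1.trans hc2.symm)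
  refine ⟨g.extendSubtype.trans f, fun i => ⟨fun h => ?_, fun h => ?_⟩⟩
  · by_contra hlt
    exact g.extendSubtype_not_mem i hlt h
  · exact g.extendSubtype_mem i h

/-! ### Two vertices attached to a clique -/

section CliqueCase

variable {V : Type*} [Fintype V] [DecidableEq V] {G : SimpleGraph V} [DecidableRel G.Adj]

omit [DecidableEq V] [DecidableRel G.Adj] in
theorem card_le_choiceNumber_of_isClique {Q : Finset V} (hQ : G.IsClique Q) :
    #Q ≤ choiceNumber G := by
  have e : Fin #Q ≃ Q := Q.equivFin.symm
  exact le_choiceNumber_of_clique (fun i => (e i : V)) fun a b hab =>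
    hQ (e a).2 (e b).2 fun h => hab (e.injective (Subtype.ext h))

/-- If a clique and `k` vertices outside are covered by `k` cliques, the energy is at least twice
the size of the clique. -/
theorem not_cover_of_energy_lt {Q : Finset V} (h : energy G < 2 * (#Q : ℝ)) (S : Finset V)
    (hS : ∀ v ∈ S, v ∉ Q) (c : V → ℕ) (hc : ∀ v ∈ Q ∪ S, c v < #S)
    (hcov : ∀ u ∈ Q ∪ S, ∀ v ∈ Q ∪ S, u ≠ v → c u = c v → G.Adj u v) : False := by
  have h1 := card_sub_cliqueCover_le_energy G (Q ∪ S) c #S hc hcov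
  rw [Finset.card_union_of_disjoint (Finset.disjoint_left.2 fun v hv hv' => hS v hv' hv)] at h1
  push_cast at h1
  linarith

/-- Two vertices attached to a maximum clique in a graph of small energy are pendant, and attached
to the same vertex unless the clique is a triangle. -/
theorem pendants_of_energy_lt {Q : Finset V} (hQ : G.IsClique Q) (h : energy G < 2 * (#Q : ℝ))
    {u v : V} (hu : u ∉ Q) (hv : v ∉ Q) (huv : u ≠ v) (hadj : ¬ G.Adj u v)
    (hux : ∃ x ∈ Q, G.Adj u x) (hvx : ∃ x ∈ Q, G.Adj v x)
    (hun : ∃ x ∈ Q, ¬ G.Adj u x) (hvn : ∃ x ∈ Q, ¬ G.Adj v x) :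
    (∃ x ∈ Q, (∀ y ∈ Q, G.Adj u y ↔ y = x) ∧ ∀ y ∈ Q, G.Adj v y ↔ y = x) ∨
    (#Q = 3 ∧ ∃ x ∈ Q, ∃ y ∈ Q, x ≠ y ∧ (∀ z ∈ Q, G.Adj u z ↔ z = x) ∧
      ∀ z ∈ Q, G.Adj v z ↔ z = y) := by
  have hlt := not_le.2 h
  -- Without a common non-neighbour, two cliques cover everything: u with its neighbours in Q, and v
  -- with the rest of Q.
  obtain ⟨z, hz, huz, hvz⟩ : ∃ z ∈ Q, ¬ G.Adj u z ∧ ¬ G.Adj v z := by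
    by_contra hcon
    push Not at hcon
    have hQS : ∀ a ∈ Q ∪ {u, v}, a ∈ Q ∨ a = u ∨ a = v := fun a ha => by
      rwa [Finset.mem_union, Finset.mem_insert, Finset.mem_singleton] at ha
    refine not_cover_of_energy_lt h {u, v} (by simp [hu, hv])
      (fun a => if a ∈ Q then (if G.Adj u a then 0 else 1) else (if a = u then 0 else 1))
      (fun a _ => ?_) (fun a ha b hb hab heq => ?_)
    · rw [Finset.card_pair huv]
      split_ifs <;> norm_num
    · rcases hQS a ha with ha' | rfl | rfl <;> rcases hQS b hb with hb' | rfl | rfl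
      · exact hQ ha' hb' hab
      · by_cases h1 : G.Adj b a
        · exact h1.symm
        · simp [ha', hu, h1] at heq
      · by_cases h1 : G.Adj u a
        · simp [ha', hv, h1, huv.symm] at heq
        · exact (hcon a ha' h1).symm
      · by_cases h1 : G.Adj a b
        · exact h1
        · simp [hb', hu, h1] at heq
      · exact absurd rfl hab
      · simp [hu, hv, hab.symm] at heq
      · by_cases h1 : G.Adj u b
        · simp [hb', hv, h1, huv.symm] at heq
        · exact hcon b hb' h1
      · simp [hu, hv, hab] at heq
      · exact absurd rfl hab
  by_cases hcommon : ∃ x ∈ Q, G.Adj u x ∧ G.Adj v x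
  · obtain ⟨x, hx, hux, hvx⟩ := hcommon
    refine Or.inl ⟨x, hx, fun y hy => ⟨fun h1 => ?_, fun h1 => h1 ▸ hux⟩,
      fun y hy => ⟨fun h1 => ?_, fun h1 => h1 ▸ hvx⟩⟩
    · by_contra hne
      by_cases hvy : G.Adj v y
      · exact hlt (energy_ge_of_two_common hQ hx hy hz hu hv huv hadj (Ne.symm hne) hux h1 huz
          hvx hvy hvz)
      · exact hlt (energy_ge_of_nested hQ hx hy hz hu hv huv hadj hux h1 huz hvx hvy hvz)
    · by_contra hne
      by_cases huy : G.Adj u y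
      · exact hlt (energy_ge_of_two_common hQ hx hy hz hu hv huv hadj (Ne.symm hne) hux huy huz
          hvx h1 hvz)
      · exact hlt (energy_ge_of_nested hQ hx hy hz hv hu huv.symm (fun h => hadj h.symm) hvx h1 hvz
          hux huy huz)
  · push Not at hcommon
    obtain ⟨x, hx, hux⟩ := hux
    obtain ⟨y, hy, hvy⟩ := hvx
    have hvx := hcommon x hx hux
    have huy : ¬ G.Adj u y := fun h1 => hcommon y hy h1 hvy
    have hxy : x ≠ y := fun h1 => hvx (h1 ▸ hvy)
    have hu1 : ∀ w ∈ Q, G.Adj u w ↔ w = x := fun w hw => by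
      refine ⟨fun h1 => ?_, fun h1 => h1 ▸ hux⟩
      by_contra hne
      exact hlt (energy_ge_of_two_one hQ hx hw hy hz hu hv huv hadj (Ne.symm hne) hux h1 huy huz
        hvx (hcommon w hw h1) hvy hvz)
    have hv1 : ∀ w ∈ Q, G.Adj v w ↔ w = y := fun w hw => by
      refine ⟨fun h1 => ?_, fun h1 => h1 ▸ hvy⟩
      by_contra hne
      exact hlt (energy_ge_of_two_one hQ hy hw hx hz hv hu huv.symm (fun h => hadj h.symm)
        (Ne.symm hne) hvy h1 hvx hvz huy (fun h2 => hcommon w hw h2 h1) hux huz)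
    have hxz : x ≠ z := fun h1 => huz (h1 ▸ hux)
    have hyz : y ≠ z := fun h1 => hvz (h1 ▸ hvy)
    refine Or.inr ⟨?_, x, hx, y, hy, hxy, hu1, hv1⟩
    have hQe : Q = {x, y, z} := by
      ext w
      simp only [Finset.mem_insert, Finset.mem_singleton]
      constructor
      · intro hw
        by_contra hcon
        push Not at hcon
        exact hlt (energy_ge_of_two_pendants hQ hx hy hz hw hu hv huv hadj hcon.2.2.symm hux huy huz
          (fun h1 => hcon.1 ((hu1 w hw).1 h1)) hvx hvy hvz
          (fun h1 => hcon.2.1 ((hv1 w hw).1 h1)))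
      · rintro (rfl | rfl | rfl) <;> assumption
    rw [hQe]
    exact Finset.card_eq_three.2 ⟨x, y, z, hxy, hxz, hyz, rfl⟩

end CliqueCase

theorem triangleTwoPendants_adj (a b : Fin 5) : triangleTwoPendants.Adj a b ↔
    listAdj [(0, 1), (0, 2), (1, 2), (0, 3), (1, 4)] a b = true := by
  fin_cases a <;> fin_cases b <;> simp [triangleTwoPendants, listAdj]

/-! ### Classification around a clique of order ch(G) -/

section Classification

variable {V : Type*} [Fintype V] [DecidableEq V] {G : SimpleGraph V} [DecidableRel G.Adj]

omit [DecidableEq V] [DecidableRel G.Adj] in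
theorem isUnionWithIsolated_completeGraph {Q : Finset V} (hQ : G.IsClique Q)
    (hiso : ∀ v ∉ Q, ∀ w, ¬ G.Adj v w) :
    IsUnionWithIsolated G (SimpleGraph.completeGraph (Fin #Q)) := by
  have e : Fin #Q ≃ Q := Q.equivFin.symm
  have hinj : Function.Injective fun i => (e i : V) :=
    Subtype.val_injective.comp e.injective
  refine isUnionWithIsolated_of_embedding (fun i => (e i : V)) hinj (fun a b => ?_)
    fun v hv w => hiso v (fun h => hv ⟨e.symm ⟨v, h⟩, by simp⟩) w
  exact ⟨fun h hab => G.loopless.irrefl _ (hab ▸ h), fun hab => hQ (e a).2 (e b).2 (hinj.ne hab)⟩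

omit [DecidableEq V] in
theorem isUnionWithIsolated_A {Q : Finset V} (hQ : G.IsClique Q) {u : V} (hu : u ∉ Q)
    (hiso : ∀ v ∉ Q, v ≠ u → ∀ w, ¬ G.Adj v w) :
    IsUnionWithIsolated G (A #Q #(Q.filter fun x => G.Adj u x)) := by
  obtain ⟨e, he⟩ := exists_equiv_lt_iff Q (fun x => G.Adj u x) rfl rfl
  have hinj : Function.Injective fun i => (e i : V) :=
    Subtype.val_injective.comp e.injective
  have heu : ∀ i, (e i : V) ≠ u := fun i h => hu (h ▸ (e i).2)
  refine isUnionWithIsolated_of_embedding (fun i => i.elim u fun i => (e i : V)) ?_ ?_ ?_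
  · rintro (_ | a) (_ | b) hab
    · rfl
    · exact absurd hab.symm (heu b)
    · exact absurd hab (heu a)
    · exact congrArg some (hinj hab)
  · rintro (_ | a) (_ | b)
    · simp
    · rw [A_adj_none_some]; exact he b
    · rw [A_adj_some_none, SimpleGraph.adj_comm]; exact he a
    · rw [A_adj_some_some]
      exact ⟨fun h hab => G.loopless.irrefl _ (hab ▸ h), fun hab =>
        hQ (e a).2 (e b).2 (hinj.ne hab)⟩
  · exact fun v hv w => hiso v (fun h => hv ⟨some (e.symm ⟨v, h⟩), by simp⟩)
      (fun h => hv ⟨none, h.symm⟩) w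

omit [DecidableRel G.Adj] in
theorem isUnionWithIsolated_B {Q : Finset V} (hQ : G.IsClique Q) {u v x : V} (hu : u ∉ Q)
    (hv : v ∉ Q) (huv : u ≠ v) (hadj : ¬ G.Adj u v) (hx : x ∈ Q) (hux : ∀ y ∈ Q, G.Adj u y ↔ y = x)
    (hvx : ∀ y ∈ Q, G.Adj v y ↔ y = x) (hiso : ∀ w ∉ Q, w ≠ u → w ≠ v → ∀ w', ¬ G.Adj w w') :
    IsUnionWithIsolated G (B #Q) := by
  obtain ⟨e, he⟩ := exists_equiv_lt_iff Q (fun y => y = x) (t := 1) rfl (by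
    rw [Finset.filter_eq' Q x, if_pos hx, Finset.card_singleton])
  have hinj : Function.Injective fun i => (e i : V) :=
    Subtype.val_injective.comp e.injective
  have heu : ∀ i, (e i : V) ≠ u := fun i h => hu (h ▸ (e i).2)
  have hev : ∀ i, (e i : V) ≠ v := fun i h => hv (h ▸ (e i).2)
  have hgQ : ∀ j i, (![u, v] : Fin 2 → V) j ≠ e i := by
    intro j i
    fin_cases j
    · exact (heu i).symm
    · exact (hev i).symm
  have hadj1 : ∀ j i, G.Adj ((![u, v] : Fin 2 → V) j) (e i) ↔ i.val = 0 := by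
    intro j i
    have h1 := he i
    fin_cases j
    · refine (hux _ (e i).2).trans (h1.trans ?_); omega
    · refine (hvx _ (e i).2).trans (h1.trans ?_); omega
  refine isUnionWithIsolated_of_embedding (Sum.elim (fun i => (e i : V)) ![u, v]) ?_ ?_ ?_
  · rintro (a | a) (b | b) hab
    · exact congrArg Sum.inl (hinj hab)
    · exact absurd hab.symm (hgQ b a)
    · exact absurd hab (hgQ a b)
    · refine congrArg Sum.inr ?_
      fin_cases a <;> fin_cases b
      · rfl
      · exact absurd hab huv
      · exact absurd hab.symm huv
      · rfl
  · rintro (a | a) (b | b)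
    · rw [B_adj_inl_inl]
      exact ⟨fun h hab => G.loopless.irrefl _ (hab ▸ h), fun hab =>
        hQ (e a).2 (e b).2 (hinj.ne hab)⟩
    · rw [B_adj_inl_inr, SimpleGraph.adj_comm]; exact hadj1 b a
    · rw [B_adj_inr_inl]; exact hadj1 a b
    · refine iff_of_false ?_ B_not_adj_inr_inr
      fin_cases a <;> fin_cases b
      · exact G.loopless.irrefl _
      · exact hadj
      · exact fun h => hadj h.symm
      · exact G.loopless.irrefl _
  · exact fun w hw w' => hiso w (fun h => hw ⟨Sum.inl (e.symm ⟨w, h⟩), by simp⟩)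
      (fun h => hw ⟨Sum.inr 0, h.symm⟩) (fun h => hw ⟨Sum.inr 1, h.symm⟩) w'

omit [DecidableRel G.Adj] in
theorem isUnionWithIsolated_triangleTwoPendants {Q : Finset V} (hQ : G.IsClique Q) (h3 : #Q = 3)
    {u v x y : V} (hu : u ∉ Q)
    (hv : v ∉ Q) (huv : u ≠ v) (hadj : ¬ G.Adj u v) (hx : x ∈ Q) (hy : y ∈ Q) (hxy : x ≠ y)
    (hux : ∀ z ∈ Q, G.Adj u z ↔ z = x)
    (hvy : ∀ z ∈ Q, G.Adj v z ↔ z = y) (hiso : ∀ w ∉ Q, w ≠ u → w ≠ v → ∀ w', ¬ G.Adj w w') :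
    IsUnionWithIsolated G triangleTwoPendants := by
  obtain ⟨z, hz, hz'⟩ := Finset.exists_mem_notMem_of_card_lt_card
    (show #({x, y} : Finset V) < #Q by rw [h3, Finset.card_pair hxy]; norm_num)
  simp only [Finset.mem_insert, Finset.mem_singleton, not_or] at hz'
  have hxz : x ≠ z := Ne.symm hz'.1
  have hyz : y ≠ z := Ne.symm hz'.2
  have hQe : {x, y, z} = Q := by
    refine Finset.eq_of_subset_of_card_le ?_ ?_
    · simp [Finset.insert_subset_iff, hx, hy, hz]
    · rw [h3, Finset.card_eq_three.2 ⟨x, y, z, hxy, hxz, hyz, rfl⟩]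
  have n1 : ∀ a ∈ Q, a ≠ u := fun a ha h => hu (h ▸ ha)
  have n2 : ∀ a ∈ Q, a ≠ v := fun a ha h => hv (h ▸ ha)
  refine isUnionWithIsolated_of_embedding ![x, y, z, u, v] (injective_of_lt ?_) (fun a b => ?_) ?_
  · intro a b hab
    fin_cases a <;> fin_cases b <;> first | exact absurd hab (by decide) | skip
    all_goals simp [hxy, hxz, hyz, n1 _ hx, n1 _ hy, n1 _ hz, n2 _ hx, n2 _ hy, n2 _ hz, huv]
  · rw [triangleTwoPendants_adj]
    refine adj_iff_listAdj _ (by decide) (fun a b hab => ?_) a b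
    fin_cases a <;> fin_cases b <;> first | exact absurd hab (by decide) | skip
    all_goals simp [listAdj, hQ hx hy hxy, hQ hx hz hxz, hQ hy hz hyz, G.adj_comm x u,
      G.adj_comm y u, G.adj_comm z u, G.adj_comm x v, G.adj_comm y v, G.adj_comm z v, hux _ hx, hux _ hy, hux _ hz, hvy _ hx, hvy _ hy, hvy _ hz, hxy, hxy.symm,
      hxz.symm, hyz.symm, hadj]
  · intro w hw
    refine hiso w (fun h => ?_) (fun h => hw ⟨3, h.symm⟩) (fun h => hw ⟨4, h.symm⟩)
    rw [← hQe] at h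
    simp only [Finset.mem_insert, Finset.mem_singleton] at h
    rcases h with rfl | rfl | rfl
    · exact hw ⟨0, rfl⟩
    · exact hw ⟨1, rfl⟩
    · exact hw ⟨2, rfl⟩

/-- The graphs of energy less than twice the choice number with a clique of that size. -/
theorem classification_of_clique {Q : Finset V} (hQ : G.IsClique Q) (hQc : #Q = choiceNumber G)
    (h : energy G < 2 * (#Q : ℝ)) :
    (∃ n : ℕ, 1 ≤ n ∧ IsUnionWithIsolated G (SimpleGraph.completeGraph (Fin n))) ∨
      (∃ n : ℕ, 1 ≤ n ∧ IsUnionWithIsolated G (B n)) ∨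
      (∃ n t : ℕ, 1 ≤ t ∧ t ≤ n - 1 ∧
        ((n ≤ 7 ∧ (n, t) ≠ (7, 4)) ∨ (8 ≤ n ∧ (t = 1 ∨ t = 2 ∨ t = n - 1))) ∧
        IsUnionWithIsolated G (A n t)) ∨
      IsUnionWithIsolated G triangleTwoPendants := by
  have hlt := not_le.2 h
  have hn : 1 ≤ #Q := by
    have h0 := energy_nonneg G
    have : (0 : ℝ) < #Q := by linarith
    exact_mod_cast this
  -- An edge outside `Q` and `Q` itself are two cliques covering |Q| + 2 vertices.
  have hind : ∀ u ∉ Q, ∀ v ∉ Q, ¬ G.Adj u v := by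
    intro u hu v hv huv
    refine not_cover_of_energy_lt h {u, v} (by simp [hu, hv])
      (fun a => if a ∈ Q then 0 else 1) (fun a _ => ?_) (fun a ha b hb hab heq => ?_)
    · rw [Finset.card_pair huv.ne]
      split_ifs <;> norm_num
    · rw [Finset.mem_union, Finset.mem_insert, Finset.mem_singleton] at ha hb
      by_cases ha' : a ∈ Q <;> by_cases hb' : b ∈ Q
      · exact hQ ha' hb' hab
      · simp [ha', hb'] at heq
      · simp [ha', hb'] at heq
      · rcases ha.resolve_left ha' with rfl | rfl <;> rcases hb.resolve_left hb' with rfl | rfl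
        · exact absurd rfl hab
        · exact huv
        · exact huv.symm
        · exact absurd rfl hab
  have hmax : ∀ u ∉ Q, ∃ z ∈ Q, ¬ G.Adj u z := by
    intro u hu
    by_contra hcon
    push Not at hcon
    have h1 : G.IsClique ((insert u Q : Finset V) : Set V) := by
      rw [Finset.coe_insert, SimpleGraph.isClique_insert]
      exact ⟨hQ, fun z hz _ => hcon z hz⟩
    have h2 := card_le_choiceNumber_of_isClique h1
    rw [Finset.card_insert_of_notMem hu] at h2
    omega
  by_cases h0 : ∀ v ∉ Q, ∀ w, ¬ G.Adj v w
  · exact Or.inl ⟨_, hn, isUnionWithIsolated_completeGraph hQ h0⟩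
  push Not at h0
  have hnb : ∀ u ∉ Q, ∀ w, G.Adj u w → ∃ x ∈ Q, G.Adj u x := fun u hu w huw =>
    ⟨w, by by_contra hw; exact hind u hu w hw huw, huw⟩
  obtain ⟨u, hu, wu, huwu⟩ := h0
  have hux := hnb u hu wu huwu
  by_cases h1 : ∀ v ∉ Q, v ≠ u → ∀ w, ¬ G.Adj v w
  · refine Or.inr (Or.inr (Or.inl ⟨_, _, ?_, ?_, ?_, isUnionWithIsolated_A hQ hu h1⟩))
    · obtain ⟨x, hx, hux⟩ := hux
      exact Finset.card_pos.2 ⟨x, Finset.mem_filter.2 ⟨hx, hux⟩⟩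
    · obtain ⟨z, hz, huz⟩ := hmax u hu
      have : #(Q.filter fun x => G.Adj u x) < #Q :=
        Finset.card_lt_card (Finset.filter_ssubset.2 ⟨z, hz, huz⟩)
      omega
    · obtain ⟨x, hx, hux⟩ := hux
      obtain ⟨z, hz, huz⟩ := hmax u hu
      have ht0 : 0 < #(Q.filter fun x => G.Adj u x) :=
        Finset.card_pos.2 ⟨x, Finset.mem_filter.2 ⟨hx, hux⟩⟩
      have htn : #(Q.filter fun x => G.Adj u x) < #Q :=
        Finset.card_lt_card (Finset.filter_ssubset.2 ⟨z, hz, huz⟩)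
      have key := mul_lt_of_energy_lt hQ hu rfl ht0
        (s := #Q + 1 - #(Q.filter fun x => G.Adj u x)) (by omega) (by omega) h
      generalize #(Q.filter fun x => G.Adj u x) = t at *
      generalize #Q = n at *
      by_cases h8 : 8 ≤ n
      · refine Or.inr ⟨h8, ?_⟩
        by_contra hcon
        push Not at hcon
        -- With t = a + 3 and n + 1 - t = b + 3 the inequality becomes ab + a + b < 3, whereas n ≥ 8
        -- means a + b ≥ 3.
        obtain ⟨a, rfl⟩ : ∃ a, t = a + 3 := ⟨t - 3, by omega⟩
        obtain ⟨b, rfl⟩ : ∃ b, n = a + b + 5 := ⟨n - (a + 5), by omega⟩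
        have : a + b + 5 + 1 - (a + 3) = b + 3 := by omega
        rw [this] at key
        nlinarith [Nat.zero_le (a * b)]
      · refine Or.inl ⟨by omega, fun h74 => ?_⟩
        rw [Prod.mk.injEq] at h74
        rw [h74.1, h74.2] at key
        omega
  push Not at h1
  obtain ⟨v, hv, hvu, wv, hvwv⟩ := h1
  have hvx := hnb v hv wv hvwv
  have hpair := fun (a b : V) (ha : a ∉ Q) (hb : b ∉ Q) (hab : a ≠ b) (ha' : ∃ x ∈ Q, G.Adj a x)
    (hb' : ∃ x ∈ Q, G.Adj b x) => pendants_of_energy_lt hQ h ha hb hab (hind a ha b hb) ha' hb'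
      (hmax a ha) (hmax b hb)
  have hmix : ∀ a b c x y : V, a ∉ Q → b ∉ Q → c ∉ Q → a ≠ b → a ≠ c → b ≠ c → x ∈ Q → y ∈ Q →
      x ≠ y → #Q = 3 → (∀ z ∈ Q, G.Adj a z ↔ z = x) → (∀ z ∈ Q, G.Adj b z ↔ z = x) →
      (∀ z ∈ Q, G.Adj c z ↔ z = y) → False := by
    intro a b c x y ha hb hc hab hac hbc hx hy hxy h3 hax hbx hcy
    obtain ⟨z, hz, hz'⟩ := Finset.exists_mem_notMem_of_card_lt_card
      (show #({x, y} : Finset V) < #Q by rw [h3, Finset.card_pair hxy]; norm_num)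
    simp only [Finset.mem_insert, Finset.mem_singleton, not_or] at hz'
    refine hlt (energy_ge_of_three_pendants hQ hx hy hz ha hb hc hab hac hbc (hind a ha b hb)
      (hind a ha c hc) (hind b hb c hc) ?_ ?_ ?_ ?_ ?_ ?_ ?_ ?_ ?_)
    · exact (hax x hx).2 rfl
    · exact fun h => hxy ((hax y hy).1 h).symm
    · exact fun h => hz'.1 ((hax z hz).1 h)
    · exact (hbx x hx).2 rfl
    · exact fun h => hxy ((hbx y hy).1 h).symm
    · exact fun h => hz'.1 ((hbx z hz).1 h)
    · exact fun h => hxy ((hcy x hx).1 h)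
    · exact (hcy y hy).2 rfl
    · exact fun h => hz'.2 ((hcy z hz).1 h)
  have huniq : ∀ a x y : V, x ∈ Q → (∀ z ∈ Q, G.Adj a z ↔ z = x) → (∀ z ∈ Q, G.Adj a z ↔ z = y) →
      x = y := fun a x y hx h1 h2 => (h2 x hx).1 ((h1 x hx).2 rfl)
  -- Three attached vertices are pendant by the pairwise analysis. They share one foot (a star
  -- K_{1,4}), use two feet of a triangle (`hmix`), or use all three; in the last case three
  -- disjoint edges cover six vertices, so E ≥ 6.
  have hthird : ∀ w ∉ Q, w ≠ u → w ≠ v → ∀ w', ¬ G.Adj w w' := by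
    intro w hw hwu hwv w' hww'
    have hwx := hnb w hw w' hww'
    rcases hpair u v hu hv hvu.symm hux hvx with ⟨x, hx, hux1, hvx1⟩ |
      ⟨h3, x, hx, y, hy, hxy, hux1, hvy1⟩
    · rcases hpair u w hu hw hwu.symm hux hwx with ⟨x', hx', hux2, hwx2⟩ |
        ⟨h3, x', hx', y, hy, hxy, hux2, hwy2⟩
      · have hxx := huniq u x x' hx hux1 hux2
        subst hxx
        obtain ⟨z, hz, huz⟩ := hmax u hu
        have hzx : z ≠ x := fun h => huz ((hux1 z hz).2 h)
        exact hlt (energy_ge_of_star hQ hx hz hu hv hw hvu.symm hwu.symm hwv.symm (hind u hu v hv)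
          (hind u hu w hw) (hind v hv w hw) ((hux1 x hx).2 rfl) huz ((hvx1 x hx).2 rfl)
          (fun h => hzx ((hvx1 z hz).1 h)) ((hwx2 x hx).2 rfl) (fun h => hzx ((hwx2 z hz).1 h)))
      · have hxx := huniq u x x' hx hux1 hux2
        subst hxx
        exact hmix u v w x y hu hv hw hvu.symm hwu.symm hwv.symm hx hy hxy h3 hux1 hvx1 hwy2
    · rcases hpair u w hu hw hwu.symm hux hwx with ⟨x', hx', hux2, hwx2⟩ |
        ⟨-, x', hx', y', hy', hxy', hux2, hwy2⟩
      · have hxx := huniq u x x' hx hux1 hux2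
        subst hxx
        exact hmix u w v x y hu hw hv hwu.symm hvu.symm hwv hx hy hxy h3 hux1 hwx2 hvy1
      · have hxx := huniq u x x' hx hux1 hux2
        subst hxx
        by_cases hyy : y' = y
        · subst hyy
          exact hmix v w u y' x hv hw hu hwv.symm hvu hwu hy hx hxy.symm h3 hvy1 hwy2 hux1
        · have hQe : {x, y, y'} = Q := by
            refine Finset.eq_of_subset_of_card_le ?_ ?_
            · simp [Finset.insert_subset_iff, hx, hy, hy']
            · rw [h3, Finset.card_eq_three.2 ⟨x, y, y', hxy, hxy', Ne.symm hyy, rfl⟩]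
          have hSc : #({u, v, w} : Finset V) = 3 :=
            Finset.card_eq_three.2 ⟨u, v, w, hvu.symm, hwu.symm, hwv.symm, rfl⟩
          refine not_cover_of_energy_lt h {u, v, w} (by simp [hu, hv, hw])
            (fun a => if a = x ∨ a = u then 0 else if a = y ∨ a = v then 1 else 2)
            (fun a _ => ?_) (fun a ha b hb hab heq => ?_)
          · rw [hSc]
            split_ifs <;> norm_num
          · have hux' := (hux1 x hx).2 rfl
            have hvy' := (hvy1 y hy).2 rfl
            have hwy' := (hwy2 y' hy').2 rfl
            have n1 : ∀ a ∈ Q, ∀ b ∉ Q, a ≠ b := fun a ha b hb h => hb (h ▸ ha)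
            have hab' : ∀ c ∈ Q ∪ {u, v, w}, (c = x ∨ c = u) ∨ (c ≠ x ∧ c ≠ u ∧ (c = y ∨ c = v)) ∨
                (c ≠ x ∧ c ≠ u ∧ c ≠ y ∧ c ≠ v ∧ (c = y' ∨ c = w)) := by
              intro c hc
              rw [← hQe] at hc
              simp only [Finset.mem_union, Finset.mem_insert, Finset.mem_singleton] at hc
              tauto
            rcases hab' a ha with h1 | ⟨h1, h2, h3⟩ | ⟨h1, h2, h3, h4, h5⟩ <;>
            rcases hab' b hb with g1 | ⟨g1, g2, g3⟩ | ⟨g1, g2, g3, g4, g5⟩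
            · rcases h1 with rfl | rfl <;> rcases g1 with rfl | rfl
              · exact absurd rfl hab
              · exact hux'.symm
              · exact hux'
              · exact absurd rfl hab
            · simp [h1, g1, g2, g3] at heq
            · simp [h1, g1, g2, g3, g4] at heq
            · simp [h1, h2, h3, g1] at heq
            · rcases h3 with rfl | rfl <;> rcases g3 with rfl | rfl
              · exact absurd rfl hab
              · exact hvy'.symm
              · exact hvy'
              · exact absurd rfl hab
            · simp [h1, h2, h3, g1, g2, g3, g4] at heq
            · simp [h1, h2, h3, h4, g1] at heq
            · simp [h1, h2, h3, h4, g1, g2, g3] at heq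
            · rcases h5 with rfl | rfl <;> rcases g5 with rfl | rfl
              · exact absurd rfl hab
              · exact hwy'.symm
              · exact hwy'
              · exact absurd rfl hab
  rcases hpair u v hu hv hvu.symm hux hvx with ⟨x, hx, hux1, hvx1⟩ |
      ⟨h3, x, hx, y, hy, hxy, hux1, hvy1⟩
  · exact Or.inr (Or.inl ⟨_, hn, isUnionWithIsolated_B hQ hu hv hvu.symm (hind u hu v hv) hx hux1
      hvx1 hthird⟩)
  · exact Or.inr (Or.inr (Or.inr (isUnionWithIsolated_triangleTwoPendants hQ h3 hu hv hvu.symm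
      (hind u hu v hv) hx hy hxy hux1 hvy1 hthird)))

end Classification

/-! ### Upper bounds for the energies of the listed graphs -/

theorem energy_completeGraph_lt {n : ℕ} (hn : 1 ≤ n)
    [DecidableRel (SimpleGraph.completeGraph (Fin n)).Adj] :
    energy (SimpleGraph.completeGraph (Fin n)) < 2 * n := by
  have hq : ∀ x, quadForm (SimpleGraph.completeGraph (Fin n)) x
      = (∑ i, x i) ^ 2 - ∑ i, x i ^ 2 := fun x =>
    quadForm_eq_of_isClique _ (Q := Finset.univ) (fun a _ b _ hab => hab) (by simp)
  have h := energy_lt_of_quadForm (SimpleGraph.completeGraph (Fin n)) {⟨0, hn⟩} (by simp) (n - 1)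
    (by simp; omega) (fun _ => 0) (fun x => by rw [hq]; ring_nf; positivity)
    (fun x hx => by
      rw [hq]
      obtain ⟨i, hi⟩ := Function.ne_iff.1 hx
      have : 0 < ∑ i, x i ^ 2 := Finset.sum_pos' (fun _ _ => sq_nonneg _)
        ⟨i, Finset.mem_univ _, by have : x i ≠ 0 := hi; positivity⟩
      nlinarith [sq_nonneg (∑ i, x i)])
  rw [Nat.cast_sub hn] at h
  simpa using h

/-- The sum of `z i * z j` over all ordered pairs of different indices. -/
theorem sum_ne_mul {n : ℕ} (z : Fin n → ℝ) :
    ∑ i, ∑ j, (if i ≠ j then (1 : ℝ) else 0) * (z i * z j) = (∑ i, z i) ^ 2 - ∑ i, z i ^ 2 := by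
  have : ∀ i j, (if i ≠ j then (1 : ℝ) else 0) * (z i * z j)
      = z i * z j - if i = j then z i * z j else 0 := by
    intro i j
    by_cases h : i = j <;> simp [h]
  simp only [this, Finset.sum_sub_distrib, sq, Finset.sum_mul_sum]
  simp

theorem quadForm_A {n t : ℕ} [DecidableRel (A n t).Adj] (x : Option (Fin n) → ℝ) :
    quadForm (A n t) x = (∑ i, x (some i)) ^ 2 - ∑ i, x (some i) ^ 2 +
      2 * x none * ∑ i : Fin n, (if i.val < t then x (some i) else 0) := by
  simp only [quadForm, Fintype.sum_option, SimpleGraph.adjMatrix_apply, A_adj_none_some,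
    A_adj_some_none, A_adj_some_some, SimpleGraph.irrefl, Finset.sum_add_distrib, sum_ne_mul]
  have h1 : ∑ i : Fin n, (if i.val < t then (1 : ℝ) else 0) * (x none * x (some i))
      = x none * ∑ i : Fin n, (if i.val < t then x (some i) else 0) := by
    rw [Finset.mul_sum]
    exact Finset.sum_congr rfl fun i _ => by split_ifs <;> ring
  have h2 : ∑ i : Fin n, (if i.val < t then (1 : ℝ) else 0) * (x (some i) * x none)
      = x none * ∑ i : Fin n, (if i.val < t then x (some i) else 0) := by
    rw [Finset.mul_sum]
    exact Finset.sum_congr rfl fun i _ => by split_ifs <;> ring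
  rw [h1, h2]
  simp
  ring

theorem energy_A_lt {n t : ℕ} [DecidableRel (A n t).Adj] (ht : 1 ≤ t) (htn : t ≤ n - 1)
    (h : t * (n + 1 - t) < 2 * (n + 1)) : energy (A n t) < 2 * n := by
  obtain ⟨m, rfl⟩ : ∃ m, n = t + m + 1 := ⟨n - t - 1, by omega⟩
  have h' : t * (m + 2) < 2 * (t + m + 2) := by
    have : t + m + 1 + 1 - t = m + 2 := by omega
    rw [this] at h
    linarith
  have hR : (t : ℝ) * (m + 2) < 2 * (t + m + 2) := by exact_mod_cast h'
  have ht0 : (0 : ℝ) < t := by exact_mod_cast ht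
  -- The new vertex and a clique vertex not joined to it are independent, leaving at most n - 1
  -- negative eigenvalues. The correction `r` is the indicator of the neighbours of the new vertex:
  -- it completes A + I to a sum of two squares.
  have key := energy_lt_of_quadForm (A (t + m + 1) t) {none, some (Fin.last (t + m))} (by
      intro i hi j hj
      simp only [Finset.mem_insert, Finset.mem_singleton] at hi hj
      rcases hi with rfl | rfl <;> rcases hj with rfl | rfl
      · simp
      · simp [A_adj_none_some]
      · simp [A_adj_some_none]
      · simp) (t + m) (by
      rw [Finset.card_pair (by simp), Fintype.card_option, Fintype.card_fin]; omega)
    (fun i => i.elim 0 fun i => if i.val < t then 1 else 0)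
    (fun x => by
      rw [quadForm_A]
      simp only [Fintype.sum_option, Option.elim, ite_mul, one_mul, zero_mul, zero_add]
      nlinarith [sq_nonneg (∑ i, x (some i)), sq_nonneg
        (x none + ∑ i : Fin (t + m + 1), (if i.val < t then x (some i) else 0))])
    (fun x hx => by
      rw [quadForm_A, Fintype.sum_option]
      set N := ∑ i : Fin (t + m + 1), (if i.val < t then x (some i) else 0) with hN
      set R := ∑ i : Fin (t + m + 1), (if i.val < t then 0 else x (some i)) with hRdef
      set P := ∑ i : Fin (t + m + 1), (if i.val < t then x (some i) ^ 2 else 0) with hP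
      set P' := ∑ i : Fin (t + m + 1), (if i.val < t then 0 else x (some i) ^ 2) with hP'
      have e1 : ∑ i, x (some i) = N + R := by
        rw [hN, hRdef, ← Finset.sum_add_distrib]
        exact Finset.sum_congr rfl fun i _ => by split_ifs <;> simp
      have e2 : ∑ i, x (some i) ^ 2 = P + P' := by
        rw [hP, hP', ← Finset.sum_add_distrib]
        exact Finset.sum_congr rfl fun i _ => by split_ifs <;> simp
      have hc1 : #(Finset.univ.filter fun i : Fin (t + m + 1) => i.val < t) = t := by
        have : (Finset.univ.filter fun i : Fin (t + m + 1) => i.val < t)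
            = Finset.univ.map (Fin.castLEEmb (by omega : t ≤ t + m + 1)) := by
          ext i
          simp only [Finset.mem_filter, Finset.mem_univ, true_and, Finset.mem_map]
          exact ⟨fun h => ⟨⟨i, h⟩, rfl⟩, fun ⟨a, ha⟩ => ha ▸ a.2⟩
        rw [this, Finset.card_map, Finset.card_univ, Fintype.card_fin]
      have hc2 : #(Finset.univ.filter fun i : Fin (t + m + 1) => ¬ i.val < t) = m + 1 := by
        have := Finset.card_filter_add_card_filter_not
          (s := (Finset.univ : Finset (Fin (t + m + 1)))) (fun i => i.val < t)
        rw [hc1, Finset.card_univ, Fintype.card_fin] at this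
        omega
      have f1 : N ^ 2 ≤ t * P := by
        have h1 := sq_sum_le_card_mul_sum_sq
          (s := Finset.univ.filter fun i : Fin (t + m + 1) => i.val < t) (f := fun i => x (some i))
        rw [hc1, Finset.sum_filter, Finset.sum_filter] at h1
        exact h1
      have f2 : R ^ 2 ≤ (m + 1) * P' := by
        have g1 : R = ∑ i : Fin (t + m + 1) with ¬ i.val < t, x (some i) := by
          rw [hRdef, Finset.sum_filter]
          exact Finset.sum_congr rfl fun i _ => by split_ifs <;> simp_all
        have g2 : P' = ∑ i : Fin (t + m + 1) with ¬ i.val < t, x (some i) ^ 2 := by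
          rw [hP', Finset.sum_filter]
          exact Finset.sum_congr rfl fun i _ => by split_ifs <;> simp_all
        have g3 : ((m : ℝ) + 1) = #(Finset.univ.filter fun i : Fin (t + m + 1) => ¬ i.val < t) := by
          rw [hc2]; push_cast; ring
        rw [g1, g2, g3]
        exact sq_sum_le_card_mul_sum_sq
      have hP0 : 0 ≤ P := Finset.sum_nonneg fun i _ => by split_ifs <;> positivity
      have hP0' : 0 ≤ P' := Finset.sum_nonneg fun i _ => by split_ifs <;> positivity
      rw [e1, e2]
      by_cases hN0 : N = 0
      · rw [hN0]
        have hpos : 0 < P + P' + x none ^ 2 := by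
          obtain ⟨i, hi⟩ := Function.ne_iff.1 hx
          rcases i with _ | i
          · have : 0 < x none ^ 2 := by have : x none ≠ 0 := hi; positivity
            linarith
          · have : 0 < ∑ i, x (some i) ^ 2 := Finset.sum_pos' (fun _ _ => sq_nonneg _)
              ⟨i, Finset.mem_univ _, by have : x (some i) ≠ 0 := hi; positivity⟩
            linarith [sq_nonneg (x none)]
        nlinarith [sq_nonneg R, sq_nonneg (x none)]
      · have hm : (0 : ℝ) < m + 1 := by positivity
        have g1 : N ^ 2 / t ≤ P := by rw [div_le_iff₀ ht0]; linarith
        have g2 : R ^ 2 / (m + 1) ≤ P' := by rw [div_le_iff₀ hm]; linarith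
        -- This is the minimum over `R`. Together with the minimum over `x none`, attained at -N/2,
        -- positivity of A + 2I becomes 1/t + 1/(m + 2) > 1/2, which is the hypothesis because m + 2
        -- = n + 1 - t.
        have g3 : N ^ 2 / (m + 2) ≤ (N + R) ^ 2 + R ^ 2 / (m + 1) := by
          have : (N + R) ^ 2 + R ^ 2 / (m + 1) - N ^ 2 / (m + 2)
              = ((m + 2) * R + (m + 1) * N) ^ 2 / ((m + 1) * (m + 2)) := by
            field_simp
            ring
          have h2 : 0 ≤ ((m + 2) * R + (m + 1) * N) ^ 2 / (((m : ℝ) + 1) * (m + 2)) := by positivity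
          linarith
        have g4 : N ^ 2 / 2 < N ^ 2 / t + N ^ 2 / (m + 2) := by
          have hpos : 0 < N ^ 2 := by positivity
          rw [div_add_div _ _ ht0.ne' (by positivity), div_lt_div_iff₀ (by norm_num) (by positivity)]
          nlinarith
        nlinarith [sq_nonneg (x none + N / 2)])
  push_cast at key ⊢
  linarith

theorem quadForm_B {n : ℕ} [DecidableRel (B (n + 1)).Adj] (x : Fin (n + 1) ⊕ Fin 2 → ℝ) :
    quadForm (B (n + 1)) x = (∑ i, x (Sum.inl i)) ^ 2 - ∑ i, x (Sum.inl i) ^ 2 +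
      2 * x (Sum.inl 0) * (x (Sum.inr 0) + x (Sum.inr 1)) := by
  have h1 : ∀ y : ℝ, ∑ i : Fin (n + 1), (if i.val = 0 then (1 : ℝ) else 0) * (x (Sum.inl i) * y)
      = x (Sum.inl 0) * y := by
    intro y
    rw [Fin.sum_univ_succ]
    simp
  have h2 : ∀ y : ℝ, ∑ i : Fin (n + 1), (if i.val = 0 then (1 : ℝ) else 0) * (y * x (Sum.inl i))
      = x (Sum.inl 0) * y := by
    intro y
    rw [← h1]
    exact Finset.sum_congr rfl fun i _ => by ring
  simp only [quadForm, Fintype.sum_sum_type, SimpleGraph.adjMatrix_apply, B_adj_inl_inl,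
    B_adj_inl_inr, B_adj_inr_inl, B_not_adj_inr_inr, Finset.sum_add_distrib, sum_ne_mul,
    Fin.sum_univ_two, h1, h2]
  simp
  ring

theorem energy_B_lt {n k : ℕ} [DecidableRel (B (n + 1)).Adj] (I : Finset (Fin (n + 1) ⊕ Fin 2))
    (hI : ∀ i ∈ I, ∀ j ∈ I, ¬ (B (n + 1)).Adj i j) (hk : n + 3 ≤ #I + k) :
    energy (B (n + 1)) < 2 * (k + 1) := by
  -- With z at the vertex carrying the pendants and a, b at the pendants, A + I plus the correction
  -- 4z² is S² + (z + a)² + (z + b)² + 2z², where S is the sum over the clique.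
  refine energy_lt_of_quadForm (B (n + 1)) I hI k (by simpa [add_assoc] using hk)
    (fun i => if i = Sum.inl 0 then 2 else 0) (fun x => ?_) (fun x hx => ?_)
  · rw [quadForm_B, Fintype.sum_sum_type, Fin.sum_univ_two]
    simp only [ite_mul, zero_mul, Finset.sum_ite_eq', Finset.mem_univ, if_true]
    nlinarith [sq_nonneg (∑ i, x (Sum.inl i)), sq_nonneg (x (Sum.inl 0) + x (Sum.inr 0)),
      sq_nonneg (x (Sum.inl 0) + x (Sum.inr 1)), sq_nonneg (x (Sum.inl 0))]
  · rw [quadForm_B, Fintype.sum_sum_type, Fin.sum_univ_two, Fin.sum_univ_succ, Fin.sum_univ_succ]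
    have hsq : ∀ i : Fin n, 0 ≤ x (Sum.inl i.succ) ^ 2 := fun _ => sq_nonneg _
    set z := x (Sum.inl 0)
    set a := x (Sum.inr 0)
    set b := x (Sum.inr 1)
    set s := ∑ i : Fin n, x (Sum.inl i.succ)
    set q := ∑ i : Fin n, x (Sum.inl i.succ) ^ 2 with hq
    have hq0 : 0 ≤ q := Finset.sum_nonneg fun i _ => hsq i
    by_contra hle
    push Not at hle
    have e1 : (z + s) ^ 2 + q + 2 * (a + z / 2) ^ 2 + 2 * (b + z / 2) ^ 2 ≤ 0 := by
      nlinarith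
    have e2 := sq_nonneg (z + s)
    have e3 := sq_nonneg (a + z / 2)
    have e4 := sq_nonneg (b + z / 2)
    have hq1 : q = 0 := by linarith
    have hzero : ∀ i : Fin n, x (Sum.inl i.succ) = 0 := fun i =>
      pow_eq_zero_iff (two_ne_zero) |>.1
        ((Finset.sum_eq_zero_iff_of_nonneg fun i _ => hsq i).1 hq1 i (Finset.mem_univ _))
    have hs : s = 0 := Finset.sum_eq_zero fun i _ => hzero i
    have hz : z = 0 := by
      have : (z + s) ^ 2 = 0 := by linarith
      rw [hs, add_zero] at this
      exact pow_eq_zero_iff two_ne_zero |>.1 this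
    have ha : a = 0 := by
      have : (a + z / 2) ^ 2 = 0 := by linarith
      rw [hz] at this
      simpa using this
    have hb : b = 0 := by
      have : (b + z / 2) ^ 2 = 0 := by linarith
      rw [hz] at this
      simpa using this
    refine hx (funext fun i => ?_)
    rcases i with i | i
    · refine Fin.cases hz hzero i
    · fin_cases i
      · exact ha
      · exact hb

/-- The sum of two rank-one forms with nonnegative coefficients is positive semidefinite. -/
theorem sum_rank_one_nonneg {ι : Type*} [Fintype ι] {c d : ℝ} (hc : 0 ≤ c) (hd : 0 ≤ d)
    (u v x : ι → ℝ) : 0 ≤ ∑ i, ∑ j, (c * (u i * u j) + d * (v i * v j)) * (x i * x j) := by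
  have : ∑ i, ∑ j, (c * (u i * u j) + d * (v i * v j)) * (x i * x j)
      = c * (∑ i, u i * x i) ^ 2 + d * (∑ i, v i * x i) ^ 2 := by
    rw [sq, sq, Finset.sum_mul_sum, Finset.sum_mul_sum, Finset.mul_sum, Finset.mul_sum,
      ← Finset.sum_add_distrib]
    refine Finset.sum_congr rfl fun i _ => ?_
    rw [Finset.mul_sum, Finset.mul_sum, ← Finset.sum_add_distrib]
    exact Finset.sum_congr rfl fun j _ => by ring
  rw [this]
  positivity

theorem energy_triangleTwoPendants_lt [DecidableRel triangleTwoPendants.Adj] :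
    energy triangleTwoPendants < 6 := by
  -- The first vectors of both matrices are antisymmetric, the second ones symmetric, under the
  -- reflection of the graph; they are rational substitutes for eigenvectors. The traces add up to
  -- 773/132 < 6.
  refine lt_of_le_of_lt (energy_le_of_sub_psd triangleTwoPendants
    (fun i j => 1 / 16 * ((![1, -1, 0, 2, -2] : Fin 5 → ℝ) i * (![1, -1, 0, 2, -2] : Fin 5 → ℝ) j)
      + 1 / 66 * ((![7, 7, 6, 3, 3] : Fin 5 → ℝ) i * (![7, 7, 6, 3, 3] : Fin 5 → ℝ) j))
    (fun i j => 1 / 16 * ((![3, -3, 0, -2, 2] : Fin 5 → ℝ) i * (![3, -3, 0, -2, 2] : Fin 5 → ℝ) j)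
      + 1 / 66 * ((![4, 4, -6, -3, -3] : Fin 5 → ℝ) i * (![4, 4, -6, -3, -3] : Fin 5 → ℝ) j))
    ?_ (fun x => sum_rank_one_nonneg (by norm_num) (by norm_num) _ _ x)
    (fun x => sum_rank_one_nonneg (by norm_num) (by norm_num) _ _ x)) ?_
  · intro i j
    fin_cases i <;> fin_cases j <;>
      simp [SimpleGraph.adjMatrix_apply, triangleTwoPendants_adj, listAdj] <;> norm_num
  · simp [Fin.sum_univ_succ]
    norm_num

theorem energy_completeBipartite_lt
    [DecidableRel (completeBipartiteGraph (Fin 2) (Fin 4)).Adj] :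
    energy (completeBipartiteGraph (Fin 2) (Fin 4)) < 6 := by
  -- The true eigenvectors have ratio √2 between the sides; replacing it by 3/2 gives 17/3 < 6. The
  -- zero terms only fit the shape of `sum_rank_one_nonneg`.
  refine lt_of_le_of_lt (energy_le_of_sub_psd _
    (fun i j => 1 / 12 * (Sum.elim (fun _ => (3 : ℝ)) (fun _ => 2) i *
        Sum.elim (fun _ => (3 : ℝ)) (fun _ => 2) j) + 0 * ((1 : ℝ) * 1))
    (fun i j => 1 / 12 * (Sum.elim (fun _ => (3 : ℝ)) (fun _ => -2) i *
        Sum.elim (fun _ => (3 : ℝ)) (fun _ => -2) j) + 0 * ((1 : ℝ) * 1))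
    ?_ (fun x => sum_rank_one_nonneg (by norm_num) le_rfl _ (fun _ => 1) x)
    (fun x => sum_rank_one_nonneg (by norm_num) le_rfl _ (fun _ => 1) x)) ?_
  · rintro (i | i) (j | j) <;> simp [SimpleGraph.adjMatrix_apply] <;> norm_num
  · simp
    norm_num

/-! ### Comparison with the choice number -/

variable {V : Type*} [Fintype V] [DecidableEq V] {G : SimpleGraph V} [DecidableRel G.Adj]

theorem energy_lt_of_completeGraph {n : ℕ} (hn : 1 ≤ n)
    (h : IsUnionWithIsolated G (SimpleGraph.completeGraph (Fin n))) :
    energy G < 2 * (choiceNumber G : ℝ) := by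
  classical
  obtain ⟨f, -, hf⟩ := exists_embedding_of_isUnionWithIsolated h
  have hch : n ≤ choiceNumber G := le_choiceNumber_of_clique f fun a b hab => (hf a b).2 hab
  have hch' : (n : ℝ) ≤ choiceNumber G := by exact_mod_cast hch
  rw [energy_eq_of_isUnionWithIsolated h]
  linarith [energy_completeGraph_lt hn]

theorem energy_lt_of_A {n t : ℕ} (ht : 1 ≤ t) (htn : t ≤ n - 1)
    (hnt : (n ≤ 7 ∧ (n, t) ≠ (7, 4)) ∨ (8 ≤ n ∧ (t = 1 ∨ t = 2 ∨ t = n - 1)))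
    (h : IsUnionWithIsolated G (A n t)) : energy G < 2 * (choiceNumber G : ℝ) := by
  classical
  obtain ⟨f, -, hf⟩ := exists_embedding_of_isUnionWithIsolated h
  have hch : n ≤ choiceNumber G := le_choiceNumber_of_clique (fun i => f (some i)) fun a b hab =>
    (hf _ _).2 (A_adj_some_some.2 hab)
  have hch' : (n : ℝ) ≤ choiceNumber G := by exact_mod_cast hch
  -- With s = n + 1 - t this says (t - 2)(s - 2) < 4. For t, s ≥ 3 it holds exactly when t + s ≤ 8
  -- and (t, s) ≠ (4, 4).
  have key : t * (n + 1 - t) < 2 * (n + 1) := by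
    rcases hnt with ⟨h7, hne⟩ | ⟨h8, rfl | rfl | rfl⟩
    · have ht7 : t ≤ 6 := by omega
      rw [ne_eq, Prod.mk.injEq] at hne
      interval_cases t <;> omega
    · omega
    · omega
    · have : n + 1 - (n - 1) = 2 := by omega
      rw [this]
      omega
  rw [energy_eq_of_isUnionWithIsolated h]
  linarith [energy_A_lt ht htn key]

theorem energy_lt_of_B {n : ℕ} (hn : 1 ≤ n) (h : IsUnionWithIsolated G (B n)) :
    energy G < 2 * (choiceNumber G : ℝ) := by
  classical
  obtain ⟨f, -, hf⟩ := exists_embedding_of_isUnionWithIsolated h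
  rw [energy_eq_of_isUnionWithIsolated h]
  obtain ⟨m, rfl⟩ : ∃ m, n = m + 1 := ⟨n - 1, by omega⟩
  -- B_1 is a path on three vertices, where the clique to use is an edge and not K_1. For larger n a
  -- further clique vertex joins the two pendants in the independent set.
  rcases Nat.eq_zero_or_pos m with rfl | hm
  · have hch : 2 ≤ choiceNumber G := le_choiceNumber_of_clique
      (f ∘ ![Sum.inl 0, Sum.inr 0]) fun a b hab => by
        rw [Function.comp_apply, Function.comp_apply, hf]
        fin_cases a <;> fin_cases b
        · exact absurd rfl hab
        · exact B_adj_inl_inr.2 rfl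
        · exact B_adj_inr_inl.2 rfl
        · exact absurd rfl hab
    have hch' : (2 : ℝ) ≤ choiceNumber G := by exact_mod_cast hch
    have := energy_B_lt (n := 0) (k := 1) {Sum.inr 0, Sum.inr 1} (by
      intro i hi j hj
      simp only [Finset.mem_insert, Finset.mem_singleton] at hi hj
      rcases hi with rfl | rfl <;> rcases hj with rfl | rfl <;> exact B_not_adj_inr_inr) (by
      rw [Finset.card_pair (by simp)])
    push_cast at this
    linarith
  · have hch : m + 1 ≤ choiceNumber G := le_choiceNumber_of_clique (fun i => f (Sum.inl i))
      fun a b hab => (hf _ _).2 (B_adj_inl_inl.2 hab)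
    have hch' : (m : ℝ) + 1 ≤ choiceNumber G := by exact_mod_cast hch
    have := energy_B_lt (n := m) (k := m) {Sum.inr 0, Sum.inr 1, Sum.inl (Fin.last m)} (by
      have hl : (Fin.last m).val ≠ 0 := by simp; omega
      intro i hi j hj
      simp only [Finset.mem_insert, Finset.mem_singleton] at hi hj
      rcases hi with rfl | rfl | rfl <;> rcases hj with rfl | rfl | rfl <;>
        simp only [B_not_adj_inr_inr, B_adj_inl_inr, B_adj_inr_inl, hl, SimpleGraph.irrefl,
          not_false_eq_true]) (by
      rw [Finset.card_eq_three.2 ⟨Sum.inr 0, Sum.inr 1, Sum.inl (Fin.last m), by simp, by simp,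
        by simp, rfl⟩]
      omega)
    linarith

theorem energy_lt_of_triangleTwoPendants (h : IsUnionWithIsolated G triangleTwoPendants) :
    energy G < 2 * (choiceNumber G : ℝ) := by
  classical
  obtain ⟨f, -, hf⟩ := exists_embedding_of_isUnionWithIsolated h
  have hch : 3 ≤ choiceNumber G := le_choiceNumber_of_clique (f ∘ ![0, 1, 2]) fun a b hab => by
    rw [Function.comp_apply, Function.comp_apply, hf, triangleTwoPendants_adj]
    revert hab
    revert a b
    decide
  have hch' : (3 : ℝ) ≤ choiceNumber G := by exact_mod_cast hch
  rw [energy_eq_of_isUnionWithIsolated h]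
  linarith [energy_triangleTwoPendants_lt]

theorem energy_lt_of_completeBipartite
    (h : IsUnionWithIsolated G (completeBipartiteGraph (Fin 2) (Fin 4))) :
    energy G < 2 * (choiceNumber G : ℝ) := by
  classical
  obtain ⟨f, hinj, hf⟩ := exists_embedding_of_isUnionWithIsolated h
  have hch : 3 ≤ choiceNumber G :=
    three_le_choiceNumber_completeBipartite f hinj fun a b => (hf a b).2
  have hch' : (3 : ℝ) ≤ choiceNumber G := by exact_mod_cast hch
  rw [energy_eq_of_isUnionWithIsolated h]
  linarith [energy_completeBipartite_lt]

end GraphEnergy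

theorem theorem2 {V : Type*} [Fintype V] [DecidableEq V] (G : SimpleGraph V)
    [DecidableRel G.Adj] :
    GraphEnergy.energy G < 2 * (GraphEnergy.choiceNumber G : ℝ) ↔
      (∃ n : ℕ, 1 ≤ n ∧
        GraphEnergy.IsUnionWithIsolated G (SimpleGraph.completeGraph (Fin n))) ∨
      (∃ n : ℕ, 1 ≤ n ∧ GraphEnergy.IsUnionWithIsolated G (GraphEnergy.B n)) ∨
      (∃ n t : ℕ, 1 ≤ t ∧ t ≤ n - 1 ∧
        ((n ≤ 7 ∧ (n, t) ≠ (7, 4)) ∨ (8 ≤ n ∧ (t = 1 ∨ t = 2 ∨ t = n - 1))) ∧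
        GraphEnergy.IsUnionWithIsolated G (GraphEnergy.A n t)) ∨
      GraphEnergy.IsUnionWithIsolated G GraphEnergy.triangleTwoPendants ∨
      GraphEnergy.IsUnionWithIsolated G (completeBipartiteGraph (Fin 2) (Fin 4)) := by
  constructor
  · intro h
    rcases GraphEnergy.exists_clique_or_completeBipartite G h with ⟨Q, hQ, hQc⟩ | h1
    · rcases GraphEnergy.classification_of_clique hQ hQc (by rw [hQc]; exact h) with
        h1 | h1 | h1 | h1
      · exact Or.inl h1
      · exact Or.inr (Or.inl h1)
      · exact Or.inr (Or.inr (Or.inl h1))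
      · exact Or.inr (Or.inr (Or.inr (Or.inl h1)))
    · exact Or.inr (Or.inr (Or.inr (Or.inr h1)))
  · rintro (⟨n, hn, h⟩ | ⟨n, hn, h⟩ | ⟨n, t, ht, htn, hnt, h⟩ | h | h)
    · exact GraphEnergy.energy_lt_of_completeGraph hn h
    · exact GraphEnergy.energy_lt_of_B hn h
    · exact GraphEnergy.energy_lt_of_A ht htn hnt h
    · exact GraphEnergy.energy_lt_of_triangleTwoPendants h
    · exact GraphEnergy.energy_lt_of_completeBipartite h
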